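/- Let $N\ge 8$ and consider $N$ spins $1/2$ on a ring (sites $j$ are integers modulo $N$; periodic boundary conditions), with Pauli matrices $X_j,Y_j,Z_j$ acting on site $j$. Up to a positive factor and a multiple of the identity, the periodic Fredkin Hamiltonian is $H=\sum_{j}\bigl(H^{(2)}_j+H^{(3)}_j\bigr)$ with $$H^{(2)}_j=-2\,(X_jX_{j+1}+Y_jY_{j+1}+Z_jZ_{j+1}),$$ $$H^{(3)}_j=X_jX_{j+1}Z_{j+2}+Y_jY_{j+1}Z_{j+2}-Z_jX_{j+1}X_{j+2}-Z_jY_{j+1}Y_{j+2}.$$ Let $R$ be a nonempty subset of the four three-site terms of $H^{(3)}_j$, and let $H_R$ be the truncated Fredkin Hamiltonian obtained from $H$ by removing the terms in $R$ at every site $j$. A Pauli string of length $l$ starting at site $j$ is a product $\mathbf A_j=A^1_jA^2_{j+1}\cdots A^l_{j+l-1}$ with letters $A^i\in\{I,X,Y,Z\}$ whose first and last letters are not $I$. A (translation invariant) $k$-local operator is one of the form $Q=\sum_{l=1}^{k}\sum_{j}\sum_{\mathbf A}q_{\mathbf A}\,\mathbf A_j$, where $\mathbf A$ runs over the Pauli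 strings of length $l$, the coefficients $q_{\mathbf A}\in\mathbb C$ do not depend on $j$, and $q_{\mathbf A}\neq 0$ for at least one $\mathbf A$ of length $k$. A nontrivial local conserved charge of a Hamiltonian is a $k$-local operator with $4\le k\le N/2$ that commutes with it. Then $H_R$ has a nontrivial local conserved charge if and only if $R$ consists of all four three-site terms, in which case $H_R=\sum_jH^{(2)}_j$ is the Hamiltonian of the Heisenberg XXX chain. Consequently, if at least one three-site term is kept, $H_R$ has no $k$-local conserved charge for any $k$ with $4\le k\le N/2$. -/

import Mathlib

/-! Spin-1/2 chains on a ring of `N` sites (`ZMod N`), i.e. with periodic boundary conditions. -/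

namespace FredkinChain

/-- The labels of the one-site operators: the identity and the three Pauli matrices. -/
inductive Pauli
  | I
  | X
  | Y
  | Z
  deriving DecidableEq

instance : Fintype Pauli :=
  ⟨{Pauli.I, Pauli.X, Pauli.Y, Pauli.Z}, fun p => by cases p <;> decide⟩

/-- The corresponding `2 × 2` matrices; index `0` is spin up, index `1` is spin down. -/
noncomputable def Pauli.mat : Pauli → Matrix (Fin 2) (Fin 2) ℂ
  | .I => !![1, 0; 0, 1]
  | .X => !![0, 1; 1, 0]
  | .Y => !![0, -Complex.I; Complex.I, 0]
  | .Z => !![1, 0; 0, -1]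

/-- Operators on the Hilbert space `(ℂ²)^{⊗N}` of the ring, as matrices in the basis of spin
configurations. -/
abbrev Op (N : ℕ) := Matrix (ZMod N → Fin 2) (ZMod N → Fin 2) ℂ

/-- The tensor product `⨂ₓ P x` of one-site operators over all the sites of the ring. -/
noncomputable def pauliOp (N : ℕ) [NeZero N] (P : ZMod N → Pauli) : Op N :=
  Matrix.of fun s t => ∏ x, (P x).mat (s x) (t x)

/-- For a string `A` of length `l ≤ N`, the operator on the ring that acts as the `i`-th letter of
`A` (counting from `0`) on the site `j + i` for `i < l`, and as the identity on all other sites. -/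
noncomputable def stringOp (N : ℕ) [NeZero N] {l : ℕ} (j : ZMod N) (A : Fin l → Pauli) : Op N :=
  pauliOp N fun x => if h : (x - j).val < l then A ⟨(x - j).val, h⟩ else Pauli.I

/-- `A` is a Pauli string of length exactly `l`: its first and its last letter belong to
`{X, Y, Z}`. -/
def IsPauliString {l : ℕ} (A : Fin l → Pauli) : Prop :=
  ∀ i : Fin l, (i.val = 0 ∨ i.val + 1 = l) → A i ≠ Pauli.I

instance {l : ℕ} (A : Fin l → Pauli) : Decidable (IsPauliString A) := by
  unfold IsPauliString; infer_instance

/-- The translation invariant operator `∑_{l=1}^{k} ∑_j ∑_A q_A A_j`, where `A` runs over the Pauli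
strings of length `l`, with coefficients `q`. -/
noncomputable def chargeOfCoeffs (N : ℕ) [NeZero N] (k : ℕ)
    (q : (l : ℕ) → (Fin l → Pauli) → ℂ) : Op N :=
  ∑ l ∈ Finset.Icc 1 k, ∑ j : ZMod N, ∑ A : Fin l → Pauli with IsPauliString A,
    q l A • stringOp N j A

/-- `Q` is a (translation invariant) `k`-local operator: a combination of Pauli strings of length at
most `k` in which some string of length exactly `k` has a nonzero coefficient. -/
def IsKLocal (N : ℕ) [NeZero N] (k : ℕ) (Q : Op N) : Prop :=
  ∃ q : (l : ℕ) → (Fin l → Pauli) → ℂ,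
    Q = chargeOfCoeffs N k q ∧ ∃ A : Fin k → Pauli, IsPauliString A ∧ q k A ≠ 0

/-- `Q` is a `k`-local conserved charge of the Hamiltonian `H`. -/
def IsKLocalConservedCharge (N : ℕ) [NeZero N] (k : ℕ) (H Q : Op N) : Prop :=
  IsKLocal N k Q ∧ ⁅Q, H⁆ = 0

/-- `H` has a nontrivial local conserved charge: a `k`-local one with `4 ≤ k ≤ N / 2`. -/
def HasNontrivialLocalCharge (N : ℕ) [NeZero N] (H : Op N) : Prop :=
  ∃ k : ℕ, 4 ≤ k ∧ 2 * k ≤ N ∧ ∃ Q : Op N, IsKLocalConservedCharge N k H Q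

/-- The nearest-neighbour density `-2 (X_j X_{j+1} + Y_j Y_{j+1} + Z_j Z_{j+1})`. -/
noncomputable def density2 (N : ℕ) [NeZero N] (j : ZMod N) : Op N :=
  (-2 : ℂ) • (stringOp N j ![Pauli.X, Pauli.X] + stringOp N j ![Pauli.Y, Pauli.Y]
    + stringOp N j ![Pauli.Z, Pauli.Z])

/-- The Hamiltonian of the Heisenberg XXX chain on the ring. -/
noncomputable def xxxHamiltonian (N : ℕ) [NeZero N] : Op N := ∑ j : ZMod N, density2 N j

/-- The names of the four three-site terms of the Fredkin Hamiltonian. -/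
inductive ThreeSiteTerm
  | XXZ
  | YYZ
  | ZXX
  | ZYY
  deriving DecidableEq

instance : Fintype ThreeSiteTerm :=
  ⟨{ThreeSiteTerm.XXZ, ThreeSiteTerm.YYZ, ThreeSiteTerm.ZXX, ThreeSiteTerm.ZYY},
    fun t => by cases t <;> decide⟩

/-- The three-site terms
`X_j X_{j+1} Z_{j+2}`, `Y_j Y_{j+1} Z_{j+2}`, `-Z_j X_{j+1} X_{j+2}`, `-Z_j Y_{j+1} Y_{j+2}`. -/
noncomputable def ThreeSiteTerm.op (N : ℕ) [NeZero N] (j : ZMod N) : ThreeSiteTerm → Op N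
  | .XXZ => stringOp N j ![Pauli.X, Pauli.X, Pauli.Z]
  | .YYZ => stringOp N j ![Pauli.Y, Pauli.Y, Pauli.Z]
  | .ZXX => -stringOp N j ![Pauli.Z, Pauli.X, Pauli.X]
  | .ZYY => -stringOp N j ![Pauli.Z, Pauli.Y, Pauli.Y]

/-- The periodic Fredkin Hamiltonian (up to a positive factor and a multiple of the identity) from
which the three-site terms in `R` have been removed, at every site of the ring. -/
noncomputable def truncatedFredkin (N : ℕ) [NeZero N] (R : Finset ThreeSiteTerm) : Op N :=
  ∑ j : ZMod N, (density2 N j + ∑ t ∈ Rᶜ, t.op N j)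

end FredkinChain

namespace FredkinChain

/-! Expand a charge in the basis of Pauli operators. Commuting with the Hamiltonian is a linear
system: for every Pauli operator `O`, the signed sum of the coefficients of `O * h`, over all terms
`h` at all sites that anticommute with `O`, is zero. Only products with support in a window of
length `k` matter, so the useful `O` have length `k + 2`, `k + 1` or `k`. Since `2 * k ≤ N`, these
equations do not see that the chain closes up, and can be written for words indexed by `ℕ`
(`RingCharge.windowCharge`).

Length `k + 2`: if a three-site term is appended at the right end of a word of length `k`, the only
other way back to length `k` is to remove a three-site term at the left end. Hence a nonzero
coefficient is passed on to a word slid by two sites (`WindowCharge.eqn_slide`). The appended terms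
can be chosen freely, while the removed ones must match the letters met. Repeating this
(`WindowCharge.exists_run`) reads the word like an automaton: first its own letters, then those of
the chosen terms. The reading gets stuck, or ends in one of a few periodic words.

The essential periodic word is `XXYXY⋯XZ` with `k` odd, a chain of copies of `XXZ` overlapping at
one site (`Z * X = Y`). It slides to itself, so equations of length `k + 2` cannot kill it.
Equations of length `k + 1` express certain words of length `k - 1` through it. Equations of length
`k`, for the word with `I`, `Z` in place of `Y`, `X` at one position (`WindowCharge.hole_eqn`), form
a recursion in that position, driven by the two-site terms `XX` and `YY`. The recursion telescopes
to a nonzero multiple of `κ .XXZ + κ .YYZ` times the coefficient, which therefore vanishes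
(`WindowCharge.altWord_eq_zero`).

Reflection and the exchange of `X` and `Y` reduce everything to four cases: `XXZ` and `YYZ` present
with `ZXX` or `ZYY` missing; only `XXZ` and `ZYY`; only `XXZ` and `ZXX`; only `XXZ`. Each has its
own choice of appended terms. So no string of length `k` survives.

Conversely, for the XXX chain the sum over the sites of `σ_j·σ_{j+2} + (σ_j × σ_{j+1})·(σ_{j+2} ×
σ_{j+3})` is a charge with `k = 4`. Its commutator involves finitely many strings up to translation,
and their cancellation is a finite computation. -/

section

/-! ### Multiplication of Pauli letters up to phases -/

/-- The product of Pauli letters, up to a phase: the Klein four-group. -/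
def Pauli.mul : Pauli → Pauli → Pauli
  | .I, q => q
  | .X, .I => .X
  | .X, .X => .I
  | .X, .Y => .Z
  | .X, .Z => .Y
  | .Y, .I => .Y
  | .Y, .X => .Z
  | .Y, .Y => .I
  | .Y, .Z => .X
  | .Z, .I => .Z
  | .Z, .X => .Y
  | .Z, .Y => .X
  | .Z, .Z => .I

instance : Mul Pauli := ⟨Pauli.mul⟩

instance : One Pauli := ⟨Pauli.I⟩

instance : CommGroup Pauli where
  mul_assoc := by decide
  one_mul := by decide
  mul_one := by decide
  inv := id
  inv_mul_cancel := by decide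
  mul_comm := by decide

/-- The orientation of a pair of letters: `p q = i (sign p q) (p * q)` if `p` and `q` anticommute,
and `sign p q = 0` if they commute. -/
def Pauli.sign : Pauli → Pauli → ℤ
  | .X, .Y => 1
  | .Y, .Z => 1
  | .Z, .X => 1
  | .Y, .X => -1
  | .Z, .Y => -1
  | .X, .Z => -1
  | _, _ => 0

/-- The phase of the product of two Pauli matrices. -/
noncomputable def Pauli.phase (p q : Pauli) : ℂ :=
  if p.sign q = 0 then 1 else Complex.I * p.sign q

theorem Pauli.mat_mul_mat (p q : Pauli) : p.mat * q.mat = p.phase q • (p * q).mat := by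
  change _ = _ • (Pauli.mul p q).mat
  cases p <;> cases q <;>
    (ext i j; fin_cases i <;> fin_cases j <;>
      simp [Pauli.mat, Pauli.phase, Pauli.sign, Pauli.mul])

theorem Pauli.trace_mat (p : Pauli) : p.mat.trace = if p = .I then 2 else 0 := by
  cases p <;> simp [Pauli.mat, Matrix.trace, one_add_one_eq_two]

theorem Pauli.I_eq_one : Pauli.I = 1 := rfl

theorem Pauli.mul_self (p : Pauli) : p * p = .I := by revert p; decide

theorem Pauli.mul_eq_I {p q : Pauli} : p * q = .I ↔ p = q := by revert p q; decide

@[simp] theorem Pauli.mul_I (p : Pauli) : p * .I = p := mul_one p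

@[simp] theorem Pauli.I_mul (p : Pauli) : .I * p = p := one_mul p

theorem Pauli.mul_mul_self (p q : Pauli) : p * q * q = p := by revert p q; decide

@[simp] theorem Pauli.sign_I (p : Pauli) : p.sign .I = 0 := by cases p <;> rfl

@[simp] theorem Pauli.I_sign (p : Pauli) : Pauli.I.sign p = 0 := rfl

@[simp] theorem Pauli.phase_I (p : Pauli) : p.phase .I = 1 := by simp [Pauli.phase]

@[simp] theorem Pauli.I_phase (p : Pauli) : Pauli.I.phase p = 1 := by simp [Pauli.phase]

/-! ### Tensor products -/

/-- The tensor product of one-site operators. -/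
noncomputable def tensorOp {N : ℕ} [NeZero N] (M : ZMod N → Matrix (Fin 2) (Fin 2) ℂ) : Op N :=
  Matrix.of fun s t => ∏ x, M x (s x) (t x)

variable {N : ℕ} [NeZero N]

theorem tensorOp_mul (M M' : ZMod N → Matrix (Fin 2) (Fin 2) ℂ) :
    tensorOp M * tensorOp M' = tensorOp fun x => M x * M' x := by
  ext s t
  simp only [tensorOp, Matrix.mul_apply, Matrix.of_apply]
  rw [Finset.prod_univ_sum, Fintype.piFinset_univ]
  exact Finset.sum_congr rfl fun u _ => Finset.prod_mul_distrib.symm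

theorem trace_tensorOp (M : ZMod N → Matrix (Fin 2) (Fin 2) ℂ) :
    (tensorOp M).trace = ∏ x, (M x).trace := by
  simp only [tensorOp, Matrix.trace, Matrix.diag_apply, Matrix.of_apply]
  rw [Finset.prod_univ_sum, Fintype.piFinset_univ]

theorem tensorOp_smul (r : ZMod N → ℂ) (M : ZMod N → Matrix (Fin 2) (Fin 2) ℂ) :
    (tensorOp fun x => r x • M x) = (∏ x, r x) • tensorOp M := by
  ext s t
  simp [tensorOp, Finset.prod_mul_distrib]

theorem pauliOp_mul (P P' : ZMod N → Pauli) :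
    pauliOp N P * pauliOp N P' = (∏ x, (P x).phase (P' x)) • pauliOp N (P * P') := by
  change tensorOp (fun x => (P x).mat) * tensorOp (fun x => (P' x).mat)
    = _ • tensorOp (fun x => (P x * P' x).mat)
  rw [tensorOp_mul, ← tensorOp_smul]
  simp only [Pauli.mat_mul_mat]

theorem trace_pauliOp (P : ZMod N → Pauli) :
    (pauliOp N P).trace = if P = 1 then 2 ^ N else 0 := by
  change (tensorOp (fun x => (P x).mat)).trace = _
  rw [trace_tensorOp]
  simp only [Pauli.trace_mat]
  split_ifs with h
  · subst h
    simp [Pauli.I_eq_one, ZMod.card]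
  · obtain ⟨x, hx⟩ := Function.ne_iff.1 h
    exact Finset.prod_eq_zero (Finset.mem_univ x) (if_neg hx)

theorem Pauli.phase_self (p : Pauli) : p.phase p = 1 := by
  cases p <;> simp [Pauli.phase, Pauli.sign]

/-- The Pauli operators on the ring are linearly independent. -/
theorem eq_zero_of_sum_pauliOp_eq_zero {f : (ZMod N → Pauli) → ℂ}
    (h : ∑ P, f P • pauliOp N P = 0) (O : ZMod N → Pauli) : f O = 0 := by
  have h1 : ((∑ P, f P • pauliOp N P) * pauliOp N O).trace = 0 := by rw [h]; simp
  rw [Finset.sum_mul, Matrix.trace_sum, Finset.sum_eq_single O] at h1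
  · rw [Matrix.smul_mul, pauliOp_mul, Matrix.trace_smul, Matrix.trace_smul, trace_pauliOp,
      if_pos (by ext x; exact Pauli.mul_self _)] at h1
    simpa [Pauli.phase_self] using h1
  · intro P _ hP
    rw [Matrix.smul_mul, pauliOp_mul, Matrix.trace_smul, Matrix.trace_smul, trace_pauliOp,
      if_neg]
    · simp
    · intro h2
      exact hP (funext fun x => Pauli.mul_eq_I.1 (congrFun h2 x))
  · simp

/-! ### The terms of the Hamiltonian -/

/-- The terms of the Hamiltonian: two-site terms and three-site terms. -/
inductive Term
  | XX
  | YY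
  | ZZ
  | XXZ
  | YYZ
  | ZXX
  | ZYY
  deriving DecidableEq

instance : Fintype Term :=
  ⟨{Term.XX, Term.YY, Term.ZZ, Term.XXZ, Term.YYZ, Term.ZXX, Term.ZYY},
    fun t => by cases t <;> decide⟩

/-- The first letter of a term. -/
def Term.fst : Term → Pauli
  | .XX => .X | .YY => .Y | .ZZ => .Z | .XXZ => .X | .YYZ => .Y | .ZXX => .Z | .ZYY => .Z

/-- The second letter of a term. -/
def Term.snd : Term → Pauli
  | .XX => .X | .YY => .Y | .ZZ => .Z | .XXZ => .X | .YYZ => .Y | .ZXX => .X | .ZYY => .Y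

/-- The third letter of a term, which is `I` for the two-site terms. -/
def Term.thd : Term → Pauli
  | .XX => .I | .YY => .I | .ZZ => .I | .XXZ => .Z | .YYZ => .Z | .ZXX => .X | .ZYY => .Y

theorem sum_term {M : Type*} [AddCommMonoid M] (f : Term → M) :
    ∑ h, f h = f .XX + f .YY + f .ZZ + f .XXZ + f .YYZ + f .ZXX + f .ZYY := by
  change ∑ h ∈ ({Term.XX, Term.YY, Term.ZZ, Term.XXZ, Term.YYZ, Term.ZXX, Term.ZYY} : Finset Term),
    f h = _
  simp [add_assoc]

/-- The operator `i⁻¹ (AB - BA) / 2` for Pauli strings that differ by signs `a`, `b`, `c` at the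
three sites of the overlap. -/
def sign₃ (a b c : ℤ) : ℤ :=
  a * (1 - b ^ 2) * (1 - c ^ 2) + b * (1 - a ^ 2) * (1 - c ^ 2) + c * (1 - a ^ 2) * (1 - b ^ 2)
    - a * b * c

/-- The sign of the commutator of `P` with the term `h`, where `P * h` has the letters `o₁`, `o₂`,
`o₃` at the three sites of `h`. -/
def Term.sign (h : Term) (o₁ o₂ o₃ : Pauli) : ℤ :=
  sign₃ ((o₁ * h.fst).sign h.fst) ((o₂ * h.snd).sign h.snd) ((o₃ * h.thd).sign h.thd)

/-- If the letters anticommute at `m` of the three sites, exchanging the factors multiplies the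
phase by `(-1) ^ m`, so only `m = 1` and `m = 3` survive. The phase is `i` times a sign for `m = 1`;
for `m = 3` it contains `i ^ 3 = -i`, which is the source of `- a * b * c` in `sign₃`. -/
theorem phase_sub_phase (p₁ p₂ p₃ q₁ q₂ q₃ : Pauli) :
    p₁.phase q₁ * p₂.phase q₂ * p₃.phase q₃ - q₁.phase p₁ * q₂.phase p₂ * q₃.phase p₃
      = 2 * Complex.I * sign₃ (p₁.sign q₁) (p₂.sign q₂) (p₃.sign q₃) := by
  have key : ∀ p q : Pauli, (p.sign q = 0 ∧ q.sign p = 0) ∨ (p.sign q = 1 ∧ q.sign p = -1) ∨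
      (p.sign q = -1 ∧ q.sign p = 1) := by decide
  have hI : Complex.I * Complex.I = -1 := Complex.I_mul_I
  simp only [Pauli.phase]
  rcases key p₁ q₁ with ⟨h1, h1'⟩ | ⟨h1, h1'⟩ | ⟨h1, h1'⟩ <;>
  rcases key p₂ q₂ with ⟨h2, h2'⟩ | ⟨h2, h2'⟩ | ⟨h2, h2'⟩ <;>
  rcases key p₃ q₃ with ⟨h3, h3'⟩ | ⟨h3, h3'⟩ | ⟨h3, h3'⟩ <;>
  simp [h1, h2, h3, h1', h2', h3', sign₃] <;> ring_nf

/-- The letters of the term `h` placed at the sites `j`, `j + 1`, `j + 2`. -/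
def Term.place (h : Term) (j x : ZMod N) : Pauli :=
  if x = j then h.fst else if x = j + 1 then h.snd else if x = j + 2 then h.thd else .I

omit [NeZero N] in
theorem add_one_ne (hN : 3 ≤ N) (j : ZMod N) : j + 1 ≠ j ∧ j + 2 ≠ j ∧ j + 2 ≠ j + 1 := by
  have h1 : (1 : ZMod N) ≠ 0 := by
    have := (ZMod.natCast_eq_zero_iff 1 N).not.2 (Nat.not_dvd_of_pos_of_lt one_pos (by omega))
    exact_mod_cast this
  have h2 : (2 : ZMod N) ≠ 0 := by
    have := (ZMod.natCast_eq_zero_iff 2 N).not.2 (Nat.not_dvd_of_pos_of_lt two_pos (by omega))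
    exact_mod_cast this
  refine ⟨by simpa using h1, by simpa using h2, fun h => h1 ?_⟩
  have := add_left_cancel h
  have e : (2 : ZMod N) = 1 + 1 := by norm_num
  rw [e] at this
  simpa using this

theorem prod_place (hN : 3 ≤ N) (f : Pauli → Pauli → ℂ) (hf : ∀ p, f p .I = 1)
    (P : ZMod N → Pauli) (h : Term) (j : ZMod N) :
    ∏ x, f (P x) (h.place j x)
      = f (P j) h.fst * f (P (j + 1)) h.snd * f (P (j + 2)) h.thd := by
  obtain ⟨h1, h2, h3⟩ := add_one_ne hN j
  rw [← Finset.prod_subset (Finset.subset_univ {j, j + 1, j + 2}),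
    Finset.prod_insert (by simp [h1.symm, h2.symm]), Finset.prod_pair h3.symm]
  · simp [Term.place, h1, h2, h3, mul_assoc]
  · intro x _ hx
    simp only [Finset.mem_insert, Finset.mem_singleton, not_or] at hx
    simp [Term.place, hx, hf]

theorem pauliOp_commutator_place (hN : 3 ≤ N) (P : ZMod N → Pauli) (h : Term) (j : ZMod N) :
    ⁅pauliOp N P, pauliOp N (h.place j)⁆ = (2 * Complex.I *
      (sign₃ ((P j).sign h.fst) ((P (j + 1)).sign h.snd) ((P (j + 2)).sign h.thd) : ℤ) : ℂ) •
        pauliOp N (P * h.place j) := by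
  rw [Ring.lie_def, pauliOp_mul, pauliOp_mul, mul_comm (h.place j) P, ← sub_smul,
    prod_place hN Pauli.phase Pauli.phase_I,
    prod_place hN (fun p q => q.phase p) Pauli.I_phase, phase_sub_phase]

end

section

variable {N : ℕ} [NeZero N]

/-! ### Coefficients of a charge in the Pauli basis -/

/-- The letters of the string `A` placed on the ring starting from the site `j`. -/
def stringFun {l : ℕ} (j : ZMod N) (A : Fin l → Pauli) (x : ZMod N) : Pauli :=
  if h : (x - j).val < l then A ⟨(x - j).val, h⟩ else Pauli.I

theorem stringOp_eq {l : ℕ} (j : ZMod N) (A : Fin l → Pauli) :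
    stringOp N j A = pauliOp N (stringFun j A) := rfl

/-- The coefficients in the Pauli basis of the operator with coefficients `q`. -/
noncomputable def chargeCoeff (k : ℕ) (q : (l : ℕ) → (Fin l → Pauli) → ℂ)
    (P : ZMod N → Pauli) : ℂ :=
  ∑ l ∈ Finset.Icc 1 k, ∑ j : ZMod N, ∑ A : Fin l → Pauli with IsPauliString A,
    if stringFun j A = P then q l A else 0

theorem chargeOfCoeffs_eq (k : ℕ) (q : (l : ℕ) → (Fin l → Pauli) → ℂ) :
    chargeOfCoeffs N k q = ∑ P, chargeCoeff k q P • pauliOp N P := by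
  simp only [chargeOfCoeffs, chargeCoeff, Finset.sum_smul, ite_smul, zero_smul]
  rw [Finset.sum_comm (s := Finset.univ (α := ZMod N → Pauli))]
  refine Finset.sum_congr rfl fun l _ => ?_
  rw [Finset.sum_comm (s := Finset.univ (α := ZMod N → Pauli))]
  refine Finset.sum_congr rfl fun j _ => ?_
  rw [Finset.sum_comm (s := Finset.univ (α := ZMod N → Pauli))]
  refine Finset.sum_congr rfl fun A _ => ?_
  simp [stringOp_eq]

theorem sub_cases (hN : 4 ≤ N) (x j : ZMod N) :
    ((x - j).val < 3 ↔ x = j ∨ x = j + 1 ∨ x = j + 2) ∧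
    ((x - j).val = 0 ↔ x = j) ∧ ((x - j).val = 1 ↔ x = j + 1) ∧
    ((x - j).val = 2 ↔ x = j + 2) := by
  have key : ∀ m : ℕ, m < N → ((x - j).val = m ↔ x = j + m) := by
    intro m hm
    constructor
    · intro h
      rw [← h, ZMod.natCast_val, ZMod.cast_id', id]
      ring
    · intro h
      rw [h, add_sub_cancel_left, ZMod.val_natCast_of_lt hm]
  have h0 := key 0 (by omega)
  have h1 := key 1 (by omega)
  have h2 := key 2 (by omega)
  push_cast at h0 h1 h2
  rw [add_zero] at h0
  refine ⟨?_, h0, h1, h2⟩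
  rw [← h0, ← h1, ← h2]
  omega

theorem stringFun_three (hN : 4 ≤ N) (j : ZMod N) (h : Term) :
    stringFun j ![h.fst, h.snd, h.thd] = h.place j := by
  obtain ⟨n1, n2, n3⟩ := add_one_ne (N := N) (by omega) j
  funext x
  obtain ⟨c, c0, c1, c2⟩ := sub_cases hN x j
  unfold stringFun
  split_ifs with hx
  · rcases c.1 hx with rfl | rfl | rfl
    · simp [Term.place]
    · have e : (⟨(j + 1 - j).val, hx⟩ : Fin 3) = 1 := by
        apply Fin.ext; simpa using c1.2 rfl
      rw [e]; simp [Term.place, n1]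
    · have e : (⟨(j + 2 - j).val, hx⟩ : Fin 3) = 2 := by
        apply Fin.ext; simpa using c2.2 rfl
      rw [e]; simp [Term.place, n2, n3]
  · rw [c] at hx
    push Not at hx
    simp [Term.place, hx]

theorem stringFun_two (hN : 4 ≤ N) (j : ZMod N) (h : Term) (h3 : h.thd = .I) :
    stringFun j ![h.fst, h.snd] = h.place j := by
  rw [← stringFun_three hN, h3]
  funext x
  unfold stringFun
  split_ifs with h1 h2 h2
  · have : (x - j).val = 0 ∨ (x - j).val = 1 := by omega
    rcases this with e | e
    · simp [e]
    · simp [e]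
  · omega
  · have : (x - j).val = 2 := by omega
    simp only [this]
    rfl
  · rfl

/-- The coefficients of the terms in the truncated Fredkin Hamiltonian. -/
def weight (R : Finset ThreeSiteTerm) : Term → ℤ
  | .XX => -2
  | .YY => -2
  | .ZZ => -2
  | .XXZ => if ThreeSiteTerm.XXZ ∈ R then 0 else 1
  | .YYZ => if ThreeSiteTerm.YYZ ∈ R then 0 else 1
  | .ZXX => if ThreeSiteTerm.ZXX ∈ R then 0 else -1
  | .ZYY => if ThreeSiteTerm.ZYY ∈ R then 0 else -1

theorem truncatedFredkin_eq (hN : 4 ≤ N) (R : Finset ThreeSiteTerm) :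
    truncatedFredkin N R = ∑ j : ZMod N, ∑ h : Term, (weight R h : ℂ) • pauliOp N (h.place j) := by
  unfold truncatedFredkin
  refine Finset.sum_congr rfl fun j _ => ?_
  have e : ∀ t : ThreeSiteTerm → Op N, ∑ x ∈ Rᶜ, t x = ∑ x, if x ∈ R then 0 else t x := by
    intro t
    rw [← Finset.sum_subset (Finset.subset_univ Rᶜ)]
    · exact Finset.sum_congr rfl fun x hx => (if_neg (Finset.mem_compl.1 hx)).symm
    · intro x _ hx
      simp only [Finset.mem_compl, not_not] at hx
      simp [hx]
  have u : ∀ t : ThreeSiteTerm → Op N, ∑ x, t x = t .XXZ + t .YYZ + t .ZXX + t .ZYY := by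
    intro t
    change ∑ x ∈ ({.XXZ, .YYZ, .ZXX, .ZYY} : Finset ThreeSiteTerm), t x = _
    simp [add_assoc]
  rw [sum_term, e, u, density2]
  simp only [stringOp_eq, ThreeSiteTerm.op]
  rw [show stringFun j ![Pauli.X, Pauli.X] = _ from stringFun_two hN j .XX rfl,
    show stringFun j ![Pauli.Y, Pauli.Y] = _ from stringFun_two hN j .YY rfl,
    show stringFun j ![Pauli.Z, Pauli.Z] = _ from stringFun_two hN j .ZZ rfl,
    show stringFun j ![Pauli.X, Pauli.X, Pauli.Z] = _ from stringFun_three hN j .XXZ,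
    show stringFun j ![Pauli.Y, Pauli.Y, Pauli.Z] = _ from stringFun_three hN j .YYZ,
    show stringFun j ![Pauli.Z, Pauli.X, Pauli.X] = _ from stringFun_three hN j .ZXX,
    show stringFun j ![Pauli.Z, Pauli.Y, Pauli.Y] = _ from stringFun_three hN j .ZYY]
  simp only [weight]
  split_ifs <;> simp [smul_add] <;> abel

theorem sum_bracket {A ι : Type*} [Ring A] (s : Finset ι) (f : ι → A) (y : A) :
    ⁅∑ i ∈ s, f i, y⁆ = ∑ i ∈ s, ⁅f i, y⁆ := by
  simp only [Ring.lie_def, Finset.sum_mul, Finset.mul_sum, Finset.sum_sub_distrib]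

theorem bracket_sum {A ι : Type*} [Ring A] (s : Finset ι) (f : ι → A) (y : A) :
    ⁅y, ∑ i ∈ s, f i⁆ = ∑ i ∈ s, ⁅y, f i⁆ := by
  simp only [Ring.lie_def, Finset.sum_mul, Finset.mul_sum, Finset.sum_sub_distrib]

theorem smul_bracket_smul {A : Type*} [Ring A] [Algebra ℂ A] (a b : ℂ) (x y : A) :
    ⁅a • x, b • y⁆ = (a * b) • ⁅x, y⁆ := by
  simp only [Ring.lie_def, smul_mul_smul_comm, smul_sub, mul_comm b a]

/-- The commutator of a combination of Pauli operators with a combination of the terms. -/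
theorem commutator_eq (hN : 4 ≤ N) (C : (ZMod N → Pauli) → ℂ) (κ : Term → ℤ) :
    ⁅∑ P, C P • pauliOp N P, ∑ j : ZMod N, ∑ h : Term, (κ h : ℂ) • pauliOp N (h.place j)⁆
      = (2 * Complex.I) • ∑ O, (∑ j : ZMod N, ∑ h : Term,
          ((κ h * h.sign (O j) (O (j + 1)) (O (j + 2)) : ℤ) : ℂ) * C (O * h.place j)) •
            pauliOp N O := by
  have h1 : ∀ (j : ZMod N) (h : Term),
      ⁅∑ P, C P • pauliOp N P, (κ h : ℂ) • pauliOp N (h.place j)⁆ =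
        (2 * Complex.I) • ∑ O : ZMod N → Pauli,
          (((κ h * h.sign (O j) (O (j + 1)) (O (j + 2)) : ℤ) : ℂ) * C (O * h.place j)) •
            pauliOp N O := by
    intro j h
    obtain ⟨n1, n2, n3⟩ := add_one_ne (N := N) (by omega) j
    rw [sum_bracket, Finset.smul_sum, ← Equiv.sum_comp (Equiv.mulRight (h.place j))]
    refine Finset.sum_congr rfl fun P _ => ?_
    rw [Equiv.coe_mulRight, smul_bracket_smul, pauliOp_commutator_place (by omega)]
    have e : P * h.place j * h.place j = P := funext fun x => Pauli.mul_mul_self _ _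
    rw [e, smul_smul, smul_smul, Term.sign]
    simp only [Pi.mul_apply, Term.place, n1, n2, n3, if_true, if_false]
    congr 1
    push_cast
    ring
  simp only [bracket_sum, h1]
  simp only [← Finset.smul_sum]
  congr 1
  simp only [Finset.sum_smul]
  rw [Finset.sum_comm (s := Finset.univ (α := ZMod N → Pauli))]
  refine Finset.sum_congr rfl fun j _ => ?_
  rw [Finset.sum_comm (s := Finset.univ (α := ZMod N → Pauli))]

/-- The properties of the Pauli coefficients of a translation invariant operator made of strings of
length at most `k` that commutes with the Hamiltonian with coefficients `κ`. -/
structure RingCharge (N : ℕ) [NeZero N] (k : ℕ) (κ : Term → ℤ) (C : (ZMod N → Pauli) → ℂ) :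
    Prop where
  shift : ∀ P, C (fun x => P (x + 1)) = C P
  supp : ∀ P, C P ≠ 0 → ∃ j, ∀ x, P x ≠ .I → (x - j).val < k
  eqn : ∀ O, ∑ j : ZMod N, ∑ h : Term,
    ((κ h * h.sign (O j) (O (j + 1)) (O (j + 2)) : ℤ) : ℂ) * C (O * h.place j) = 0

theorem chargeCoeff_shift (k : ℕ) (q : (l : ℕ) → (Fin l → Pauli) → ℂ) (P : ZMod N → Pauli) :
    chargeCoeff k q (fun x => P (x + 1)) = chargeCoeff k q P := by
  unfold chargeCoeff
  refine Finset.sum_congr rfl fun l _ => ?_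
  rw [← Equiv.sum_comp (Equiv.addRight (1 : ZMod N))
    (fun j => ∑ A : Fin l → Pauli with IsPauliString A, if stringFun j A = P then q l A else 0)]
  refine Finset.sum_congr rfl fun j _ => Finset.sum_congr rfl fun A _ => ?_
  refine if_congr ?_ rfl rfl
  have e : stringFun j A = fun x => stringFun (j + 1) A (x + 1) := by
    funext x
    simp [stringFun]
  rw [e, Equiv.coe_addRight]
  constructor
  · intro h
    funext x
    simpa using congrFun h (x - 1)
  · intro h
    rw [h]

theorem chargeCoeff_supp (k : ℕ) (q : (l : ℕ) → (Fin l → Pauli) → ℂ) (P : ZMod N → Pauli)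
    (h : chargeCoeff k q P ≠ 0) : ∃ j, ∀ x, P x ≠ .I → (x - j).val < k := by
  obtain ⟨l, hl, h⟩ := Finset.exists_ne_zero_of_sum_ne_zero h
  obtain ⟨j, -, h⟩ := Finset.exists_ne_zero_of_sum_ne_zero h
  obtain ⟨A, -, h⟩ := Finset.exists_ne_zero_of_sum_ne_zero h
  refine ⟨j, fun x hx => ?_⟩
  have e : stringFun j A = P := by
    by_contra h'
    exact h (if_neg h')
  rw [← e, stringFun] at hx
  have : (x - j).val < l := by
    by_contra h'
    exact hx (dif_neg h')
  have := (Finset.mem_Icc.1 hl).2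
  omega

/-- Each string starts inside the support of the other. If `j ≠ 0`, the distances from `0` to `j`
and from `j` to `0` are less than `k` and `l` but add up to `N`, against `2 * k ≤ N`. Hence the
coefficient of a string of length `k` is not mixed with that of any other string. -/
theorem stringFun_injective {k l : ℕ} (hk : 1 ≤ k) (hl : 1 ≤ l) (hlk : l ≤ k) (hN : 2 * k ≤ N)
    {j : ZMod N} {A : Fin l → Pauli} {B : Fin k → Pauli} (hA : IsPauliString A)
    (hB : IsPauliString B) (h : stringFun j A = stringFun 0 B) : j = 0 ∧ l = k := by
  have lt_of : ∀ (l : ℕ) (j x : ZMod N) (A : Fin l → Pauli), stringFun j A x ≠ .I →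
      (x - j).val < l := by
    intro l j x A hx
    by_contra h'
    exact hx (dif_neg h')
  have h1 : (j - 0).val < k := by
    refine lt_of _ _ _ B ?_
    rw [← h]
    have h0 : (j - j).val < l := by simpa using Nat.pos_of_ne_zero (by omega)
    rw [stringFun, dif_pos h0]
    exact hA _ (Or.inl (by simp))
  have h2 : (0 - j).val < l := by
    refine lt_of _ _ _ A ?_
    rw [h]
    have h0 : ((0 : ZMod N) - 0).val < k := by simpa using Nat.pos_of_ne_zero (by omega)
    rw [stringFun, dif_pos h0]
    exact hB _ (Or.inl (by simp))
  have hk1 : ((k - 1 : ℕ) : ZMod N).val = k - 1 := ZMod.val_natCast_of_lt (by omega)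
  have h3 : (((k - 1 : ℕ) : ZMod N) - j).val < l := by
    refine lt_of _ _ _ A ?_
    rw [h]
    have h0 : (((k - 1 : ℕ) : ZMod N) - 0).val < k := by rw [sub_zero, hk1]; omega
    rw [stringFun, dif_pos h0]
    exact hB _ (Or.inr (by simp only [sub_zero, hk1]; omega))
  have hj : j = 0 := by
    by_contra hj
    simp only [zero_sub, sub_zero] at h1 h2
    have : NeZero j := ⟨hj⟩
    rw [ZMod.val_neg_of_ne_zero] at h2
    omega
  subst hj
  rw [sub_zero, hk1] at h3
  exact ⟨rfl, by omega⟩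

theorem chargeCoeff_stringFun {k : ℕ} (hk : 1 ≤ k) (hN : 2 * k ≤ N)
    (q : (l : ℕ) → (Fin l → Pauli) → ℂ) (B : Fin k → Pauli) (hB : IsPauliString B) :
    chargeCoeff k q (stringFun (0 : ZMod N) B) = q k B := by
  unfold chargeCoeff
  rw [Finset.sum_eq_single k, Finset.sum_eq_single 0, Finset.sum_eq_single B]
  · simp
  · intro A _ hAB
    refine if_neg fun h => hAB ?_
    funext i
    have hi : ((i : ℕ) : ZMod N).val = i := ZMod.val_natCast_of_lt (by omega)
    have := congrFun h ((i : ℕ) : ZMod N)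
    simpa [stringFun, hi] using this
  · intro hB'
    exact absurd (Finset.mem_filter.2 ⟨Finset.mem_univ _, hB⟩) hB'
  · intro j _ hj
    refine Finset.sum_eq_zero fun A hA => if_neg fun h => hj ?_
    exact (stringFun_injective hk hk le_rfl hN (Finset.mem_filter.1 hA).2 hB h).1
  · simp
  · intro l hl hlk
    rw [Finset.mem_Icc] at hl
    refine Finset.sum_eq_zero fun j _ => Finset.sum_eq_zero fun A hA => if_neg fun h => hlk ?_
    exact (stringFun_injective hk hl.1 hl.2 hN (Finset.mem_filter.1 hA).2 hB h).2
  · intro h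
    exact absurd (Finset.mem_Icc.2 ⟨hk, le_rfl⟩) h

/-- The Pauli coefficients of a conserved charge. -/
theorem IsKLocalConservedCharge.exists_ringCharge {k : ℕ} (hk : 4 ≤ k) (hN : 2 * k ≤ N)
    {R : Finset ThreeSiteTerm} {Q : Op N}
    (hQ : IsKLocalConservedCharge N k (truncatedFredkin N R) Q) :
    ∃ C : (ZMod N → Pauli) → ℂ, RingCharge N k (weight R) C ∧
      ∃ P : ZMod N → Pauli, P 0 ≠ .I ∧ P ((k - 1 : ℕ) : ZMod N) ≠ .I ∧
        (∀ x, k ≤ x.val → P x = .I) ∧ C P ≠ 0 := by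
  obtain ⟨⟨q, rfl, A, hA, hq⟩, hQ⟩ := hQ
  rw [chargeOfCoeffs_eq, truncatedFredkin_eq (by omega), commutator_eq (by omega),
    smul_eq_zero] at hQ
  have hQ' := hQ.resolve_left (by simp)
  refine ⟨chargeCoeff k q, ⟨chargeCoeff_shift k q, chargeCoeff_supp k q,
    eq_zero_of_sum_pauliOp_eq_zero hQ'⟩, stringFun 0 A, ?_, ?_, ?_, ?_⟩
  · have h0 : ((0 : ZMod N) - 0).val < k := by simp; omega
    rw [stringFun, dif_pos h0]
    exact hA _ (Or.inl (by simp))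
  · have hk1 : ((k - 1 : ℕ) : ZMod N).val = k - 1 := ZMod.val_natCast_of_lt (by omega)
    have h0 : (((k - 1 : ℕ) : ZMod N) - 0).val < k := by rw [sub_zero, hk1]; omega
    rw [stringFun, dif_pos h0]
    exact hA _ (Or.inr (by simp only [sub_zero, hk1]; omega))
  · intro x hx
    exact dif_neg (by simpa using hx)
  · rwa [chargeCoeff_stringFun (by omega) hN q A hA]

end

section

variable {N : ℕ} [NeZero N]

/-! ### Symmetries -/

/-- All coefficients of the strings of length exactly `k` vanish. -/
def VanishesAt (k : ℕ) (C : (ZMod N → Pauli) → ℂ) : Prop :=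
  ∀ (P : ZMod N → Pauli) (j : ZMod N), P j ≠ .I → P (j + (k - 1 : ℕ)) ≠ .I →
    (∀ x, P x ≠ .I → (x - j).val < k) → C P = 0

/-- The exchange of `X` and `Y`. -/
def Pauli.swap : Pauli → Pauli
  | .I => .I | .X => .Y | .Y => .X | .Z => .Z

/-- The exchange of `X` and `Y` in a term. -/
def Term.swap : Term → Term
  | .XX => .YY | .YY => .XX | .ZZ => .ZZ | .XXZ => .YYZ | .YYZ => .XXZ | .ZXX => .ZYY
  | .ZYY => .ZXX

/-- The reflection of a term. -/
def Term.reverse : Term → Term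
  | .XX => .XX | .YY => .YY | .ZZ => .ZZ | .XXZ => .ZXX | .YYZ => .ZYY | .ZXX => .XXZ
  | .ZYY => .YYZ

/-- The number of sites of a term. -/
def Term.len : Term → ℕ
  | .XX => 2 | .YY => 2 | .ZZ => 2 | _ => 3

theorem Pauli.swap_swap (p : Pauli) : p.swap.swap = p := by revert p; decide

theorem Pauli.swap_mul (p q : Pauli) : (p * q).swap = p.swap * q.swap := by revert p q; decide

theorem Pauli.swap_eq_I {p : Pauli} : p.swap = .I ↔ p = .I := by revert p; decide

theorem Term.swap_swap (h : Term) : h.swap.swap = h := by revert h; decide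

theorem Term.reverse_reverse (h : Term) : h.reverse.reverse = h := by revert h; decide

/-- The exchange reverses the cyclic orientation of `X`, `Y`, `Z`, and `sign₃` is odd. All equations
change sign together, so they are preserved. -/
theorem Term.sign_swap (h : Term) (o₁ o₂ o₃ : Pauli) :
    h.swap.sign o₁.swap o₂.swap o₃.swap = -h.sign o₁ o₂ o₃ := by
  revert h o₁ o₂ o₃; decide

omit [NeZero N] in
theorem Term.place_swap (h : Term) (j x : ZMod N) : (h.place j x).swap = h.swap.place j x := by
  unfold Term.place
  split_ifs <;> first | rfl | (revert h; decide)

theorem RingCharge.swap {k : ℕ} {κ : Term → ℤ} {C : (ZMod N → Pauli) → ℂ}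
    (h : RingCharge N k κ C) :
    RingCharge N k (fun t => κ t.swap) (fun P => C fun x => (P x).swap) where
  shift P := h.shift fun x => (P x).swap
  supp P hP := by
    obtain ⟨j, hj⟩ := h.supp _ hP
    exact ⟨j, fun x hx => hj x (Pauli.swap_eq_I.not.2 hx)⟩
  eqn O := by
    have := h.eqn fun x => (O x).swap
    rw [← neg_eq_zero, ← this, ← Finset.sum_neg_distrib]
    refine Finset.sum_congr rfl fun j _ => ?_
    let e : Term ≃ Term := ⟨Term.swap, Term.swap, Term.swap_swap, Term.swap_swap⟩
    rw [← Finset.sum_neg_distrib, ← Equiv.sum_comp e]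
    refine Finset.sum_congr rfl fun t _ => ?_
    have e1 : (fun x => ((O * (e t).place j) x).swap)
        = (fun x => (O x).swap) * t.place j := by
      funext x
      simp only [Pi.mul_apply, Pauli.swap_mul]
      rw [Term.place_swap, show (e t).swap = t from Term.swap_swap t]
    rw [e1, show (e t).swap = t from Term.swap_swap t]
    have e2 := Term.sign_swap (e t) (O j) (O (j + 1)) (O (j + 2))
    rw [show (e t).swap = t from Term.swap_swap t] at e2
    rw [e2]
    push_cast
    ring

omit [NeZero N] in
theorem VanishesAt.of_swap {k : ℕ} {C : (ZMod N → Pauli) → ℂ}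
    (h : VanishesAt k fun P : ZMod N → Pauli => C fun x => (P x).swap) : VanishesAt k C := by
  intro P j h0 h1 h2
  have := h (fun x => (P x).swap) j (Pauli.swap_eq_I.not.2 h0) (Pauli.swap_eq_I.not.2 h1)
    fun x hx => h2 x (Pauli.swap_eq_I.not.1 hx)
  simpa only [Pauli.swap_swap] using this

theorem val_reflect {k : ℕ} (hk : 1 ≤ k) (hN : k ≤ N) {x j : ZMod N} (h : (-x - j).val < k) :
    (x - (-j - ((k - 1 : ℕ) : ZMod N))).val < k := by
  have e : x - (-j - ((k - 1 : ℕ) : ZMod N)) = (((k - 1) - (-x - j).val : ℕ) : ZMod N) := by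
    rw [Nat.cast_sub (show (-x - j).val ≤ k - 1 by omega), ZMod.natCast_val, ZMod.cast_id', id]
    ring
  rw [e, ZMod.val_natCast_of_lt (by omega)]
  omega

-- The reflection turns the last site of a term into its first one, so the new starting point
-- depends on the length of the term.
omit [NeZero N] in
theorem Term.place_reverse (hN : 4 ≤ N) (h : Term) (j x : ZMod N) :
    h.reverse.place (-((h.len - 1 : ℕ) : ZMod N) - j) (-x) = h.place j x := by
  obtain ⟨n1, n2, n3⟩ := add_one_ne (N := N) (by omega) j
  have e1 : -x = -1 - j ↔ x = j + 1 := by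
    constructor <;> intro h
    · linear_combination -h
    · linear_combination -h
  have e2 : -x = -1 - j + 1 ↔ x = j := by
    constructor <;> intro h
    · linear_combination -h
    · linear_combination -h
  have e3 : -x = -2 - j ↔ x = j + 2 := by
    constructor <;> intro h
    · linear_combination -h
    · linear_combination -h
  have e4 : -x = -2 - j + 1 ↔ x = j + 1 := by
    constructor <;> intro h
    · linear_combination -h
    · linear_combination -h
  have e5 : -x = -2 - j + 2 ↔ x = j := by
    constructor <;> intro h
    · linear_combination -h
    · linear_combination -h
  cases h <;> simp only [Term.place, Term.reverse, Term.len, Nat.add_one_sub_one, Nat.cast_one,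
    Nat.cast_ofNat, e1, e2, e3, e4, e5, Term.fst, Term.snd, Term.thd, ite_self] <;>
  by_cases h1 : x = j <;> by_cases h2 : x = j + 1 <;> by_cases h3 : x = j + 2 <;> simp_all

omit [NeZero N] in
theorem Term.sign_reverse (h : Term) (j : ZMod N) (O : ZMod N → Pauli) :
    h.reverse.sign (O (-(-((h.len - 1 : ℕ) : ZMod N) - j))) (O (-(-((h.len - 1 : ℕ) : ZMod N) - j + 1)))
      (O (-(-((h.len - 1 : ℕ) : ZMod N) - j + 2))) = h.sign (O j) (O (j + 1)) (O (j + 2)) := by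
  have e1 : -(-1 - j) = j + 1 := by ring
  have e2 : -(-1 - j + 1) = j := by ring
  have e3 : -(-2 - j) = j + 2 := by ring
  have e4 : -(-2 - j + 1) = j + 1 := by ring
  have e5 : -(-2 - j + 2) = j := by ring
  cases h <;> simp only [Term.reverse, Term.len, Nat.add_one_sub_one, Nat.cast_one,
    Nat.cast_ofNat, e1, e2, e3, e4, e5, Term.sign, Term.fst, Term.snd, Term.thd, sign₃,
    Pauli.sign_I] <;> ring

theorem RingCharge.reverse {k : ℕ} (hk : 1 ≤ k) (hkN : k ≤ N) (hN : 4 ≤ N) {κ : Term → ℤ}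
    {C : (ZMod N → Pauli) → ℂ} (h : RingCharge N k κ C) :
    RingCharge N k (fun t => κ t.reverse) (fun P => C fun x => P (-x)) where
  shift P := by
    have := h.shift fun x => P (-x + 1)
    simp only [neg_add, add_assoc] at this
    simpa using this.symm
  supp P hP := by
    obtain ⟨j, hj⟩ := h.supp _ hP
    exact ⟨-j - ((k - 1 : ℕ) : ZMod N), fun x hx => val_reflect hk hkN (hj (-x) (by simpa using hx))⟩
  eqn O := by
    have := h.eqn fun x => O (-x)
    rw [Finset.sum_comm] at this ⊢
    rw [← this]
    let e : Term ≃ Term := ⟨Term.reverse, Term.reverse, Term.reverse_reverse, Term.reverse_reverse⟩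
    rw [← Equiv.sum_comp e]
    refine Finset.sum_congr rfl fun t _ => ?_
    rw [← Equiv.sum_comp (Equiv.subLeft (-((t.len - 1 : ℕ) : ZMod N)))]
    refine Finset.sum_congr rfl fun j _ => ?_
    change ((κ t.reverse.reverse * t.reverse.sign (O (-((t.len - 1 : ℕ) : ZMod N) - j))
      (O (-((t.len - 1 : ℕ) : ZMod N) - j + 1)) (O (-((t.len - 1 : ℕ) : ZMod N) - j + 2)) : ℤ) : ℂ) *
      C (fun x => (O * t.reverse.place (-((t.len - 1 : ℕ) : ZMod N) - j)) (-x)) = _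
    have e1 : (fun x => (O * t.reverse.place (-((t.len - 1 : ℕ) : ZMod N) - j)) (-x))
        = (fun x => O (-x)) * t.place j := by
      funext x
      simp only [Pi.mul_apply, Term.place_reverse hN]
    have e2 := Term.sign_reverse t j (fun x => O (-x))
    simp only [neg_neg] at e2
    rw [e1, Term.reverse_reverse, e2]

theorem VanishesAt.of_reverse {k : ℕ} (hk : 1 ≤ k) (hkN : k ≤ N) {C : (ZMod N → Pauli) → ℂ}
    (h : VanishesAt k fun P : ZMod N → Pauli => C fun x => P (-x)) : VanishesAt k C := by
  intro P j h0 h1 h2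
  have := h (fun x => P (-x)) (-j - ((k - 1 : ℕ) : ZMod N)) (by simpa [add_comm] using h1) (by simpa using h0)
    fun x hx => val_reflect hk hkN (h2 _ hx)
  simpa only [neg_neg] using this

theorem RingCharge.shift_natCast {k : ℕ} {κ : Term → ℤ} {C : (ZMod N → Pauli) → ℂ}
    (h : RingCharge N k κ C) (P : ZMod N → Pauli) (n : ℕ) : C (fun x => P (x + n)) = C P := by
  induction n with
  | zero => simp
  | succ n ih =>
    rw [← ih, ← h.shift fun x => P (x + n)]
    congr 1
    funext x
    push_cast
    congr 1
    ring

/-! ### Words on a window of the ring -/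

/-- The multiplication of a word by the term `h` at the position `j`. -/
def Term.act (h : Term) (j : ℕ) (w : ℕ → Pauli) (i : ℕ) : Pauli :=
  if i = j then w i * h.fst else if i = j + 1 then w i * h.snd
  else if i = j + 2 then w i * h.thd else w i

/-- A word that contains two letters other than `I` at distance at least `k`. -/
def IsWide (k : ℕ) (w : ℕ → Pauli) : Prop := ∃ i j, i + k ≤ j ∧ w i ≠ .I ∧ w j ≠ .I

/-- The properties of the coefficients of a charge as a function of words. The word
`O` of length `n` gives an equation if `n ≤ k + 1`, or if `n = k + 2` and `O` has enough
letters other than `I`. -/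
structure WindowCharge (k : ℕ) (κ : Term → ℤ) (c : (ℕ → Pauli) → ℂ) : Prop where
  wide : ∀ w, IsWide k w → c w = 0
  shift : ∀ w, (∀ i, k + 2 ≤ i → w i = .I) → w 0 = .I → c w = c fun i => w (i + 1)
  eqn : ∀ (n : ℕ) (O : ℕ → Pauli), k ≤ n → n ≤ k + 2 → (∀ i, n ≤ i → O i = .I) →
    O 0 ≠ .I → O (n - 1) ≠ .I →
    (n = k + 2 → (∃ i, 2 ≤ i ∧ i ≤ k - 1 ∧ O i ≠ .I) ∧ (∃ i, 3 ≤ i ∧ i ≤ k ∧ O i ≠ .I) ∧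
      (∃ i, 1 ≤ i ∧ i ≤ k - 2 ∧ O i ≠ .I)) →
    ∑ j ∈ Finset.range n, ∑ h : Term, (if j + h.len ≤ n then
      ((κ h * h.sign (O j) (O (j + 1)) (O (j + 2)) : ℤ) : ℂ) * c (h.act j O) else 0) = 0

theorem val_add_sub (x j : ZMod N) (d : ℕ) : (x + d - j).val = ((x - j).val + d) % N := by
  have : x + d - j = (x - j) + (d : ZMod N) := by ring
  rw [this, ZMod.val_add, ZMod.val_natCast, Nat.add_mod_mod]

/-- Both arcs between the two letters have length at least `k`, so no window of `k` sites contains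
both. -/
theorem RingCharge.eq_zero_of_two {k : ℕ} {κ : Term → ℤ} {C : (ZMod N → Pauli) → ℂ}
    (h : RingCharge N k κ C) {P : ZMod N → Pauli} {x : ZMod N} {d : ℕ} (hd : k ≤ d)
    (hd' : d + k ≤ N) (h0 : P x ≠ .I) (h1 : P (x + d) ≠ .I) : C P = 0 := by
  by_contra hP
  obtain ⟨j, hj⟩ := h.supp P hP
  have u0 := hj _ h0
  have u1 := hj _ h1
  rw [val_add_sub] at u1
  rw [Nat.mod_eq_of_lt (by omega)] at u1
  omega

/-- A window that contains the three letters avoids the interior of one of the three gaps, and so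
spans the other two. The bounds make the sum of any two gaps at least `k`. This serves when two
letters are so far apart that the arc on the other side is shorter than `k`. -/
theorem RingCharge.eq_zero_of_three {k : ℕ} (hkN : 2 * k ≤ N) {κ : Term → ℤ}
    {C : (ZMod N → Pauli) → ℂ} (h : RingCharge N k κ C) {P : ZMod N → Pauli} {x : ZMod N}
    {a b : ℕ} (ha : a ≤ k) (hab : b ≤ a + k) (hb : k ≤ b)
    (h0 : P x ≠ .I) (h1 : P (x + a) ≠ .I) (h2 : P (x + b) ≠ .I) : C P = 0 := by
  by_contra hP
  obtain ⟨j, hj⟩ := h.supp P hP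
  have u0 := hj _ h0
  have u1 := hj _ h1
  have u2 := hj _ h2
  rw [val_add_sub] at u1 u2
  set u := (x - j).val
  rcases lt_or_ge (u + b) N with hb' | hb'
  · rw [Nat.mod_eq_of_lt hb'] at u2
    omega
  · rw [Nat.mod_eq_of_lt (by omega)] at u1
    omega

end

/-! ### From equations on the ring to equations for words -/

section

variable {N : ℕ} [NeZero N]

/-- The word `w` on the ring. -/
def onRing (N : ℕ) (w : ℕ → Pauli) (x : ZMod N) : Pauli := w x.val

omit [NeZero N] in
theorem onRing_natCast {i : ℕ} (hi : i < N) (w : ℕ → Pauli) : onRing N w (i : ZMod N) = w i := by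
  rw [onRing, ZMod.val_natCast_of_lt hi]

theorem onRing_add_one {w : ℕ → Pauli} {n : ℕ} (hw : ∀ i, n ≤ i → w i = .I) (hn : n ≤ N)
    (h0 : w 0 = .I) : (fun x => onRing N w (x + 1)) = onRing N fun i => w (i + 1) := by
  funext x
  simp only [onRing]
  by_cases hx : x.val + 1 < N
  · have e : x + 1 = ((x.val + 1 : ℕ) : ZMod N) := by push_cast; simp
    rw [e, ZMod.val_natCast_of_lt hx]
  · have hxv := ZMod.val_lt x
    have e : x + 1 = 0 := by
      have : x + 1 = ((x.val + 1 : ℕ) : ZMod N) := by push_cast; simp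
      rw [this, show x.val + 1 = N by omega]; simp
    rw [e, ZMod.val_zero, h0, hw _ (by omega)]

theorem RingCharge.onRing_eq_zero_of_two {k : ℕ} {κ : Term → ℤ} {C : (ZMod N → Pauli) → ℂ}
    (h : RingCharge N k κ C) {w : ℕ → Pauli} {i j : ℕ} (hd : i + k ≤ j)
    (hd' : j + k ≤ i + N) (hj : j < N) (h0 : w i ≠ .I) (h1 : w j ≠ .I) : C (onRing N w) = 0 := by
  refine h.eq_zero_of_two (x := (i : ZMod N)) (d := j - i) (by omega) (by omega) ?_ ?_
  · rwa [onRing_natCast (by omega)]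
  · rwa [← Nat.cast_add, onRing_natCast (by omega), show i + (j - i) = j by omega]

theorem RingCharge.onRing_eq_zero_of_three {k : ℕ} (hkN : 2 * k ≤ N) {κ : Term → ℤ}
    {C : (ZMod N → Pauli) → ℂ} (h : RingCharge N k κ C) {w : ℕ → Pauli} {i j l : ℕ}
    (hij : i ≤ j) (ha : j ≤ i + k) (hab : l ≤ j + k) (hb : i + k ≤ l) (hl : l < N)
    (h0 : w i ≠ .I) (h1 : w j ≠ .I) (h2 : w l ≠ .I) : C (onRing N w) = 0 := by
  refine h.eq_zero_of_three hkN (x := (i : ZMod N)) (a := j - i) (b := l - i) (by omega) (by omega)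
    (by omega) ?_ ?_ ?_
  · rwa [onRing_natCast (by omega)]
  · rwa [← Nat.cast_add, onRing_natCast (by omega), show i + (j - i) = j by omega]
  · rwa [← Nat.cast_add, onRing_natCast (by omega), show i + (l - i) = l by omega]

open Classical in
/-- The coefficients of a charge as a function of words. -/
noncomputable def windowCoeff (N : ℕ) (k : ℕ) (C : (ZMod N → Pauli) → ℂ) (w : ℕ → Pauli) : ℂ :=
  if IsWide k w then 0 else C (onRing N w)

theorem sum_zmod {M : Type*} [AddCommMonoid M] (f : ZMod N → M) :
    ∑ j, f j = ∑ t ∈ Finset.range N, f (t : ZMod N) := by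
  refine Finset.sum_nbij' (fun j => j.val) (fun t => (t : ZMod N)) ?_ ?_ ?_ ?_ ?_
  · intro j _
    exact Finset.mem_range.2 (ZMod.val_lt j)
  · simp
  · simp
  · intro t ht
    exact ZMod.val_natCast_of_lt (Finset.mem_range.1 ht)
  · simp

theorem natCast_val_eq_iff {x : ZMod N} {t : ℕ} (ht : t < N) : x = (t : ZMod N) ↔ x.val = t := by
  constructor
  · rintro rfl
    exact ZMod.val_natCast_of_lt ht
  · rintro rfl
    simp

theorem onRing_mul_place {t : ℕ} (ht : t + 2 < N) (h : Term) (O : ℕ → Pauli) :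
    onRing N O * h.place (t : ZMod N) = onRing N (h.act t O) := by
  funext x
  have e0 := natCast_val_eq_iff (x := x) (show t < N by omega)
  have e1 := natCast_val_eq_iff (x := x) (show t + 1 < N by omega)
  have e2 := natCast_val_eq_iff (x := x) ht
  push_cast at e1 e2
  simp only [Pi.mul_apply, onRing, Term.place, Term.act, e0, e1, e2]
  split_ifs <;> simp

/-- A nonzero commutator needs a site with anticommuting letters, and at such a site there is a
letter other than `I` both before and after the multiplication. -/
theorem Term.exists_ne_of_sign_ne_zero {h : Term} {o₁ o₂ o₃ : Pauli} (hs : h.sign o₁ o₂ o₃ ≠ 0) :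
    (o₁ ≠ .I ∧ o₁ * h.fst ≠ .I) ∨ (o₂ ≠ .I ∧ o₂ * h.snd ≠ .I) ∨
      (h.len = 3 ∧ o₃ ≠ .I ∧ o₃ * h.thd ≠ .I) := by
  revert h o₁ o₂ o₃; decide

theorem Term.sign_self (h : Term) (o : Pauli) (h3 : h.len = 3 → o = h.thd) :
    h.sign h.fst h.snd o = 0 := by
  revert h o; decide

theorem Term.fst_ne (h : Term) : h.fst ≠ .I := by revert h; decide

theorem Term.snd_ne (h : Term) : h.snd ≠ .I := by revert h; decide

theorem Term.thd_ne {h : Term} (h3 : h.len = 3) : h.thd ≠ .I := by revert h; decide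

theorem Term.thd_eq {h : Term} (h3 : h.len ≠ 3) : h.thd = .I := by revert h; decide

theorem Term.len_cases (h : Term) : h.len = 2 ∨ h.len = 3 := by revert h; decide

theorem Term.act_of_lt (h : Term) {j i : ℕ} (w : ℕ → Pauli) (hi : i < j) : h.act j w i = w i := by
  unfold Term.act; split_ifs <;> first | omega | rfl

theorem Term.act_of_ge (h : Term) {j i : ℕ} (w : ℕ → Pauli) (hi : j + h.len ≤ i) :
    h.act j w i = w i := by
  unfold Term.act
  rcases h.len_cases with e | e
  · split_ifs <;> first | omega | rfl | rw [Term.thd_eq (by omega), Pauli.mul_I]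
  · split_ifs <;> first | omega | rfl

theorem Term.act_fst (h : Term) (j : ℕ) (w : ℕ → Pauli) : h.act j w j = w j * h.fst := by
  simp [Term.act]

theorem Term.act_snd (h : Term) (j : ℕ) (w : ℕ → Pauli) :
    h.act j w (j + 1) = w (j + 1) * h.snd := by
  simp [Term.act]

theorem Term.act_thd (h : Term) (j : ℕ) (w : ℕ → Pauli) :
    h.act j w (j + 2) = w (j + 2) * h.thd := by
  simp [Term.act]

/-- The condition on a word of length `n ≤ k + 2` under which it gives an equation. -/
def Clean (k n : ℕ) (O : ℕ → Pauli) : Prop :=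
  n = k + 2 → (∃ i, 2 ≤ i ∧ i ≤ k - 1 ∧ O i ≠ .I) ∧ (∃ i, 3 ≤ i ∧ i ≤ k ∧ O i ≠ .I) ∧
      (∃ i, 1 ≤ i ∧ i ≤ k - 2 ∧ O i ≠ .I)

/-- Terms that stick out of the word on the right do not contribute. -/
theorem RingCharge.eq_zero_of_right {k : ℕ} (hk : 4 ≤ k) (hkN : 2 * k ≤ N) {κ : Term → ℤ}
    {C : (ZMod N → Pauli) → ℂ} (hC : RingCharge N k κ C) {n t : ℕ} {O : ℕ → Pauli} {h : Term}
    (hn : k ≤ n) (hn' : n ≤ k + 2) (hO : ∀ i, n ≤ i → O i = .I) (h0 : O 0 ≠ .I)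
    (hc : Clean k n O) (ht : t < n) (ht' : n < t + h.len)
    (hs : h.sign (O t) (O (t + 1)) (O (t + 2)) ≠ 0) : C (onRing N (h.act t O)) = 0 := by
  have hlen := h.len_cases
  have a0 : h.act t O 0 ≠ .I := by rwa [h.act_of_lt _ (by omega)]
  have an : h.act t O n ≠ .I := by
    rcases (by omega : n = t + 1 ∨ n = t + 2 ∧ h.len = 3) with rfl | ⟨rfl, h3⟩
    · rw [h.act_snd, hO _ le_rfl, Pauli.I_mul]; exact h.snd_ne
    · rw [h.act_thd, hO _ le_rfl, Pauli.I_mul]; exact Term.thd_ne h3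
  rcases (by omega : n = k ∨ n = k + 1 ∨ n = k + 2) with rfl | rfl | rfl
  · exact hC.onRing_eq_zero_of_two (i := 0) (j := n) (by omega) (by omega) (by omega) a0 an
  -- The letters at `0` and `k + 1` alone do not suffice: for `N = 2 * k` the arc on the other side
  -- has length `k - 1`. The site of anticommutation supplies a further letter.
  · rcases Term.exists_ne_of_sign_ne_zero hs with ⟨-, h1⟩ | ⟨h1, h2⟩ | ⟨h3, h1, h2⟩
    · rw [← h.act_fst] at h1
      exact hC.onRing_eq_zero_of_three hkN (i := 0) (j := t) (l := k + 1) (by omega) (by omega)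
        (by omega) (by omega) (by omega) a0 h1 an
    · have : t + 1 < k + 1 := by
        by_contra h'
        exact h1 (hO _ (by omega))
      rw [← h.act_snd] at h2
      exact hC.onRing_eq_zero_of_two (i := 0) (j := t + 1) (by omega) (by omega) (by omega) a0 h2
    · exact absurd (hO _ (by omega)) h1
  -- The first condition of `Clean` gives a letter that terms sticking out on either side do not
  -- reach: `i ≤ k - 1` lies left of the term, and `2 ≤ i` makes the gap between `i` and `k + 2` at
  -- most `k`.
  · obtain ⟨⟨i, hi, hi', h1⟩, -, -⟩ := hc rfl
    rw [← h.act_of_lt (j := t) O (by omega)] at h1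
    exact hC.onRing_eq_zero_of_three hkN (i := 0) (j := i) (l := k + 2) (by omega) (by omega)
        (by omega) (by omega) (by omega) a0 h1 an

/-- Terms that stick out of the word on the left do not contribute. -/
theorem RingCharge.eq_zero_of_left {k : ℕ} (hk : 4 ≤ k) (hkN : 2 * k ≤ N) {κ : Term → ℤ}
    {C : (ZMod N → Pauli) → ℂ} (hC : RingCharge N k κ C) {n : ℕ} {O : ℕ → Pauli} {h : Term}
    (hn : k ≤ n) (hn' : n ≤ k + 2) (hO : ∀ i, n ≤ i → O i = .I)
    (h1 : O (n - 1) ≠ .I) (hc : Clean k n O) {j : ZMod N} (hj : n ≤ j.val)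
    (hs : h.sign (onRing N O j) (onRing N O (j + 1)) (onRing N O (j + 2)) ≠ 0) :
    C (onRing N O * h.place j) = 0 := by
  have hz : ∀ x : ZMod N, n ≤ x.val → onRing N O x = .I := fun x hx => hO _ hx
  have hjv : ((j.val : ℕ) : ZMod N) = j := by simp
  have hjN := ZMod.val_lt j
  obtain ⟨n1, n2, n3⟩ := add_one_ne (N := N) (by omega) j
  -- a letter of the word that is not affected
  have keep : ∀ (i : ℕ), 2 ≤ i → i < n → O i ≠ .I →
      (onRing N O * h.place j) ((i : ℕ) : ZMod N) ≠ .I := by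
    intro i hi hi' hOi
    have e0 : ((i : ℕ) : ZMod N) ≠ j := by
      intro e
      rw [← e, ZMod.val_natCast_of_lt (by omega)] at hj
      omega
    have e1 : ((i : ℕ) : ZMod N) ≠ j + 1 := by
      intro e
      have : j = ((i - 1 : ℕ) : ZMod N) := by
        rw [Nat.cast_sub (by omega), e]; push_cast; ring
      rw [this, ZMod.val_natCast_of_lt (by omega)] at hj
      omega
    have e2 : ((i : ℕ) : ZMod N) ≠ j + 2 := by
      intro e
      have : j = ((i - 2 : ℕ) : ZMod N) := by
        rw [Nat.cast_sub (by omega), e]; push_cast; ring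
      rw [this, ZMod.val_natCast_of_lt (by omega)] at hj
      omega
    rw [Pi.mul_apply, Term.place, if_neg e0, if_neg e1, if_neg e2, Pauli.mul_I,
      onRing_natCast (by omega)]
    exact hOi
  have pj : (onRing N O * h.place j) j ≠ .I := by
    rw [Pi.mul_apply, hz j hj, Pauli.I_mul, Term.place, if_pos rfl]
    exact h.fst_ne
  have pj1 : (onRing N O * h.place j) (j + 1) = onRing N O (j + 1) * h.snd := by
    rw [Pi.mul_apply, Term.place, if_neg n1, if_pos rfl]
  have pj2 : (onRing N O * h.place j) (j + 2) = onRing N O (j + 2) * h.thd := by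
    rw [Pi.mul_apply, Term.place, if_neg n2, if_neg n3, if_pos rfl]
  rcases (by omega : j.val = N - 1 ∨ j.val = N - 2 ∨ j.val + 2 < N) with e | e | e
  · -- the term starts one site to the left of the word
    have ej : j + 1 = 0 := by
      rw [← hjv, e, Nat.cast_sub (by omega)]; simp
    have ej' : ∀ i : ℕ, ((i : ℕ) : ZMod N) = j + ((i + 1 : ℕ) : ZMod N) := by
      intro i
      push_cast
      linear_combination -ej
    have hlast := keep (n - 1) (by omega) (by omega) h1
    rcases (by omega : n = k ∨ n = k + 1 ∨ n = k + 2) with rfl | rfl | rfl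
    · rw [ej'] at hlast
      exact hC.eq_zero_of_two (d := n - 1 + 1) (by omega) (by omega) pj hlast
    · rcases Term.exists_ne_of_sign_ne_zero hs with ⟨h2, -⟩ | ⟨-, h2⟩ | ⟨h3, -, h2⟩
      · exact absurd (hz _ hj) h2
      · rw [← pj1, ej] at h2
        refine hC.eq_zero_of_two (d := k) le_rfl (by omega) h2 ?_
        simpa using hlast
      · rw [← pj2] at h2
        rw [ej'] at hlast
        refine hC.eq_zero_of_three hkN (a := 2) (b := k + 1 - 1 + 1) (by omega) (by omega) (by omega)
          pj (by simpa using h2) hlast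
    · obtain ⟨⟨i, hi, hi', hOi⟩, -, -⟩ := hc rfl
      have hi2 := keep i hi (by omega) hOi
      rw [ej'] at hlast hi2
      exact hC.eq_zero_of_three hkN (a := i + 1) (b := k + 2 - 1 + 1) (by omega) (by omega)
        (by omega) pj hi2 hlast
  · -- the term starts two sites to the left of the word
    have ej : j + 2 = 0 := by
      rw [← hjv, e, Nat.cast_sub (by omega)]; simp
    have ev : (j + 1).val = N - 1 := by
      have : j + 1 = ((N - 1 : ℕ) : ZMod N) := by
        rw [Nat.cast_sub (by omega)]; push_cast; simp; linear_combination ej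
      rw [this, ZMod.val_natCast_of_lt (by omega)]
    have pj1' : (onRing N O * h.place j) (j + 1) ≠ .I := by
      rw [pj1, hz (j + 1) (by omega), Pauli.I_mul]
      exact h.snd_ne
    have ej' : ∀ i : ℕ, ((i : ℕ) : ZMod N) = j + 1 + ((i + 1 : ℕ) : ZMod N) := by
      intro i
      push_cast
      linear_combination -ej
    have hlast := keep (n - 1) (by omega) (by omega) h1
    rcases (by omega : n = k ∨ n = k + 1 ∨ n = k + 2) with rfl | rfl | rfl
    · rw [ej'] at hlast
      exact hC.eq_zero_of_two (d := n - 1 + 1) (by omega) (by omega) pj1' hlast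
    · rcases Term.exists_ne_of_sign_ne_zero hs with ⟨h2, -⟩ | ⟨h2, -⟩ | ⟨h3, -, h2⟩
      · exact absurd (hz _ hj) h2
      · exact absurd (hz _ (by omega)) h2
      · rw [← pj2, ej] at h2
        refine hC.eq_zero_of_two (d := k) le_rfl (by omega) h2 ?_
        simpa using hlast
    · obtain ⟨⟨i, hi, hi', hOi⟩, -, -⟩ := hc rfl
      have hi2 := keep i hi (by omega) hOi
      rw [ej'] at hlast hi2
      exact hC.eq_zero_of_three hkN (a := i + 1) (b := k + 2 - 1 + 1) (by omega) (by omega)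
        (by omega) pj1' hi2 hlast
  · -- the term does not meet the word
    have v : ∀ d : ℕ, d ≤ 2 → n ≤ (j + (d : ZMod N)).val := by
      intro d hd
      rw [← hjv, ← Nat.cast_add, ZMod.val_natCast_of_lt (by omega)]
      omega
    have v1 := v 1 (by omega)
    have v2 := v 2 (by omega)
    push_cast at v1 v2
    rcases Term.exists_ne_of_sign_ne_zero hs with ⟨h2, -⟩ | ⟨h2, -⟩ | ⟨-, h2, -⟩
    · exact absurd (hz _ hj) h2
    · exact absurd (hz _ v1) h2
    · exact absurd (hz _ v2) h2

/-- Terms inside the word contribute only if the result is not wide. -/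
theorem RingCharge.eq_zero_of_wide {k : ℕ} (hk : 4 ≤ k) (hkN : 2 * k ≤ N) {κ : Term → ℤ}
    {C : (ZMod N → Pauli) → ℂ} (hC : RingCharge N k κ C) {n t : ℕ} {O : ℕ → Pauli} {h : Term}
    (hn' : n ≤ k + 2) (hO : ∀ i, n ≤ i → O i = .I)
    (hc : Clean k n O) (ht : t + h.len ≤ n)
    (hs : h.sign (O t) (O (t + 1)) (O (t + 2)) ≠ 0) (hw : IsWide k (h.act t O)) :
    C (onRing N (h.act t O)) = 0 := by
  obtain ⟨i, j, hij, hi, hj⟩ := hw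
  have hjn : j < n := by
    by_contra h'
    exact hj (by rw [h.act_of_ge _ (by omega), hO _ (by omega)])
  by_cases hjk : j ≤ i + k
  · exact hC.onRing_eq_zero_of_two hij (by omega) (by omega) hi hj
  obtain rfl : i = 0 := by omega
  obtain rfl : j = k + 1 := by omega
  obtain rfl : n = k + 2 := by omega
  by_cases hy : ∃ y, 1 ≤ y ∧ y ≤ k ∧ h.act t O y ≠ .I
  · obtain ⟨y, hy1, hyk, hy⟩ := hy
    exact hC.onRing_eq_zero_of_three hkN (i := 0) (j := y) (l := k + 1) (by omega) (by omega)
      (by omega) (by omega) (by omega) hi hy hj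
  push Not at hy
  -- The interior has been erased by a single term. The conditions `3 ≤ i1` and `i2 ≤ k - 2` force
  -- this term to lie within the sites `1, …, k`, so the letters there are those of `h` itself,
  -- which commutes with itself.
  exfalso
  obtain ⟨-, ⟨i1, h1, h1', hO1⟩, ⟨i2, h2, h2', hO2⟩⟩ := hc rfl
  have hlen := h.len_cases
  have mem : ∀ y, 1 ≤ y → y ≤ k → O y ≠ .I → t ≤ y ∧ y < t + h.len := by
    intro y hy1 hy2 hOy
    constructor
    · by_contra h'
      exact hOy (by rw [← h.act_of_lt (j := t) O (by omega)]; exact hy y hy1 hy2)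
    · by_contra h'
      exact hOy (by rw [← h.act_of_ge (j := t) O (by omega)]; exact hy y hy1 hy2)
  have m1 := mem i1 (by omega) (by omega) hO1
  have m2 := mem i2 (by omega) (by omega) hO2
  have e0 := hy t (by omega) (by omega)
  have e1 := hy (t + 1) (by omega) (by omega)
  rw [h.act_fst, Pauli.mul_eq_I] at e0
  rw [h.act_snd, Pauli.mul_eq_I] at e1
  rw [e0, e1] at hs
  refine hs (h.sign_self _ fun h3 => ?_)
  have e2 := hy (t + 2) (by omega) (by omega)
  rwa [h.act_thd, Pauli.mul_eq_I] at e2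

/-- Setting the coefficients of wide words to zero makes `wide` hold by definition. The geometry of
the ring enters in `eqn`: every product that is discarded there has coefficient zero on the ring as
well, or belongs to a vanishing commutator. -/
theorem RingCharge.windowCharge {k : ℕ} (hk : 4 ≤ k) (hkN : 2 * k ≤ N) {κ : Term → ℤ}
    {C : (ZMod N → Pauli) → ℂ} (hC : RingCharge N k κ C) :
    WindowCharge k κ (windowCoeff N k C) where
  wide w hw := if_pos hw
  shift w hw h0 := by
    have hwide : IsWide k w ↔ IsWide k fun i => w (i + 1) := by
      constructor
      · rintro ⟨i, j, hij, hi, hj⟩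
        have hi0 : i ≠ 0 := by rintro rfl; exact hi h0
        refine ⟨i - 1, j - 1, by omega, ?_, ?_⟩
        · change w (i - 1 + 1) ≠ _
          rwa [Nat.sub_add_cancel (by omega)]
        · change w (j - 1 + 1) ≠ _
          rwa [Nat.sub_add_cancel (by omega)]
      · rintro ⟨i, j, hij, hi, hj⟩
        exact ⟨i + 1, j + 1, by omega, hi, hj⟩
    unfold windowCoeff
    rw [hwide, ← hC.shift (onRing N w)]
    rw [onRing_add_one hw (by omega) h0]
  eqn n O hn hn' hO h0 h1 hc := by
    have := hC.eqn (onRing N O)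
    rw [sum_zmod, ← Finset.sum_subset (Finset.range_subset_range.2 (show n ≤ N by omega))] at this
    · refine Eq.trans ?_ this
      refine Finset.sum_congr rfl fun t ht => Finset.sum_congr rfl fun h _ => ?_
      rw [Finset.mem_range] at ht
      have c0 : onRing N O (t : ZMod N) = O t := onRing_natCast (by omega) O
      have c1 : onRing N O ((t : ZMod N) + 1) = O (t + 1) := by
        have := onRing_natCast (N := N) (i := t + 1) (by omega) O
        push_cast at this
        exact this
      have c2 : onRing N O ((t : ZMod N) + 2) = O (t + 2) := by
        have := onRing_natCast (N := N) (i := t + 2) (by omega) O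
        push_cast at this
        exact this
      rw [c0, c1, c2, onRing_mul_place (by omega)]
      by_cases hs : h.sign (O t) (O (t + 1)) (O (t + 2)) = 0
      · simp only [hs, mul_zero, Int.cast_zero, zero_mul, ite_self]
      split_ifs with hlen
      · unfold windowCoeff
        split_ifs with hw
        · rw [hC.eq_zero_of_wide hk hkN hn' hO hc hlen hs hw]
        · rfl
      · rw [hC.eq_zero_of_right hk hkN hn hn' hO h0 hc ht (by omega) hs, mul_zero]
    · intro t ht ht'
      rw [Finset.mem_range] at ht ht'
      refine Finset.sum_eq_zero fun h _ => ?_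
      by_cases hs : h.sign (onRing N O (t : ZMod N)) (onRing N O ((t : ZMod N) + 1))
        (onRing N O ((t : ZMod N) + 2)) = 0
      · simp only [hs, mul_zero, Int.cast_zero, zero_mul]
      · rw [hC.eq_zero_of_left hk hkN hn hn' hO h1 hc
          (by rw [ZMod.val_natCast_of_lt ht]; omega) hs, mul_zero]

theorem RingCharge.vanishesAt {k : ℕ} (hk : 4 ≤ k) {κ : Term → ℤ}
    {C : (ZMod N → Pauli) → ℂ} (hC : RingCharge N k κ C)
    (h : ∀ w : ℕ → Pauli, w 0 ≠ .I → w (k - 1) ≠ .I → (∀ i, k ≤ i → w i = .I) →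
      windowCoeff N k C w = 0) : VanishesAt k C := by
  intro P j h0 h1 h2
  rw [← hC.shift_natCast P j.val]
  have hj : ((j.val : ℕ) : ZMod N) = j := by simp
  set w : ℕ → Pauli := fun i => if i < k then P (i + j) else .I with hw
  have e : (fun x => P (x + (j.val : ℕ))) = onRing N w := by
    funext x
    simp only [onRing, hw, hj, ZMod.natCast_val, ZMod.cast_id', id]
    split_ifs with hx
    · rfl
    · by_contra h'
      have := h2 _ h'
      simp at this
      omega
  rw [e]
  have hwk : ∀ i, k ≤ i → w i = .I := fun i hi => if_neg (by omega)
  have := h w ?_ ?_ hwk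
  · rw [windowCoeff, if_neg] at this
    · exact this
    · rintro ⟨i, i', hi, -, h'⟩
      exact h' (hwk _ (by omega))
  · simp only [hw]
    rw [if_pos (by omega)]
    simpa using h0
  · simp only [hw]
    rw [if_pos (by omega), add_comm]
    exact h1

end

section

/-! ### The equations given by words of length `k + 1` and `k + 2` -/

variable {k : ℕ} {κ : Term → ℤ} {c : (ℕ → Pauli) → ℂ}

/-- The last letter of a term. -/
def Term.last (h : Term) : Pauli := if h.len = 2 then h.snd else h.thd

/-- The letters of the three-site term `h` determined by its end. -/
theorem Term.eq_of_end {h h' : Term} (h3 : h.len = 3) (h3' : h'.len = 3) (e : h.snd = h'.snd)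
    (e' : h.thd = h'.thd) : h = h' := by
  revert h h'; decide

theorem Term.sign_pair {h : Term} (h2 : h.len = 2) (o : Pauli) : h.sign h.fst h.snd o = 0 :=
  h.sign_self o fun h3 => absurd h3 (by omega)

theorem Term.sign_right {h : Term} (h3 : h.len = 3) (p : Pauli) :
    h.sign (p * h.fst) h.snd h.thd = p.sign h.fst := by
  revert h p; decide

theorem Term.sign_left (h : Term) (p : Pauli) :
    h.sign h.fst h.snd p = (p * h.thd).sign h.thd := by
  revert h p; decide

/-- A word of length `k + 1` becomes short enough only by losing its first or its last letter. This
singles out the terms at the two ends whose outer letter agrees with that of `O`. -/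
theorem WindowCharge.eqn_one (hc : WindowCharge k κ c) (hk : 4 ≤ k) {O : ℕ → Pauli}
    (hO : ∀ i, k < i → O i = .I) (h0 : O 0 ≠ .I) (h1 : O k ≠ .I) :
    ∑ h : Term, (if h.fst = O 0 then
      ((κ h * h.sign (O 0) (O 1) (O 2) : ℤ) : ℂ) * c (fun i => h.act 0 O (i + 1)) else 0) +
    ∑ h : Term, (if h.last = O k then
      ((κ h * h.sign (O (k + 1 - h.len)) (O (k + 2 - h.len)) (O (k + 3 - h.len)) : ℤ) : ℂ) *
        c (h.act (k + 1 - h.len) O) else 0) = 0 := by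
  have := hc.eqn (k + 1) O (by omega) (by omega) (fun i hi => hO i hi) h0 h1
    (fun h => absurd h (by omega))
  rw [Finset.sum_comm] at this
  rw [← Finset.sum_add_distrib]
  refine Eq.trans ?_ this
  refine Finset.sum_congr rfl fun h _ => ?_
  have hlen := h.len_cases
  have hend : h.act (k + 1 - h.len) O k = O k * h.last := by
    unfold Term.last
    rcases hlen with e | e
    · rw [e, if_pos rfl]
      have := h.act_snd (k + 1 - 2) O
      rwa [show k + 1 - 2 + 1 = k by omega] at this
    · rw [e, if_neg (by omega)]
      have := h.act_thd (k + 1 - 3) O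
      rwa [show k + 1 - 3 + 2 = k by omega] at this
  rw [Finset.sum_eq_add_of_mem 0 (k + 1 - h.len) (by simp) (by simp; omega) (by omega),
    if_pos (show 0 + h.len ≤ k + 1 by omega), if_pos (show k + 1 - h.len + h.len ≤ k + 1 by omega)]
  · congr 1
    · split_ifs with e
      · rw [hc.shift (h.act 0 O)]
        · intro i hi
          rw [h.act_of_ge _ (by omega), hO i (by omega)]
        · rw [h.act_fst, Pauli.mul_eq_I, e]
      · rw [hc.wide, mul_zero]
        refine ⟨0, k, by omega, ?_, ?_⟩
        · rw [h.act_fst, Ne, Pauli.mul_eq_I]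
          exact fun e' => e e'.symm
        · rwa [h.act_of_ge _ (by omega)]
    · rw [show k + 1 - h.len + 1 = k + 2 - h.len by omega,
        show k + 1 - h.len + 2 = k + 3 - h.len by omega]
      split_ifs with e
      · rfl
      · rw [hc.wide, mul_zero]
        refine ⟨0, k, by omega, ?_, ?_⟩
        · rwa [h.act_of_lt _ (by omega)]
        · rw [hend, Ne, Pauli.mul_eq_I]
          exact fun e' => e e'.symm
  · intro j hj hj'
    rw [Finset.mem_range] at hj
    split_ifs with hjl
    · rw [hc.wide, mul_zero]
      refine ⟨0, k, by omega, ?_, ?_⟩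
      · rwa [h.act_of_lt _ (by omega)]
      · rwa [h.act_of_ge _ (by omega)]
    · rfl

/-- The word obtained from the word `w` by multiplying its last letter with the first letter of `h`,
appending the rest of `h`, and removing the first two letters, which belong to a term `h'`. -/
def slide (k : ℕ) (w : ℕ → Pauli) (h h' : Term) (i : ℕ) : Pauli :=
  if i = 0 then w 2 * h'.thd else if i < k - 3 then w (i + 2)
  else if i = k - 3 then w (k - 1) * h.fst else if i = k - 2 then h.snd
  else if i = k - 1 then h.thd else .I

/-- The word `w` extended to the right by the term `h`. -/
def extend (k : ℕ) (w : ℕ → Pauli) (h : Term) (i : ℕ) : Pauli :=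
  if i < k - 1 then w i else if i = k - 1 then w i * h.fst else if i = k then h.snd
  else if i = k + 1 then h.thd else .I

/-- A word of length `k + 2` must lose two letters at the same end, by a single term. At the right
end only `h` does this; at the left end a three-site term matching the first two letters is needed,
since a two-site term that matches both commutes with the word. The condition `he` keeps the letter
at `k - 1` different from `I`, and the interior letter of `w` provides the rest of the `Clean`
condition. -/
theorem WindowCharge.eqn_slide (hc : WindowCharge k κ c) (hk : 4 ≤ k) {w : ℕ → Pauli}
    (hw : ∀ i, k ≤ i → w i = .I) (h0 : w 0 ≠ .I) (hi : ∃ i, 1 ≤ i ∧ i ≤ k - 2 ∧ w i ≠ .I)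
    {h : Term} (h3 : h.len = 3) (he : w (k - 1) ≠ h.fst) :
    ((κ h * (w (k - 1)).sign h.fst : ℤ) : ℂ) * c w +
    ∑ h' : Term, (if h'.len = 3 ∧ h'.fst = w 0 ∧ h'.snd = w 1 then
      ((κ h' * (w 2 * h'.thd).sign h'.thd : ℤ) : ℂ) * c (slide k w h h') else 0) = 0 := by
  set O := extend k w h with hOdef
  have O0 : O 0 = w 0 := by rw [hOdef]; unfold extend; rw [if_pos (by omega)]
  have O1 : O 1 = w 1 := by rw [hOdef]; unfold extend; rw [if_pos (by omega)]
  have O2 : O 2 = w 2 := by rw [hOdef]; unfold extend; rw [if_pos (by omega)]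
  have Oe : O (k - 1) = w (k - 1) * h.fst := by
    rw [hOdef]; unfold extend; rw [if_neg (by omega), if_pos rfl]
  have Ok : O k = h.snd := by
    rw [hOdef]; unfold extend; rw [if_neg (by omega), if_neg (by omega), if_pos rfl]
  have Ok1 : O (k + 1) = h.thd := by
    rw [hOdef]; unfold extend
    rw [if_neg (by omega), if_neg (by omega), if_neg (by omega), if_pos rfl]
  have hOI : ∀ i, k + 2 ≤ i → O i = .I := by
    intro i hi
    rw [hOdef]; unfold extend
    rw [if_neg (by omega), if_neg (by omega), if_neg (by omega), if_neg (by omega)]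
  have Oe' : O (k - 1) ≠ .I := by rw [Oe, Ne, Pauli.mul_eq_I]; exact he
  have Ok1' : O (k + 1) ≠ .I := by rw [Ok1]; exact Term.thd_ne h3
  have := hc.eqn (k + 2) O (by omega) (by omega) hOI (by rwa [O0]) Ok1' ?_
  swap
  · obtain ⟨i, hi1, hi2, hi3⟩ := hi
    refine fun _ => ⟨⟨k - 1, by omega, by omega, Oe'⟩, ⟨k - 1, by omega, by omega, Oe'⟩,
      ⟨i, hi1, hi2, ?_⟩⟩
    rw [hOdef]; unfold extend
    rwa [if_pos (by omega)]
  rw [Finset.sum_eq_add_of_mem 0 (k - 1) (by simp) (by simp; omega) (by omega), add_comm] at this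
  · refine Eq.trans (congrArg₂ _ ?_ ?_) this
    · rw [Finset.sum_eq_single h]
      · rw [if_pos (by omega), show k - 1 + 1 = k by omega, show k - 1 + 2 = k + 1 by omega, Oe, Ok,
          Ok1]
        have e1 : h.act (k - 1) O = w := by
          funext i
          unfold Term.act
          rw [show k - 1 + 1 = k by omega, show k - 1 + 2 = k + 1 by omega]
          split_ifs with i1 i2 i3
          · rw [i1, Oe, Pauli.mul_mul_self]
          · rw [i2, Ok, Pauli.mul_self, hw _ le_rfl]
          · rw [i3, Ok1, Pauli.mul_self, hw _ (by omega)]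
          · rcases lt_or_ge i k with hik | hik
            · rw [hOdef]; unfold extend; rw [if_pos (by omega)]
            · rw [hOI _ (by omega), hw _ hik]
        rw [e1, Term.sign_right h3]
      · intro h' _ hh'
        split_ifs with hl
        · have h3' : h'.len = 3 ∨ h'.len = 2 := h'.len_cases.symm
          -- A term at `k - 1` must erase the letters at both `k` and `k + 1`. A three-site term is
          -- determined by these two letters.
          by_cases e2 : h'.thd = O (k + 1)
          · have hl3 : h'.len = 3 := by
              by_contra hl3
              rw [Term.thd_eq hl3] at e2
              exact Ok1' e2.symm
            rw [hc.wide, mul_zero]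
            refine ⟨0, k, by omega, ?_, ?_⟩
            · rwa [h'.act_of_lt _ (by omega), O0]
            · have := h'.act_snd (k - 1) O
              rw [show k - 1 + 1 = k by omega] at this
              rw [this, Ne, Pauli.mul_eq_I, Ok]
              exact fun e => hh' (Term.eq_of_end hl3 h3 e.symm (e2.trans Ok1))
          · rw [hc.wide, mul_zero]
            refine ⟨0, k + 1, by omega, ?_, ?_⟩
            · rwa [h'.act_of_lt _ (by omega), O0]
            · have := h'.act_thd (k - 1) O
              rw [show k - 1 + 2 = k + 1 by omega] at this
              rw [this, Ne, Pauli.mul_eq_I]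
              exact fun e => e2 e.symm
        · rfl
      · simp
    · refine Finset.sum_congr rfl fun h' _ => ?_
      have hlen := h'.len_cases
      rw [if_pos (show 0 + h'.len ≤ k + 2 by omega)]
      have key : h'.act 0 O (k + 1) ≠ .I := by rwa [h'.act_of_ge _ (by omega)]
      by_cases e1 : h'.fst = w 0
      · by_cases e2 : h'.snd = w 1
        · by_cases l3 : h'.len = 3
          · rw [if_pos ⟨l3, e1, e2⟩]
            have a0 : h'.act 0 O 0 = .I := by rw [h'.act_fst, O0, e1, Pauli.mul_self]
            have a1 : h'.act 0 O 1 = .I := by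
              have := h'.act_snd 0 O
              rw [zero_add] at this
              rw [this, O1, e2, Pauli.mul_self]
            have aI : ∀ i, k + 2 ≤ i → h'.act 0 O i = .I := fun i hi => by
              rw [h'.act_of_ge _ (by omega), hOI i hi]
            rw [hc.shift (h'.act 0 O) aI a0, hc.shift (fun i => h'.act 0 O (i + 1))
              (fun i hi => aI _ (by omega)) a1]
            congr 2
            · rw [O0, O1, zero_add, O2, ← e1, ← e2, Term.sign_left]
            · funext i
              unfold slide
              split_ifs with i0 i1 i2 i3 i4
              · rw [i0]
                have := h'.act_thd 0 O
                rw [zero_add, O2] at this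
                exact this.symm
              all_goals
                change _ = h'.act 0 O (i + 2)
                rw [h'.act_of_ge _ (by omega)]
              · rw [hOdef]; unfold extend
                rw [if_pos (by omega)]
              · rw [i2, show k - 3 + 2 = k - 1 by omega, Oe]
              · rw [i3, show k - 2 + 2 = k by omega, Ok]
              · rw [i4, show k - 1 + 2 = k + 1 by omega, Ok1]
              · rw [hOI _ (by omega)]
          · rw [if_neg (fun h => l3 h.1), O0, O1, ← e1, ← e2, Term.sign_pair (by omega)]
            simp
        · rw [if_neg (fun h => e2 h.2.2), hc.wide, mul_zero]
          refine ⟨1, k + 1, by omega, ?_, key⟩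
          have := h'.act_snd 0 O
          rw [zero_add] at this
          rw [this, O1, Ne, Pauli.mul_eq_I]
          exact fun e => e2 e.symm
      · rw [if_neg (fun h => e1 h.2.1), hc.wide, mul_zero]
        refine ⟨0, k + 1, by omega, ?_, key⟩
        rw [h'.act_fst, O0, Ne, Pauli.mul_eq_I]
        exact fun e => e1 e.symm
  · intro j hj hj'
    rw [Finset.mem_range] at hj
    refine Finset.sum_eq_zero fun h' _ => ?_
    have hlen := h'.len_cases
    split_ifs with hl
    · have a0 : h'.act j O 0 ≠ .I := by rwa [h'.act_of_lt _ (by omega), O0]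
      -- A term at `j ≤ k - 2` does not reach the last letter. At `j = k` only a two-site term fits,
      -- and if it erases both letters it commutes with the word.
      rcases (by omega : j ≤ k - 2 ∨ j = k) with hjk | rfl
      · rw [hc.wide, mul_zero]
        refine ⟨0, k + 1, by omega, a0, ?_⟩
        rwa [h'.act_of_ge _ (by omega)]
      · by_cases e1 : h'.act j O j = .I
        · by_cases e2 : h'.act j O (j + 1) = .I
          · rw [h'.act_fst, Pauli.mul_eq_I] at e1
            rw [h'.act_snd, Pauli.mul_eq_I] at e2
            rw [e1, e2, Term.sign_pair (by omega)]
            simp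
          · rw [hc.wide, mul_zero]
            exact ⟨0, j + 1, by omega, a0, e2⟩
        · rw [hc.wide, mul_zero]
          exact ⟨0, j, by omega, a0, e1⟩
    · rfl

end

section

variable {k : ℕ} {κ : Term → ℤ} {c : (ℕ → Pauli) → ℂ}

/-! ### Sliding a word by two sites -/

/-- `w` is a word of length exactly `k`. -/
def IsWord (k : ℕ) (w : ℕ → Pauli) : Prop :=
  w 0 ≠ .I ∧ w (k - 1) ≠ .I ∧ ∀ i, k ≤ i → w i = .I

/-- The three-site term `h` occurs in the Hamiltonian. -/
def Kept (κ : Term → ℤ) (h : Term) : Prop := h.len = 3 ∧ κ h ≠ 0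

/-- One step along a word: a three-site term with first letters `D`, `y` is split off, and what
remains of the next letter `z` is `D'`. -/
def Step (κ : Term → ℤ) (D y z D' : Pauli) : Prop :=
  ∃ h, Kept κ h ∧ h.fst = D ∧ h.snd = y ∧ z ≠ .I ∧ z ≠ h.thd ∧ D' = z * h.thd

/-- Hypotheses on the coefficients under which words without interior letters are harmless. -/
structure Admissible (κ : Term → ℤ) : Prop where
  two : ∀ h : Term, h.len = 2 → κ h = -2
  full : (κ .ZXX = 0 ∧ κ .ZYY = 0) ∨ ∀ p : Pauli, ∃ h, Kept κ h ∧ p ≠ h.fst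

theorem Pauli.sign_ne_zero {p q : Pauli} (hp : p ≠ .I) (hq : q ≠ .I) (hpq : p ≠ q) :
    p.sign q ≠ 0 := by
  revert p q; decide

theorem Pauli.ne_of_sign_mul_ne_zero {p q : Pauli} (h : (p * q).sign q ≠ 0) :
    p ≠ .I ∧ p ≠ q := by
  revert p q; decide

/-- The contribution of `h` in `eqn_slide` is nonzero, so some removed term `h'` must balance it;
its nonzero sign says that the third letter of `w` anticommutes with that of `h'`. -/
theorem WindowCharge.exists_slide_of_interior (hc : WindowCharge k κ c) (hk : 4 ≤ k)
    {w : ℕ → Pauli} (hw : IsWord k w) (hi : ∃ i, 1 ≤ i ∧ i ≤ k - 2 ∧ w i ≠ .I) {h : Term}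
    (hh : Kept κ h) (he : w (k - 1) ≠ h.fst) (hcw : c w ≠ 0) :
    ∃ h', Kept κ h' ∧ h'.fst = w 0 ∧ h'.snd = w 1 ∧ w 2 ≠ .I ∧ w 2 ≠ h'.thd ∧
      c (slide k w h h') ≠ 0 := by
  have := hc.eqn_slide hk hw.2.2 hw.1 hi hh.1 he
  have h1 : ((κ h * (w (k - 1)).sign h.fst : ℤ) : ℂ) * c w ≠ 0 := by
    refine mul_ne_zero ?_ hcw
    rw [Ne, Int.cast_eq_zero]
    exact mul_ne_zero hh.2 (Pauli.sign_ne_zero hw.2.1 h.fst_ne he)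
  obtain ⟨h', -, h2⟩ := Finset.exists_ne_zero_of_sum_ne_zero
    (fun h0 => h1 (by rw [h0, add_zero] at this; exact this))
  split_ifs at h2 with h3
  · have h4 := left_ne_zero_of_mul h2
    rw [Ne, Int.cast_eq_zero] at h4
    have h5 := Pauli.ne_of_sign_mul_ne_zero (right_ne_zero_of_mul h4)
    exact ⟨h', ⟨h3.1, left_ne_zero_of_mul h4⟩, h3.2.1, h3.2.2, h5.1, h5.2,
      right_ne_zero_of_mul h2⟩
  · exact absurd rfl h2

/-- A two-site term whose letter is different from a given one, and such that the letters created at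
the end of a word are not the end of a three-site term. -/
def exitTerm : Pauli → Term
  | .X => .YY
  | _ => .XX

/-- Such a word may wrap around the ring after an extension to length `k + 2`, so the equation of
length `k + 1` is used, with a two-site term appended. No term contributes on the left, since the
first letter is followed by `I`, `I`. Choosing `X` or `Y` as the appended letter excludes terms
ending with `Z` on the right. -/
theorem WindowCharge.eq_zero_of_no_interior (hc : WindowCharge k κ c) (hκ : Admissible κ)
    (hk : 4 ≤ k) {w : ℕ → Pauli} (hw : IsWord k w)
    (hi : ∀ i, 1 ≤ i → i ≤ k - 2 → w i = .I) (hJ : w (k - 1) ≠ .I) : c w = 0 := by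
  set e := w (k - 1) with he
  have hh2 : (exitTerm e).len = 2 := by cases e <;> rfl
  have hhe : e ≠ (exitTerm e).fst := by cases e <;> decide
  set h := exitTerm e with hh
  set O : ℕ → Pauli := fun i => if i = k then h.snd else if i = k - 1 then e * h.fst else w i
    with hO
  have Ok : O k = h.snd := if_pos rfl
  have Ok1 : O (k - 1) = e * h.fst := by
    simp only [hO]; rw [if_neg (by omega)]; simp
  have Oi : ∀ i, i < k - 1 → O i = w i := by
    intro i hi
    simp only [hO]; rw [if_neg (by omega), if_neg (by omega)]
  have OI : ∀ i, k < i → O i = .I := by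
    intro i hi
    simp only [hO]; rw [if_neg (by omega), if_neg (by omega), hw.2.2 i (by omega)]
  have O1 : O 1 = .I := by rw [Oi _ (by omega), hi 1 le_rfl (by omega)]
  have O2 : O 2 = .I := by rw [Oi _ (by omega), hi 2 (by omega) (by omega)]
  have Ok2 : O (k - 2) = .I := by rw [Oi _ (by omega), hi _ (by omega) le_rfl]
  have := hc.eqn_one hk OI (by rw [Oi _ (by omega)]; exact hw.1) (by rw [Ok]; exact h.snd_ne)
  rw [Finset.sum_eq_zero, zero_add, Finset.sum_eq_single h] at this
  · rw [if_pos (by rw [Ok, Term.last, if_pos hh2]), hh2, show k + 1 - 2 = k - 1 by omega,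
      show k + 2 - 2 = k by omega, show k + 3 - 2 = k + 1 by omega, Ok, Ok1] at this
    have e1 : h.act (k - 1) O = w := by
      funext i
      unfold Term.act
      rw [show k - 1 + 1 = k by omega, show k - 1 + 2 = k + 1 by omega]
      split_ifs with i1 i2 i3
      · rw [i1, Ok1, Pauli.mul_mul_self]
      · rw [i2, Ok, Pauli.mul_self, hw.2.2 _ le_rfl]
      · rw [i3, OI _ (by omega), Term.thd_eq (by omega), hw.2.2 _ (by omega)]; rfl
      · rcases lt_or_ge i k with hik | hik
        · rw [Oi _ (by omega)]
        · rw [OI _ (by omega), hw.2.2 _ hik]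
    rw [e1, hκ.two h hh2, OI _ (by omega)] at this
    refine (mul_eq_zero.1 this).resolve_left ?_
    rw [Int.cast_eq_zero]
    refine mul_ne_zero (by norm_num) ?_
    rw [hh]
    clear_value e
    clear * - hJ
    revert e; decide
  · intro t _ hth
    split_ifs with h1
    · rcases t.len_cases with h2 | h3
      · exfalso
        rw [Ok, Term.last, if_pos h2] at h1
        refine hth ?_
        clear * - h1 h2 hh2
        clear_value h
        revert t h; decide
      · rw [Ok, Term.last, if_neg (by omega)] at h1
        rw [h3, show k + 1 - 3 = k - 2 by omega, show k + 2 - 3 = k - 1 by omega,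
          show k + 3 - 3 = k by omega, Ok2, Ok1, Ok]
        by_cases hs : t.sign Pauli.I (e * h.fst) h.snd = 0
        · rw [hs]; simp
        have hs1 : e * h.fst * t.snd ≠ .I := by
          rw [← h1] at hs
          generalize e * h.fst = p at hs
          clear * - hs h3
          revert t p; decide
        -- Either no three-site term ends with `X` or `Y`, or the word produced by `t` has an
        -- interior letter and can be slid. The slide would have to match a second letter `I`, which
        -- is impossible.
        rcases hκ.full with ⟨h4, h5⟩ | hfull
        · have : κ t = 0 := by
            clear_value h
            clear_value e
            have h6 : h.snd = .X ∨ h.snd = .Y := by rw [hh]; cases e <;> decide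
            have : t = .ZXX ∨ t = .ZYY := by
              clear * - h6 h1 h3
              generalize h.snd = p at h6 h1
              revert t p; decide
            rcases this with rfl | rfl <;> assumption
          rw [this]; simp
        · rw [mul_eq_zero]
          right
          by_contra hcw
          have a1 : t.act (k - 2) O (k - 1) = e * h.fst * t.snd := by
            have := t.act_snd (k - 2) O
            rwa [show k - 2 + 1 = k - 1 by omega, Ok1] at this
          have hword : IsWord k (t.act (k - 2) O) := by
            refine ⟨?_, ?_, ?_⟩
            · rw [t.act_of_lt _ (by omega), Oi _ (by omega)]; exact hw.1
            · rwa [a1]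
            · intro i hi
              rcases (by omega : i = k ∨ k < i) with rfl | hi'
              · have := t.act_thd (i - 2) O
                rw [show i - 2 + 2 = i by omega] at this
                rw [this, Ok, h1, Pauli.mul_self]
              · rw [t.act_of_ge _ (by omega), OI i hi']
          obtain ⟨t', ht', hne⟩ := hfull (t.act (k - 2) O (k - 1))
          obtain ⟨h', -, -, h6, -⟩ := hc.exists_slide_of_interior hk hword
            ⟨k - 2, by omega, le_rfl, by rw [t.act_fst, Ok2, Pauli.I_mul]; exact t.fst_ne⟩ ht' hne hcw
          rw [t.act_of_lt _ (by omega), O1] at h6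
          exact h'.snd_ne h6
    · rfl
  · simp
  · intro t _
    split_ifs with h1
    · rw [O1, O2, ← h1]
      have : t.sign t.fst .I .I = 0 := by clear * -; revert t; decide
      rw [this]; simp
    · rfl

theorem WindowCharge.exists_slide (hc : WindowCharge k κ c) (hκ : Admissible κ) (hk : 4 ≤ k)
    {w : ℕ → Pauli} (hw : IsWord k w) {h : Term}
    (hh : Kept κ h) (he : w (k - 1) ≠ h.fst) (hcw : c w ≠ 0) :
    ∃ h', Kept κ h' ∧ h'.fst = w 0 ∧ h'.snd = w 1 ∧ w 2 ≠ .I ∧ w 2 ≠ h'.thd ∧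
      c (slide k w h h') ≠ 0 := by
  by_cases hi : ∃ i, 1 ≤ i ∧ i ≤ k - 2 ∧ w i ≠ .I
  · exact hc.exists_slide_of_interior hk hw hi hh he hcw
  · push Not at hi
    exact absurd (hc.eq_zero_of_no_interior hκ hk hw hi hw.2.1) hcw

/-! ### Sliding a word repeatedly -/

/-- The letters of the word `w` followed by those of the terms `H 0`, `H 1`, …, each of which
overlaps the previous one at one site. -/
def stream (k : ℕ) (w : ℕ → Pauli) (H : ℕ → Term) (i : ℕ) : Pauli :=
  if i < k - 1 then w i else if i = k - 1 then w i * (H 0).fst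
  else if (i - (k - 1)) % 2 = 1 then (H ((i - (k - 1)) / 2)).snd
  else (H ((i - (k - 1)) / 2 - 1)).thd * (H ((i - (k - 1)) / 2)).fst

/-- The word that starts with `D` and continues with the letters of the stream from `2 * n` on. -/
def streamWord (k : ℕ) (w : ℕ → Pauli) (H : ℕ → Term) (n : ℕ) (D : Pauli) (i : ℕ) : Pauli :=
  if i = 0 then D else if i < k - 1 then stream k w H (2 * n + i)
  else if i = k - 1 then (if n = 0 then w (k - 1) else (H (n - 1)).thd) else .I

theorem slide_streamWord (hk : 4 ≤ k) (w : ℕ → Pauli) (H : ℕ → Term) (n : ℕ) (D : Pauli)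
    (h' : Term) : slide k (streamWord k w H n D) (H n) h' =
      streamWord k w H (n + 1) (stream k w H (2 * n + 2) * h'.thd) := by
  funext i
  have e2 : streamWord k w H n D 2 = stream k w H (2 * n + 2) := by
    unfold streamWord
    rw [if_neg (by omega), if_pos (by omega)]
  have ek : streamWord k w H n D (k - 1) = if n = 0 then w (k - 1) else (H (n - 1)).thd := by
    unfold streamWord
    rw [if_neg (by omega), if_neg (by omega), if_pos rfl]
  unfold slide
  rw [e2, ek]
  by_cases i0 : i = 0
  · rw [if_pos i0]; unfold streamWord; rw [if_pos i0]
  rw [if_neg i0]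
  by_cases i1 : i < k - 3
  · rw [if_pos i1]; unfold streamWord
    rw [if_neg (by omega), if_pos (by omega), if_neg (by omega), if_pos (by omega),
      show 2 * n + (i + 2) = 2 * (n + 1) + i by ring]
  rw [if_neg i1]
  by_cases i2 : i = k - 3
  · rw [if_pos i2]
    by_cases hn : n = 0
    · rw [if_pos hn]; unfold streamWord stream
      rw [if_neg i0, if_pos (show i < k - 1 by omega), if_neg (by omega), if_pos (by omega), hn, i2,
        show 2 * (0 + 1) + (k - 3) = k - 1 by omega]
    · rw [if_neg hn]; unfold streamWord stream
      rw [if_neg i0, if_pos (show i < k - 1 by omega), if_neg (by omega), if_neg (by omega),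
        if_neg (by omega), show (2 * (n + 1) + i - (k - 1)) / 2 = n by omega]
  rw [if_neg i2]
  by_cases i3 : i = k - 2
  · rw [if_pos i3]; unfold streamWord stream
    rw [if_neg i0, if_pos (show i < k - 1 by omega), if_neg (by omega), if_neg (by omega),
      if_pos (by omega), show (2 * (n + 1) + i - (k - 1)) / 2 = n by omega]
  rw [if_neg i3]; unfold streamWord
  rw [if_neg i0, if_neg (show ¬ i < k - 1 by omega), if_neg (show n + 1 ≠ 0 by omega)]
  rfl

/-- Each slide reads two letters of the stream and keeps one letter `D` as its state. The appended
terms `H n` are arbitrary except that consecutive ones must not cancel at their common site, whereas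
the terms split off are forced by the letters. A choice of `H` that leaves no admissible step shows
that the original coefficient vanishes. -/
theorem WindowCharge.exists_run (hc : WindowCharge k κ c) (hκ : Admissible κ) (hk : 4 ≤ k)
    {w : ℕ → Pauli} (hw : IsWord k w) {H : ℕ → Term} (hH : ∀ n, Kept κ (H n))
    (he : w (k - 1) ≠ (H 0).fst) (hH' : ∀ n, (H n).thd ≠ (H (n + 1)).fst) (hcw : c w ≠ 0)
    (n : ℕ) :
    ∃ D : ℕ → Pauli, D 0 = w 0 ∧ (∀ i < n, Step κ (D i) (stream k w H (2 * i + 1))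
      (stream k w H (2 * i + 2)) (D (i + 1))) ∧ D n ≠ .I ∧ c (streamWord k w H n (D n)) ≠ 0 := by
  induction n with
  | zero =>
    refine ⟨fun _ => w 0, rfl, by simp, hw.1, ?_⟩
    have : streamWord k w H 0 (w 0) = w := by
      funext i
      unfold streamWord stream
      split_ifs with i0 i1 i2 i3 <;> first | omega | simp_all
      exact (hw.2.2 _ (by omega)).symm
    rwa [this]
  | succ n ih =>
    obtain ⟨D, D0, hD, hDn, hcD⟩ := ih
    have e1 : streamWord k w H n (D n) 1 = stream k w H (2 * n + 1) := by
      unfold streamWord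
      rw [if_neg (by omega), if_pos (by omega)]
    have e2 : streamWord k w H n (D n) 2 = stream k w H (2 * n + 2) := by
      unfold streamWord
      rw [if_neg (by omega), if_pos (by omega)]
    have ek : streamWord k w H n (D n) (k - 1) = if n = 0 then w (k - 1) else (H (n - 1)).thd := by
      unfold streamWord
      rw [if_neg (by omega), if_neg (by omega), if_pos rfl]
    have hword : IsWord k (streamWord k w H n (D n)) := by
      refine ⟨by simpa [streamWord] using hDn, ?_, ?_⟩
      · rw [ek]
        split_ifs with hn
        · exact hw.2.1
        · exact Term.thd_ne (hH _).1
      · intro i hi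
        unfold streamWord
        rw [if_neg (by omega), if_neg (by omega), if_neg (by omega)]
    obtain ⟨h', k1, k2, k3, k4, k5, k6⟩ := hc.exists_slide hκ hk hword (hH n) (by
      rw [ek]
      split_ifs with hn
      · rwa [hn]
      · have := hH' (n - 1)
        rwa [Nat.sub_add_cancel (by omega)] at this) hcD
    rw [e1] at k3
    rw [e2] at k4 k5
    rw [slide_streamWord hk] at k6
    refine ⟨Function.update D (n + 1) (stream k w H (2 * n + 2) * h'.thd), ?_, ?_, ?_, ?_⟩
    · rw [Function.update_of_ne (by omega)]; exact D0
    · intro i hi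
      rcases (by omega : i < n ∨ i = n) with hi' | rfl
      · rw [Function.update_of_ne (by omega), Function.update_of_ne (by omega)]
        exact hD i hi'
      · rw [Function.update_of_ne (by omega), Function.update_self]
        refine ⟨h', k1, ?_, k3, k4, k5, rfl⟩
        rw [k2]; simp [streamWord]
    · rw [Function.update_self, Ne, Pauli.mul_eq_I]
      exact k5
    · rwa [Function.update_self]

theorem Term.thd_ne_fst {h : Term} (h3 : h.len = 3) : h.thd ≠ h.fst := by revert h; decide

/-- The shape of the words with a nonzero coefficient. -/
theorem WindowCharge.shape (hc : WindowCharge k κ c) (hκ : Admissible κ) (hk : 4 ≤ k)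
    {w : ℕ → Pauli} (hw : IsWord k w) {h : Term} (hh : Kept κ h) (he : w (k - 1) ≠ h.fst)
    (hcw : c w ≠ 0) (i : ℕ) (hi : 1 ≤ i) (hik : i ≤ k - 2) :
    if i % 2 = 1 then w i = .X ∨ w i = .Y else w i ≠ .I := by
  -- The stream begins with the letters of `w` before its last one, so the steps of the run
  -- constrain `w` itself. Odd positions are read as second letters of terms, which are `X` or `Y`.
  obtain ⟨D, -, hD, -⟩ := hc.exists_run hκ hk hw (H := fun _ => h) (fun _ => hh) he
    (fun _ => Term.thd_ne_fst hh.1) hcw k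
  have hs : ∀ i, i ≤ k - 2 → stream k w (fun _ => h) i = w i := by
    intro i hi
    unfold stream
    rw [if_pos (by omega)]
  split_ifs with hpar
  · obtain ⟨h', h1, -, h3, -⟩ := hD (i / 2) (by omega)
    rw [show 2 * (i / 2) + 1 = i by omega, hs i hik] at h3
    rw [← h3]
    have := h1.1
    clear * - this
    revert h'; decide
  · obtain ⟨h', h1, -, h3, h4, -⟩ := hD (i / 2 - 1) (by omega)
    rwa [show 2 * (i / 2 - 1) + 2 = i by omega, hs i hik] at h4

end

section

variable {k : ℕ} {κ : Term → ℤ} {c : (ℕ → Pauli) → ℂ}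

/-! ### Alternating words -/

theorem Pauli.mul_def (p q : Pauli) : p * q = Pauli.mul p q := rfl

/-- The letters `X`, `X`, `Y`, `X`, `Y`, …. -/
def alt (i : ℕ) : Pauli := if i = 0 then .X else if i % 2 = 1 then .X else .Y

/-- The word `XXYXY⋯Z` of length `k`. -/
def altWord (k i : ℕ) : Pauli := if i < k - 1 then alt i else if i = k - 1 then .Z else .I

/-- The alternating letters of length `k - 1`, with the last two replaced by `X`, `Y`. -/
def altXY (k i : ℕ) : Pauli :=
  if i < k - 3 then alt i else if i = k - 3 then .X else if i = k - 2 then .Y else .I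

/-- The alternating word `XXYXY⋯X` of length `k - 1`. -/
def altYX (k i : ℕ) : Pauli := if i < k - 1 then alt i else .I

theorem WindowCharge.strip (hc : WindowCharge k κ c) {O : ℕ → Pauli} {h : Term}
    (hO : ∀ i, k < i → O i = .I) (hk : 2 ≤ k) (h1 : O 1 = h.snd) :
    c (fun i => h.act 0 O (i + 1)) = c fun i => if i = 0 then O 2 * h.thd else O (i + 2) := by
  rw [hc.shift]
  · congr 1
    funext i
    simp only [Term.act]
    grind
  · intro i hi
    rw [h.act_of_ge _ (by have := h.len_cases; omega), hO _ (by omega)]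
  · rw [h.act_snd, Pauli.mul_eq_I, h1]

/-- The equation of the word `XXYX⋯XXY` of length `k + 1`: on the right `YY` turns the last two
letters into `Z`, and on the left `XXZ` strips two letters. `XX` on the left commutes with the word,
and `ZYY` on the right anticommutes at two sites, hence commutes too. -/
theorem WindowCharge.altXY_eq (hc : WindowCharge k κ c) (hk : 5 ≤ k) (hodd : k % 2 = 1)
    (hκ : ∀ h : Term, h.len = 2 → κ h = -2) :
    κ .XXZ * c (altXY k) = 2 * c (altWord k) := by
  set O : ℕ → Pauli := fun i => if i < k - 1 then alt i else if i = k - 1 then .X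
    else if i = k then .Y else .I with hO
  have O0 : O 0 = .X := by grind [alt]
  have O1 : O 1 = .X := by grind [alt]
  have O2 : O 2 = .Y := by grind [alt]
  have Ok2 : O (k - 2) = .X := by grind [alt]
  have Ok1 : O (k - 1) = .X := by grind
  have Ok : O k = .Y := by grind
  have OI : ∀ i, k < i → O i = .I := by grind
  have := hc.eqn_one (by omega) OI (by rw [O0]; decide) (by rw [Ok]; decide)
  have e2 : (fun i => if i = 0 then O 2 * Term.XXZ.thd else O (i + 2)) = altXY k := by
    funext i
    simp only [altXY, hO, alt, Term.thd]
    grind [Pauli.mul_def, Pauli.mul]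
  have e3 : Term.YY.act (k - 1) O = altWord k := by
    funext i
    simp only [Term.act, altWord, hO, Term.fst, Term.snd, Term.thd]
    grind [Pauli.mul_def, Pauli.mul]
  simp only [sum_term, Term.fst, Term.last, Term.len, O0, O1, O2, Ok, reduceIte, reduceCtorEq,
    Nat.reduceEqDiff, Term.snd, Term.thd, show k + 3 - 2 = k + 1 by omega,
    OI (k + 1) (by omega), show k + 1 - 2 = k - 1 by omega, show k + 1 - 3 = k - 2 by omega, Ok2,
    show k + 2 - 3 = k - 1 by omega, Ok1, show k + 2 - 2 = k by omega,
    show k + 3 - 3 = k by omega, Term.sign, sign₃, Pauli.mul_def, Pauli.mul, Pauli.sign, e3,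
    hc.strip OI (by omega) (show O 1 = Term.XXZ.snd from O1)] at this e2
  rw [e2, hκ .YY rfl] at this
  norm_num at this
  linear_combination -this

/-- As for `altXY_eq`, with the last two letters `Y`, `X` and the term `XX` on the right. -/
theorem WindowCharge.altYX_eq (hc : WindowCharge k κ c) (hk : 5 ≤ k) (hodd : k % 2 = 1)
    (hκ : ∀ h : Term, h.len = 2 → κ h = -2) :
    κ .XXZ * c (altYX k) = -2 * c (altWord k) := by
  set O : ℕ → Pauli := fun i => if i < k - 1 then alt i else if i = k - 1 then .Y
    else if i = k then .X else .I with hO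
  have O0 : O 0 = .X := by grind [alt]
  have O1 : O 1 = .X := by grind [alt]
  have O2 : O 2 = .Y := by grind [alt]
  have Ok2 : O (k - 2) = .X := by grind [alt]
  have Ok1 : O (k - 1) = .Y := by grind
  have Ok : O k = .X := by grind
  have OI : ∀ i, k < i → O i = .I := by grind
  have := hc.eqn_one (by omega) OI (by rw [O0]; decide) (by rw [Ok]; decide)
  have e2 : (fun i => if i = 0 then O 2 * Term.XXZ.thd else O (i + 2)) = altYX k := by
    funext i
    simp only [altYX, hO, alt, Term.thd]
    grind [Pauli.mul_def, Pauli.mul]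
  have e3 : Term.XX.act (k - 1) O = altWord k := by
    funext i
    simp only [Term.act, altWord, hO, Term.fst, Term.snd, Term.thd]
    grind [Pauli.mul_def, Pauli.mul]
  simp only [sum_term, Term.fst, Term.last, Term.len, O0, O1, O2, Ok, reduceIte, reduceCtorEq,
    Nat.reduceEqDiff, Term.snd, Term.thd, show k + 3 - 2 = k + 1 by omega,
    OI (k + 1) (by omega), show k + 1 - 2 = k - 1 by omega, show k + 1 - 3 = k - 2 by omega, Ok2,
    show k + 2 - 3 = k - 1 by omega, Ok1, show k + 2 - 2 = k by omega,
    show k + 3 - 3 = k by omega, Term.sign, sign₃, Pauli.mul_def, Pauli.mul, Pauli.sign, e3,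
    hc.strip OI (by omega) (show O 1 = Term.XXZ.snd from O1)] at this e2
  rw [e2, hκ .XX rfl] at this
  norm_num at this
  linear_combination -this

/-- The alternating word with the letters `X`, `Y` at the sites `2 * p`, `2 * p + 1`. -/
def altKink (k p i : ℕ) : Pauli :=
  if i < k - 1 then (if i = 2 * p then .X else if i = 2 * p + 1 then .Y else alt i)
  else if i = k - 1 then .Z else .I

/-- The alternating word that starts with `YY`. -/
def altYY (k i : ℕ) : Pauli := if i ≤ 1 then .Y else altWord k i

theorem WindowCharge.altYY_eq (hc : WindowCharge k κ c) (hk : 5 ≤ k) (hodd : k % 2 = 1) :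
    κ .XXZ * c (altYY k) = κ .YYZ * c (altWord k) := by
  have w0 : altYY k 0 = .Y := rfl
  have w1 : altYY k 1 = .Y := rfl
  have w2 : altYY k 2 = .Y := by grind [alt, altWord, altYY]
  have wk : altYY k (k - 1) = .Z := by grind [alt, altWord, altYY]
  have := hc.eqn_slide (by omega) (w := altYY k) (h := .XXZ) (by grind [altWord, altYY])
    (by rw [w0]; decide) ⟨1, by omega, by omega, by rw [w1]; decide⟩ rfl (by rw [wk]; decide)
  have e : slide k (altYY k) .XXZ .YYZ = altWord k := by
    funext i
    simp only [slide, altYY, altWord, alt, Term.fst, Term.snd, Term.thd]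
    grind [Pauli.mul_def, Pauli.mul]
  simp only [sum_term, Term.fst, Term.len, w0, w1, w2, wk, e, reduceCtorEq,
    Nat.reduceEqDiff, Term.snd, Term.thd, Pauli.mul_def, Pauli.mul, Pauli.sign] at this
  norm_num at this
  linear_combination this

/-- Sliding with `XXZ` moves the kink two sites to the left without changing the coefficient. At the
left end it becomes the prefix `YY`, with a change of sign, and is then removed by `YYZ`; this
exchanges a factor `κ .XXZ` for `κ .YYZ`. -/
theorem WindowCharge.altKink_eq (hc : WindowCharge k κ c) (hk : 5 ≤ k) (hodd : k % 2 = 1)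
    (hκ : κ .XXZ ≠ 0) {p : ℕ} (hp : 1 ≤ p) (hpk : 2 * p + 3 ≤ k) :
    κ .XXZ * c (altKink k p) = -κ .YYZ * c (altWord k) := by
  have hκ' : (κ .XXZ : ℂ) ≠ 0 := Int.cast_ne_zero.2 hκ
  induction p, hp using Nat.le_induction with
  | base =>
    have w0 : altKink k 1 0 = .X := by grind [alt, altKink]
    have w1 : altKink k 1 1 = .X := by grind [alt, altKink]
    have w2 : altKink k 1 2 = .X := by grind [alt, altKink]
    have wk : altKink k 1 (k - 1) = .Z := by grind [alt, altKink]
    have := hc.eqn_slide (by omega) (w := altKink k 1) (h := .XXZ) (by grind [altKink])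
      (by rw [w0]; decide) ⟨1, by omega, by omega, by rw [w1]; decide⟩ rfl (by rw [wk]; decide)
    have e : slide k (altKink k 1) .XXZ .XXZ = altYY k := by
      funext i
      simp only [slide, altYY, altWord, altKink, alt, Term.fst, Term.snd, Term.thd]
      grind [Pauli.mul_def, Pauli.mul]
    simp only [sum_term, Term.fst, Term.len, w0, w1, w2, wk, e, reduceCtorEq,
      Nat.reduceEqDiff, Term.snd, Term.thd, Pauli.mul_def, Pauli.mul, Pauli.sign] at this
    norm_num at this
    linear_combination this - hc.altYY_eq hk hodd
  | succ p hp ih =>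
    have w0 : altKink k (p + 1) 0 = .X := by grind [alt, altKink]
    have w1 : altKink k (p + 1) 1 = .X := by grind [alt, altKink]
    have w2 : altKink k (p + 1) 2 = .Y := by grind [alt, altKink]
    have wk : altKink k (p + 1) (k - 1) = .Z := by grind [alt, altKink]
    have := hc.eqn_slide (by omega) (w := altKink k (p + 1)) (h := .XXZ) (by grind [altKink])
      (by rw [w0]; decide) ⟨1, by omega, by omega, by rw [w1]; decide⟩ rfl (by rw [wk]; decide)
    have e : slide k (altKink k (p + 1)) .XXZ .XXZ = altKink k p := by
      funext i
      simp only [slide, altKink, alt, Term.fst, Term.snd, Term.thd]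
      grind [Pauli.mul_def, Pauli.mul]
    simp only [sum_term, Term.fst, Term.len, w0, w1, w2, wk, e, reduceCtorEq,
      Nat.reduceEqDiff, Term.snd, Term.thd, Pauli.mul_def, Pauli.mul, Pauli.sign] at this
    norm_num at this
    linear_combination this + ih (by omega)

end

section

variable {k : ℕ} {κ : Term → ℤ} {c : (ℕ → Pauli) → ℂ}

/-! ### The alternating word has coefficient zero -/

/-- Words with a nonzero coefficient have letters `X` or `Y` at the odd sites, and do not have the
letter `I` in between. -/
def Shaped (k : ℕ) (c : (ℕ → Pauli) → ℂ) : Prop :=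
  ∀ w, IsWord k w → c w ≠ 0 → ∀ i, 1 ≤ i → i ≤ k - 2 →
    if i % 2 = 1 then w i = .X ∨ w i = .Y else w i ≠ .I

/-- The alternating letters with `I`, `Z` at the sites `2 * p`, `2 * p + 1`. -/
def hole (p i : ℕ) : Pauli := if i = 2 * p then .I else if i = 2 * p + 1 then .Z else alt i

/-- The word of length `k` with letters `hole p` that ends with `Z`. -/
def holeWord (k p i : ℕ) : Pauli := if i < k - 1 then hole p i else if i = k - 1 then .Z else .I

/-- The word of length `k - 1` with letters `hole p` that ends with `Y`. -/
def holeY (k p i : ℕ) : Pauli := if i < k - 2 then hole p i else if i = k - 2 then .Y else .I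

/-- The word of length `k - 1` with letters `hole p` that ends with `I`, `Z`. -/
def holeIZ (k p i : ℕ) : Pauli :=
  if i < k - 3 then hole p i else if i = k - 3 then .I else if i = k - 2 then .Z else .I

theorem Term.fst_eq_X {h : Term} (e : h.fst = .X) : h = .XX ∨ h = .XXZ := by revert h; decide

theorem Term.last_eq_Z {h : Term} (e : h.last = .Z) : h = .ZZ ∨ h = .XXZ ∨ h = .YYZ := by
  revert h; decide

theorem Term.eq_of_hole {h : Term} {o : Pauli} (ho : o = .Y ∨ o = .Z) (hs : h.sign .I .Z o ≠ 0)
    (h1 : .Z * h.snd = .X ∨ .Z * h.snd = .Y) (h2 : o * h.thd ≠ .I) : h = .XX ∨ h = .YY := by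
  revert h o; decide

theorem Term.sign_eq_zero_of_hole {h : Term} (h1 : .Z * h.thd = .X ∨ .Z * h.thd = .Y) :
    h.sign .X .I .Z = 0 := by
  revert h; decide

theorem Term.act_last (h : Term) {n : ℕ} (hn : h.len ≤ n) (O : ℕ → Pauli) :
    h.act (n - h.len) O (n - 1) = O (n - 1) * h.last := by
  unfold Term.last
  rcases h.len_cases with e | e
  · rw [e, if_pos rfl]
    have := h.act_snd (n - 2) O
    rwa [show n - 2 + 1 = n - 1 by omega] at this
  · rw [e, if_neg (by omega)]
    have := h.act_thd (n - 3) O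
    rwa [show n - 3 + 2 = n - 1 by omega] at this

/-- Both letters of the hole violate `Shaped`: `I` at an even site and `Z` at an odd one. A term
that keeps the length `k` must therefore repair both, and only `YY` and `XX` at the hole do so,
giving the alternating word and the kink. All other contributions shorten the word at one of its
ends. -/
theorem WindowCharge.hole_eqn (hc : WindowCharge k κ c) (hU : Shaped k c)
    (hκ : ∀ h : Term, h.len = 2 → κ h = -2) {p : ℕ} (hp : 1 ≤ p) (hpk : 2 * p + 3 ≤ k)
    (hodd : k % 2 = 1) :
    κ .XXZ * Term.XXZ.sign .X .X (holeWord k p 2) * c (Term.XXZ.act 0 (holeWord k p))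
      - 2 * c (altWord k) + 2 * c (altKink k p)
      - 2 * Term.ZZ.sign (holeWord k p (k - 2)) .Z .I * c (Term.ZZ.act (k - 2) (holeWord k p))
      + κ .XXZ * Term.XXZ.sign (holeWord k p (k - 3)) (holeWord k p (k - 2)) .Z *
        c (Term.XXZ.act (k - 3) (holeWord k p))
      + κ .YYZ * Term.YYZ.sign (holeWord k p (k - 3)) (holeWord k p (k - 2)) .Z *
        c (Term.YYZ.act (k - 3) (holeWord k p)) = 0 := by
  set O := holeWord k p with hO
  have O0 : O 0 = .X := by grind [holeWord, hole, alt]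
  have O1 : O 1 = .X := by grind [holeWord, hole, alt]
  have Op0 : O (2 * p - 1) = .X := by grind [holeWord, hole, alt]
  have Op1 : O (2 * p) = .I := by grind [holeWord, hole]
  have Op2 : O (2 * p + 1) = .Z := by grind [holeWord, hole]
  have Op3 : O (2 * p + 2) = .Y ∨ O (2 * p + 2) = .Z := by grind [holeWord, hole, alt]
  have Ok1 : O (k - 1) = .Z := by grind [holeWord]
  have OI : ∀ i, k ≤ i → O i = .I := by grind [holeWord]
  have := hc.eqn k O le_rfl (by omega) OI (by rw [O0]; decide) (by rw [Ok1]; decide)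
    (fun h => absurd h (by omega))
  rw [← Finset.sum_product'] at this
  set S : Finset (ℕ × Term) := {(0, .XXZ), (2 * p, .YY), (2 * p, .XX), (k - 2, .ZZ), (k - 3, .XXZ),
    (k - 3, .YYZ)} with hS
  rw [← Finset.sum_subset (s₁ := S)] at this
  · have eA : Term.YY.act (2 * p) O = altWord k := by
      funext i
      simp only [Term.act, altWord, hO, holeWord, hole, alt, Term.fst, Term.snd, Term.thd]
      grind [Pauli.mul_def, Pauli.mul]
    have eK : Term.XX.act (2 * p) O = altKink k p := by
      funext i
      simp only [Term.act, altKink, hO, holeWord, hole, alt, Term.fst, Term.snd, Term.thd]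
      grind [Pauli.mul_def, Pauli.mul]
    rw [hS, Finset.sum_insert (by simp; omega), Finset.sum_insert (by simp),
      Finset.sum_insert (by simp), Finset.sum_insert (by simp), Finset.sum_insert (by simp),
      Finset.sum_singleton] at this
    simp only at this
    rw [if_pos (by simp only [Term.len]; omega), if_pos (by simp only [Term.len]; omega),
      if_pos (by simp only [Term.len]; omega), if_pos (by simp only [Term.len]; omega),
      if_pos (by simp only [Term.len]; omega), if_pos (by simp only [Term.len]; omega), eA, eK, hκ .XX rfl, hκ .YY rfl, hκ .ZZ rfl, zero_add,
      zero_add, O0, O1, Op1, Op2, show k - 2 + 1 = k - 1 by omega, show k - 2 + 2 = k by omega,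
      show k - 3 + 1 = k - 2 by omega, show k - 3 + 2 = k - 1 by omega, Ok1, OI k le_rfl] at this
    have s1 : ∀ o, Term.YY.sign .I .Z o = 1 := by decide
    have s2 : ∀ o, Term.XX.sign .I .Z o = -1 := by decide
    rw [s1, s2] at this
    push_cast at this
    linear_combination this
  · intro x hx
    simp only [hS, Finset.mem_insert, Finset.mem_singleton] at hx
    simp only [Finset.mem_product, Finset.mem_range, Finset.mem_univ, and_true]
    rcases hx with rfl | rfl | rfl | rfl | rfl | rfl <;> simp only <;> omega
  · rintro ⟨j, h⟩ hj hjS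
    simp only [Finset.mem_product, Finset.mem_range, Finset.mem_univ, and_true] at hj
    simp only
    split_ifs with hl
    swap
    · rfl
    by_contra hne
    have hs : h.sign (O j) (O (j + 1)) (O (j + 2)) ≠ 0 := by
      intro hs
      rw [hs] at hne
      simp at hne
    have hcw := right_ne_zero_of_mul hne
    refine hjS ?_
    have hlen := h.len_cases
    by_cases a0 : h.act j O 0 = .I
    · obtain rfl : j = 0 := by
        by_contra hj0
        rw [h.act_of_lt _ (by omega), O0] at a0
        exact absurd a0 (by decide)
      rw [h.act_fst, Pauli.mul_eq_I, O0] at a0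
      rcases Term.fst_eq_X a0.symm with rfl | rfl
      · exact absurd (by rw [O0, zero_add, O1]; exact Term.sign_pair rfl _) hs
      · simp [hS]
    by_cases a1 : h.act j O (k - 1) = .I
    · have hjk : j = k - h.len := by
        by_contra hj0
        rw [h.act_of_ge _ (by omega), Ok1] at a1
        exact absurd a1 (by decide)
      rw [hjk, h.act_last (by omega), Pauli.mul_eq_I, Ok1] at a1
      rcases Term.last_eq_Z a1.symm with rfl | rfl | rfl <;> rw [hjk] <;> simp [hS, Term.len]
    have hword : IsWord k (h.act j O) :=
      ⟨a0, a1, fun i hi => by rw [h.act_of_ge _ (by omega), OI i hi]⟩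
    have u1 := hU _ hword hcw (2 * p) (by omega) (by omega)
    have u2 := hU _ hword hcw (2 * p + 1) (by omega) (by omega)
    have u3 := hU _ hword hcw (2 * p + 2) (by omega)
    rw [if_neg (by omega)] at u1
    rw [if_pos (by omega)] at u2
    have j1 : 2 * p + 1 < j + h.len := by
      by_contra h'
      rw [h.act_of_ge _ (by omega), Op2] at u2
      exact absurd u2 (by decide)
    have j2 : j ≤ 2 * p := by
      by_contra h'
      rw [h.act_of_lt _ (by omega), Op1] at u1
      exact u1 rfl
    -- Three-site terms that might repair the hole commute with the word, because they anticommute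
    -- with it at exactly two sites, or they erase its last letter, which `a1` excludes.
    rcases (by omega : j = 2 * p ∨ j = 2 * p - 1) with rfl | rfl
    · rw [h.act_snd, Op2] at u2
      rw [Op1, Op2] at hs
      have h3 : O (2 * p + 2) * h.thd ≠ .I := by
        rw [← h.act_thd]
        rcases (by omega : 2 * p + 2 ≤ k - 2 ∨ 2 * p + 2 = k - 1) with hh | hh
        · have := u3 hh
          rwa [if_neg (by omega)] at this
        · rwa [hh]
      rcases Term.eq_of_hole Op3 hs u2 h3 with rfl | rfl <;> simp [hS]
    · have := h.act_thd (2 * p - 1) O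
      rw [show 2 * p - 1 + 2 = 2 * p + 1 by omega, Op2] at this
      rw [this] at u2
      rw [show 2 * p - 1 + 1 = 2 * p by omega, show 2 * p - 1 + 2 = 2 * p + 1 by omega, Op0, Op1,
        Op2] at hs
      exact absurd (Term.sign_eq_zero_of_hole u2) hs

/-- The word of length `k - 2` with letters `hole p` that ends with `Z`. -/
def holeZ (k p i : ℕ) : Pauli := if i < k - 3 then hole p i else if i = k - 3 then .Z else .I

/-- The equation of length `k + 1` links the hole `p`, by `XXZ` on the left, with the hole `p + 1`,
by `ZYY` on the right. When the hole reaches the right end, the last three letters are `ZYY` itself,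
which commutes with the word; hence the induction on the distance `n` to that end. -/
theorem WindowCharge.holeY_eq (hc : WindowCharge k κ c) (hk : 5 ≤ k) (hodd : k % 2 = 1)
    (hκ : κ .XXZ ≠ 0) {p : ℕ} (hp : 1 ≤ p) (hpk : 2 * p + 5 ≤ k) : c (holeY k p) = 0 := by
  have hκ' : (κ .XXZ : ℂ) ≠ 0 := Int.cast_ne_zero.2 hκ
  obtain ⟨n, hn⟩ : ∃ n, 2 * p + 5 + 2 * n = k := ⟨(k - (2 * p + 5)) / 2, by omega⟩
  induction n generalizing p with
  | zero =>
    set O : ℕ → Pauli := fun i => if i < k then hole (p + 1) i else if i = k then .Y else .I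
      with hO
    have O0 : O 0 = .X := by grind [hole, alt]
    have O1 : O 1 = .X := by grind [hole, alt]
    have O2 : O 2 = .Y := by grind [hole, alt]
    have Ok2 : O (k - 2) = .Z := by grind [hole, alt]
    have Ok1 : O (k - 1) = .Y := by grind [hole, alt]
    have Ok : O k = .Y := by grind [hole, alt]
    have OI : ∀ i, k < i → O i = .I := by grind [hole, alt]
    have := hc.eqn_one (by omega) OI (by rw [O0]; decide) (by rw [Ok]; decide)
    have e2 : (fun i => if i = 0 then O 2 * Term.XXZ.thd else O (i + 2)) = holeY k p := by
      funext i
      simp only [holeY, hole, hO, alt, Term.thd]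
      grind [Pauli.mul_def, Pauli.mul]
    simp only [sum_term, Term.fst, Term.last, Term.len, O0, O1, O2, Ok, reduceIte, reduceCtorEq,
      Nat.reduceEqDiff, Term.snd, Term.thd, show k + 3 - 2 = k + 1 by omega,
      OI (k + 1) (by omega), show k + 1 - 2 = k - 1 by omega, show k + 1 - 3 = k - 2 by omega, Ok2,
      show k + 2 - 3 = k - 1 by omega, Ok1, show k + 2 - 2 = k by omega,
      show k + 3 - 3 = k by omega, Term.sign, sign₃, Pauli.mul_def, Pauli.mul, Pauli.sign,
      hc.strip OI (by omega) (show O 1 = Term.XXZ.snd from O1)] at this e2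
    rw [e2] at this
    norm_num at this
    exact this.resolve_left hκ
  | succ n ih =>
    set O : ℕ → Pauli := fun i => if i < k then hole (p + 1) i else if i = k then .Y else .I
      with hO
    have O0 : O 0 = .X := by grind [hole, alt]
    have O1 : O 1 = .X := by grind [hole, alt]
    have O2 : O 2 = .Y := by grind [hole, alt]
    have Ok2 : O (k - 2) = .X := by grind [hole, alt]
    have Ok1 : O (k - 1) = .Y := by grind [hole, alt]
    have Ok : O k = .Y := by grind [hole, alt]
    have OI : ∀ i, k < i → O i = .I := by grind [hole, alt]
    have := hc.eqn_one (by omega) OI (by rw [O0]; decide) (by rw [Ok]; decide)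
    have e2 : (fun i => if i = 0 then O 2 * Term.XXZ.thd else O (i + 2)) = holeY k p := by
      funext i
      simp only [holeY, hole, hO, alt, Term.thd]
      grind [Pauli.mul_def, Pauli.mul]
    have e3 : Term.ZYY.act (k - 2) O = holeY k (p + 1) := by
      funext i
      simp only [holeY, hole, hO, alt, Term.fst, Term.snd, Term.thd, Term.act]
      grind [Pauli.mul_def, Pauli.mul]
    simp only [sum_term, Term.fst, Term.last, Term.len, O0, O1, O2, Ok, reduceIte, reduceCtorEq,
      Nat.reduceEqDiff, Term.snd, Term.thd, show k + 3 - 2 = k + 1 by omega,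
      OI (k + 1) (by omega), show k + 1 - 2 = k - 1 by omega, show k + 1 - 3 = k - 2 by omega, Ok2,
      show k + 2 - 3 = k - 1 by omega, Ok1, show k + 2 - 2 = k by omega,
      show k + 3 - 3 = k by omega, Term.sign, sign₃, Pauli.mul_def, Pauli.mul, Pauli.sign, e3,
      hc.strip OI (by omega) (show O 1 = Term.XXZ.snd from O1)] at this e2
    rw [e2, ih (p := p + 1) (by omega) (by omega) (by omega)] at this
    norm_num at this
    exact this.resolve_left hκ

/-- In the equation of length `k + 1` the terms on the right leave the hole untouched, so by
`Shaped` the resulting words of length `k` have coefficient zero. `ZZ` meets the letters `I`, `Z`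
and commutes. -/
theorem WindowCharge.holeIZ_eq (hc : WindowCharge k κ c) (hU : Shaped k c) (hk : 5 ≤ k)
    (hodd : k % 2 = 1) (hκ : κ .XXZ ≠ 0) {p : ℕ} (hp : 1 ≤ p) (hpk : 2 * p + 5 ≤ k) :
    c (holeIZ k p) = 0 := by
  have hκ' : (κ .XXZ : ℂ) ≠ 0 := Int.cast_ne_zero.2 hκ
  set O : ℕ → Pauli := fun i => if i < k - 1 then hole (p + 1) i else if i = k then .Z else .I
      with hO
  have O0 : O 0 = .X := by grind [hole, alt]
  have O1 : O 1 = .X := by grind [hole, alt]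
  have O2 : O 2 = .Y := by grind [hole, alt]
  have Ok2 : O (k - 2) ≠ .Y := by grind [hole, alt]
  have Ok2' : O (k - 2) ≠ .I := by grind [hole, alt]
  have Ok1 : O (k - 1) = .I := by grind [hole, alt]
  have Ok : O k = .Z := by grind [hole, alt]
  have Oh : O (2 * p + 2) = .I := by grind [hole, alt]
  have OI : ∀ i, k < i → O i = .I := by grind [hole, alt]
  have := hc.eqn_one (by omega) OI (by rw [O0]; decide) (by rw [Ok]; decide)
  have e2 : (fun i => if i = 0 then O 2 * Term.XXZ.thd else O (i + 2)) = holeIZ k p := by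
    funext i
    simp only [holeIZ, hole, hO, alt, Term.thd]
    grind [Pauli.mul_def, Pauli.mul]
  have e3 : ∀ h : Term, h.len = 3 → h.last = .Z → c (h.act (k - 2) O) = 0 := by
    intro h h3 hl
    by_contra hcw
    have hword : IsWord k (h.act (k - 2) O) := by
      refine ⟨by rw [h.act_of_lt _ (by omega), O0]; decide, ?_, ?_⟩
      · have := h.act_snd (k - 2) O
        rw [show k - 2 + 1 = k - 1 by omega, Ok1] at this
        rw [this, Pauli.I_mul]
        exact h.snd_ne
      · intro i hi
        rcases (by omega : i = k ∨ k < i) with rfl | hi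
        · have := h.act_thd (i - 2) O
          rw [show i - 2 + 2 = i by omega, Ok, Pauli.mul_def] at this
          rw [this, ← Pauli.mul_def, Pauli.mul_eq_I, ← hl, Term.last, if_neg (by omega)]
        · rw [h.act_of_ge _ (by omega), OI i hi]
    have := hU _ hword hcw (2 * p + 2) (by omega) (by omega)
    rw [if_neg (by omega), h.act_of_lt _ (by omega)] at this
    exact this Oh
  simp only [sum_term, Term.fst, Term.last, Term.len, O0, O1, O2, Ok, reduceIte, reduceCtorEq,
    Nat.reduceEqDiff, Term.snd, Term.thd, show k + 3 - 2 = k + 1 by omega,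
    OI (k + 1) (by omega), show k + 1 - 2 = k - 1 by omega, show k + 1 - 3 = k - 2 by omega,
    show k + 2 - 3 = k - 1 by omega, Ok1, show k + 2 - 2 = k by omega,
    show k + 3 - 3 = k by omega, Term.sign, sign₃, Pauli.mul_def, Pauli.mul, Pauli.sign,
    e3 .XXZ rfl rfl, e3 .YYZ rfl rfl,
    hc.strip OI (by omega) (show O 1 = Term.XXZ.snd from O1)] at this e2
  rw [e2] at this
  norm_num at this
  exact this.resolve_left hκ

end

/-! ### Solving the recursion in the position of the hole -/

section

variable {k : ℕ} {κ : Term → ℤ} {c : (ℕ → Pauli) → ℂ}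

theorem WindowCharge.holeWord_left (hc : WindowCharge k κ c) (hk : 5 ≤ k) (hodd : k % 2 = 1)
    {p : ℕ} (hp : 1 ≤ p) :
    Term.XXZ.sign .X .X (holeWord k (p + 1) 2) * c (Term.XXZ.act 0 (holeWord k (p + 1)))
      = -c (holeZ k p) := by
  set O := holeWord k (p + 1) with hO
  have O0 : O 0 = .X := by grind [holeWord, hole, alt]
  have O1 : O 1 = .X := by grind [holeWord, hole, alt]
  have O2 : O 2 = .Y := by grind [holeWord, hole, alt]
  have OI : ∀ i, k ≤ i → O i = .I := by grind [holeWord]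
  have e : (fun i => if i = 0 then O 2 * Term.XXZ.thd else O (i + 2)) = holeZ k p := by
    funext i
    simp only [holeZ, hole, hO, holeWord, alt, Term.thd]
    grind [Pauli.mul_def, Pauli.mul]
  rw [hc.shift, hc.strip (fun i hi => OI i (by omega)) (by omega) (by rw [O1]; rfl), e, O2,
    show Term.XXZ.sign .X .X .Y = -1 by decide]
  · push_cast; ring
  · intro i hi
    rw [Term.act_of_ge _ _ (by simp only [Term.len]; omega), OI i (by omega)]
  · rw [Term.act_fst, O0]; rfl

/-- Away from the right end the three shortened words are `holeY`, `holeZ` and `holeIZ`; the first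
and the last have coefficient zero. -/
theorem WindowCharge.holeWord_right (hc : WindowCharge k κ c) (hU : Shaped k c) (hk : 5 ≤ k)
    (hodd : k % 2 = 1) (hκ : κ .XXZ ≠ 0) {p : ℕ} (hp : 1 ≤ p) (hpk : 2 * p + 5 ≤ k) :
    - 2 * Term.ZZ.sign (holeWord k p (k - 2)) .Z .I * c (Term.ZZ.act (k - 2) (holeWord k p))
      + κ .XXZ * Term.XXZ.sign (holeWord k p (k - 3)) (holeWord k p (k - 2)) .Z *
        c (Term.XXZ.act (k - 3) (holeWord k p))
      + κ .YYZ * Term.YYZ.sign (holeWord k p (k - 3)) (holeWord k p (k - 2)) .Z *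
        c (Term.YYZ.act (k - 3) (holeWord k p)) = κ .XXZ * c (holeZ k p) := by
  set O := holeWord k p with hO
  have O0 : O (k - 3) = .Y := by grind [holeWord, hole, alt]
  have O1 : O (k - 2) = .X := by grind [holeWord, hole, alt]
  have e1 : Term.ZZ.act (k - 2) O = holeY k p := by
    funext i
    simp only [Term.act, hO, holeY, holeWord, hole, alt, Term.fst, Term.snd, Term.thd]
    grind [Pauli.mul_def, Pauli.mul]
  have e2 : Term.XXZ.act (k - 3) O = holeZ k p := by
    funext i
    simp only [Term.act, hO, holeZ, holeWord, hole, alt, Term.fst, Term.snd, Term.thd]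
    grind [Pauli.mul_def, Pauli.mul]
  have e3 : Term.YYZ.act (k - 3) O = holeIZ k p := by
    funext i
    simp only [Term.act, hO, holeIZ, holeWord, hole, alt, Term.fst, Term.snd, Term.thd]
    grind [Pauli.mul_def, Pauli.mul]
  rw [e1, e2, e3, hc.holeY_eq hk hodd hκ hp hpk, hc.holeIZ_eq hU hk hodd hκ hp hpk, O0, O1,
    show Term.XXZ.sign .Y .X .Z = 1 by decide]
  push_cast; ring

/-- For the last hole the three-site terms act on the hole itself and give the words of `altXY_eq`
and `altYX_eq`, which closes the recursion. -/
theorem WindowCharge.holeWord_end (hc : WindowCharge k κ c) (hk : 5 ≤ k)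
    (hodd : k % 2 = 1) (hκ : ∀ h : Term, h.len = 2 → κ h = -2) {p : ℕ}
    (hpk : 2 * p + 3 = k) :
    κ .XXZ * (- 2 * Term.ZZ.sign (holeWord k p (k - 2)) .Z .I *
        c (Term.ZZ.act (k - 2) (holeWord k p))
      + κ .XXZ * Term.XXZ.sign (holeWord k p (k - 3)) (holeWord k p (k - 2)) .Z *
        c (Term.XXZ.act (k - 3) (holeWord k p))
      + κ .YYZ * Term.YYZ.sign (holeWord k p (k - 3)) (holeWord k p (k - 2)) .Z *
        c (Term.YYZ.act (k - 3) (holeWord k p))) = -2 * (κ .XXZ + κ .YYZ) * c (altWord k) := by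
  set O := holeWord k p with hO
  have O0 : O (k - 3) = .I := by grind [holeWord, hole, alt]
  have O1 : O (k - 2) = .Z := by grind [holeWord, hole, alt]
  have e2 : Term.XXZ.act (k - 3) O = altXY k := by
    funext i
    simp only [Term.act, hO, altXY, holeWord, hole, alt, Term.fst, Term.snd, Term.thd]
    grind [Pauli.mul_def, Pauli.mul]
  have e3 : Term.YYZ.act (k - 3) O = altYX k := by
    funext i
    simp only [Term.act, hO, altYX, holeWord, hole, alt, Term.fst, Term.snd, Term.thd]
    grind [Pauli.mul_def, Pauli.mul]
  rw [e2, e3, O0, O1, show Term.XXZ.sign .I .Z .Z = -1 by decide,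
    show Term.YYZ.sign .I .Z .Z = 1 by decide, show Term.ZZ.sign .Z .Z .I = 0 by decide]
  push_cast
  linear_combination -κ .XXZ * hc.altXY_eq hk hodd hκ + κ .YYZ * hc.altYX_eq hk hodd hκ

/-- With `a = κ .XXZ` and `b = κ .YYZ`, the equation of the hole `p` says that `a ^ 2 * c (holeZ k
p)` exceeds its predecessor by `2 * (a + b) * c (altWord k)`. The predecessor is absent for `p = 1`,
where `XXZ` commutes with the prefix `XXI`. -/
theorem WindowCharge.holeZ_eq (hc : WindowCharge k κ c) (hU : Shaped k c) (hk : 5 ≤ k)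
    (hodd : k % 2 = 1) (hκ : ∀ h : Term, h.len = 2 → κ h = -2) (hκa : κ .XXZ ≠ 0) {p : ℕ}
    (hp : 1 ≤ p) (hpk : 2 * p + 5 ≤ k) :
    (κ .XXZ) ^ 2 * c (holeZ k p) = 2 * p * (κ .XXZ + κ .YYZ) * c (altWord k) := by
  induction p, hp using Nat.le_induction with
  | base =>
    have e1 := hc.hole_eqn hU hκ le_rfl (by omega) hodd
    have e2 := hc.holeWord_right hU hk hodd hκa le_rfl hpk
    have e3 := hc.altKink_eq hk hodd hκa le_rfl (by omega)
    have O2 : holeWord k 1 2 = .I := by grind [holeWord, hole]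
    rw [O2, show Term.XXZ.sign .X .X .I = 0 by decide] at e1
    push_cast at e1 ⊢
    linear_combination κ .XXZ * e1 - κ .XXZ * e2 - 2 * e3
  | succ p hp ih =>
    have e1 := hc.hole_eqn hU hκ (p := p + 1) (by omega) (by omega) hodd
    have e2 := hc.holeWord_right hU hk hodd hκa (p := p + 1) (by omega) hpk
    have e3 := hc.altKink_eq hk hodd hκa (p := p + 1) (by omega) (by omega)
    have e4 := hc.holeWord_left hk hodd hp
    have e5 := ih (by omega)
    push_cast at e1 ⊢
    linear_combination κ .XXZ * e1 - κ .XXZ * e2 - 2 * e3 - (κ .XXZ) ^ 2 * e4 + e5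

/-- The coefficient of the alternating word is zero. -/
theorem WindowCharge.altWord_eq_zero (hc : WindowCharge k κ c) (hU : Shaped k c) (hk : 5 ≤ k)
    (hodd : k % 2 = 1) (hκ : ∀ h : Term, h.len = 2 → κ h = -2) (hκa : κ .XXZ ≠ 0)
    (hκab : κ .XXZ + κ .YYZ ≠ 0) : c (altWord k) = 0 := by
  obtain ⟨p, hpk⟩ : ∃ p, k = 2 * p + 5 := ⟨(k - 5) / 2, by omega⟩
  have e1 := hc.hole_eqn hU hκ (p := p + 1) (by omega) (by omega) hodd
  have e2 := hc.holeWord_end hk hodd hκ (p := p + 1) (by omega)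
  have e3 := hc.altKink_eq hk hodd hκa (p := p + 1) (by omega) (by omega)
  -- The holes `1, …, p + 1` contribute `2 * (p + 1)`, and the right end of the last one contributes
  -- `2` more.
  have key : (2 * (p + 2) * (κ .XXZ + κ .YYZ) : ℂ) * c (altWord k) = 0 := by
    rcases Nat.eq_zero_or_pos p with rfl | hp
    · have O2 : holeWord k (0 + 1) 2 = .I := by grind [holeWord, hole]
      rw [O2, show Term.XXZ.sign .X .X .I = 0 by decide, Int.cast_zero] at e1
      rw [Nat.cast_zero]
      linear_combination -κ .XXZ * e1 + e2 + 2 * e3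
    · have e4 := hc.holeWord_left hk hodd hp
      have e5 := hc.holeZ_eq hU hk hodd hκ hκa hp (by omega)
      linear_combination -κ .XXZ * e1 + e2 + 2 * e3 + (κ .XXZ) ^ 2 * e4 - e5
  refine (mul_eq_zero.1 key).resolve_left ?_
  have h1 : (p + 2 : ℂ) ≠ 0 := by exact_mod_cast (show p + 2 ≠ 0 by omega)
  have h2 : (κ .XXZ + κ .YYZ : ℂ) ≠ 0 := by exact_mod_cast hκab
  simp [h1, h2]

end

section

variable {k : ℕ} {κ : Term → ℤ} {c : (ℕ → Pauli) → ℂ}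

/-! ### Repeating the same term -/

/-- The word of length `k` that starts with `D`, ends with `e` and has the letters `y` and `z` at
the odd and even sites in between. -/
def pat (k : ℕ) (D y z e : Pauli) (i : ℕ) : Pauli :=
  if i = 0 then D else if i < k - 1 then (if i % 2 = 1 then y else z) else if i = k - 1 then e
  else .I

theorem altWord_eq_pat (hk : 4 ≤ k) : altWord k = pat k .X .X .Y .Z := by
  funext i
  simp only [altWord, alt, pat]
  grind

theorem stream_end (hk : 1 ≤ k) {w : ℕ → Pauli} {H : ℕ → Term} (t : ℕ) {i : ℕ} (hi : i + 1 = k + (2 * t + 1)) :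
    stream k w H i = (H t).snd := by
  unfold stream
  rw [if_neg (by omega), if_neg (by omega), if_pos (by omega),
    show (i - (k - 1)) / 2 = t by omega]

theorem stream_end' (hk : 1 ≤ k) {w : ℕ → Pauli} {H : ℕ → Term} (t : ℕ) {i : ℕ}
    (hi : i = k + (2 * t + 1)) : stream k w H i = (H t).thd * (H (t + 1)).fst := by
  unfold stream
  rw [if_neg (by omega), if_neg (by omega), if_neg (by omega),
    show (i - (k - 1)) / 2 = t + 1 by omega]
  rfl

/-- What remains after replacing the whole word by copies of the term `h`. -/
theorem WindowCharge.exists_pat (hc : WindowCharge k κ c) (hκ : Admissible κ) (hk : 4 ≤ k)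
    {w : ℕ → Pauli} (hw : IsWord k w) {h₀ h : Term} (hh₀ : Kept κ h₀) (hh : Kept κ h)
    (he : w (k - 1) ≠ h₀.fst) (he' : h₀.thd ≠ h.fst) (hcw : c w ≠ 0) (y z : Pauli)
    (hy : y = if k % 2 = 1 then h.snd else h.thd * h.fst)
    (hz : z = if k % 2 = 1 then h.thd * h.fst else h.snd) :
    ∃ h', Kept κ h' ∧ h'.snd = y ∧ z ≠ h'.thd ∧ c (pat k (z * h'.thd) y z h.thd) ≠ 0 := by
  -- The last letter of `w` may equal the first letter of `h`, so one different term `h₀` is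
  -- appended first. Its influence on the stream ends at position `k + 1`.
  set H : ℕ → Term := fun n => if n = 0 then h₀ else h with hH
  have Hpos : ∀ n, 0 < n → H n = h := fun n hn => if_neg (by omega)
  have hst : ∀ i, k + 2 ≤ i → stream k w H i = if i % 2 = 1 then y else z := by
    intro i hi
    obtain ⟨t, ht | ht⟩ := Nat.even_or_odd' (i - k - 2)
    · rw [stream_end (by omega) (t + 1) (by omega), Hpos _ (by omega)]
      split_ifs at hy hz ⊢ <;> first | omega | simp_all
    · rw [stream_end' (by omega) (t + 1) (by omega), Hpos _ (by omega), Hpos _ (by omega)]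
      split_ifs at hy hz ⊢ <;> first | omega | simp_all
  obtain ⟨D, -, hD, -, hcD⟩ := hc.exists_run hκ hk hw (H := H)
    (fun n => by simp only [hH]; split_ifs <;> assumption) he
    (fun n => by
      rw [Hpos (n + 1) (by omega)]
      simp only [hH]
      split_ifs
      · exact he'
      · exact Term.thd_ne_fst hh.1) hcw (k + 2)
  obtain ⟨h', h1, -, h3, h4, h5, h6⟩ := hD (k + 1) (by omega)
  rw [hst _ (by omega), if_pos (by omega)] at h3
  rw [hst _ (by omega), if_neg (by omega)] at h5 h6
  refine ⟨h', h1, h3, h5, ?_⟩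
  rw [← h6]
  convert hcD using 2
  funext i
  unfold pat streamWord
  rw [if_neg (show k + 2 ≠ 0 by omega), Hpos _ (by omega)]
  split_ifs with i0 i1 i2 i3
  · rfl
  · rw [hst _ (by omega), if_pos (by omega)]
  · rw [hst _ (by omega), if_neg (by omega)]
  all_goals rfl

theorem WindowCharge.shaped (hc : WindowCharge k κ c) (hκ : Admissible κ) (hk : 4 ≤ k)
    (hfull : ∀ p : Pauli, ∃ h, Kept κ h ∧ p ≠ h.fst) : Shaped k c := by
  intro w hw hcw i hi hik
  obtain ⟨h, hh, he⟩ := hfull (w (k - 1))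
  exact hc.shape hκ hk hw hh he hcw i hi hik

/-! ### Both terms `XXZ` and `YYZ` are present -/

/-- The next letter `Z * X = Y` rules out `ZYY`, whose third letter would cancel it, so the state is
known whatever it was before. -/
theorem Step.eq_X_of_YY {D D' : Pauli} (h : Step κ D .Y (.Z * .X) D') : D' = .X := by
  obtain ⟨h, ⟨h1, -⟩, -, h3, -, h5, rfl⟩ := h
  revert h; decide

theorem Step.eq_Y_of_XX {D D' : Pauli} (h : Step κ D .X (.Z * .Y) D') : D' = .Y := by
  obtain ⟨h, ⟨h1, -⟩, -, h3, -, h5, rfl⟩ := h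
  revert h; decide

theorem Step.eq_X {p D' : Pauli} (hp : p ≠ .Z) (h : Step κ p p (.Z * .X) D') : D' = .X := by
  obtain ⟨h, ⟨h1, -⟩, h2, h3, -, -, rfl⟩ := h
  revert p h; decide

theorem Step.eq_Y_or_ZYY {D D' : Pauli} (h : Step κ D .Y .X D') :
    D' = .Y ∨ (D' = .Z ∧ κ .ZYY ≠ 0) := by
  obtain ⟨h, ⟨h1, h0⟩, -, h3, -, -, rfl⟩ := h
  cases h <;> first | exact absurd h1 (by decide) | exact absurd h3 (by decide) |
    exact Or.inl rfl | exact Or.inr ⟨rfl, h0⟩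

theorem Step.ZXX {D D' : Pauli} (h : Step κ D .X .Y D') : D ≠ .Y ∧ (D = .Z → κ .ZXX ≠ 0) := by
  obtain ⟨h, ⟨h1, h0⟩, h2, h3, -⟩ := h
  cases h <;> first | exact absurd h1 (by decide) | exact absurd h3 (by decide) |
    (rw [← h2]; first | exact ⟨by decide, fun _ => h0⟩ | exact ⟨by decide, fun h => absurd h (by decide)⟩)

/-- With both terms available, switching between them along the run produces letters that force the
state of the automaton. The parity of `k` decides whether second letters or overlap letters of the
appended terms are read at odd positions. -/
theorem WindowCharge.eq_zero_of_XXZ_YYZ (hc : WindowCharge k κ c) (hk : 4 ≤ k)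
    (h2 : ∀ h : Term, h.len = 2 → κ h = -2) (ha : κ .XXZ ≠ 0) (hb : κ .YYZ ≠ 0)
    (hab : κ .XXZ + κ .YYZ ≠ 0) (hcd : κ .ZXX = 0 ∨ κ .ZYY = 0) {w : ℕ → Pauli}
    (hw : IsWord k w) : c w = 0 := by
  have hfull : ∀ p : Pauli, ∃ h, Kept κ h ∧ p ≠ h.fst := by
    intro p
    by_cases hp : p = .X
    · exact ⟨.YYZ, ⟨rfl, hb⟩, by rw [hp]; decide⟩
    · exact ⟨.XXZ, ⟨rfl, ha⟩, hp⟩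
  have hκ : Admissible κ := ⟨h2, Or.inr hfull⟩
  by_contra hcw
  obtain ⟨h₀, hh₀, he, hh₀'⟩ : ∃ h₀, Kept κ h₀ ∧ w (k - 1) ≠ h₀.fst ∧ (h₀ = .XXZ ∨ h₀ = .YYZ) := by
    by_cases hp : w (k - 1) = .X
    · exact ⟨.YYZ, ⟨rfl, hb⟩, by rw [hp]; decide, Or.inr rfl⟩
    · exact ⟨.XXZ, ⟨rfl, ha⟩, hp, Or.inl rfl⟩
  rcases Nat.even_or_odd' k with ⟨m, hm | hm⟩
  -- For even `k` the letters read are `Y`, `X` and then `X`, `Y`. The first step leaves the state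
  -- `Y`, or `Z` if `ZYY` is present; the second cannot start from `Y`, and needs `ZXX` to start
  -- from `Z`.
  · set H : ℕ → Term := fun n => if n = 0 then h₀ else if n = 2 then .YYZ else .XXZ with hH
    have H0 : (H 0).thd = .Z := by rcases hh₀' with h | h <;> simp [hH, h, Term.thd]
    obtain ⟨D, -, hD, -⟩ := hc.exists_run hκ hk hw (H := H)
      (fun n => by simp only [hH]; split_ifs <;> first | assumption | exact ⟨rfl, by assumption⟩) he
      (fun n => by
        simp only [hH]
        rcases hh₀' with h | h <;> rw [h] <;> split_ifs <;> first | omega | decide) hcw (m + 2)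
    have s1 := hD m (by omega)
    have s2 := hD (m + 1) (by omega)
    rw [stream_end' (by omega) 0 (by omega), stream_end (by omega) 1 (by omega), H0] at s1
    rw [stream_end' (by omega) 1 (by omega), stream_end (by omega) 2 (by omega)] at s2
    rcases s1.eq_Y_or_ZYY with h | ⟨h, hd⟩
    · exact s2.ZXX.1 h
    · exact hcd.elim (s2.ZXX.2 h) hd
  -- For odd `k` the change from `h₀` to the other term fixes the state, and copies of `XXZ` then
  -- lead to the state `X` and keep it there. After `k` further slides only the alternating word is
  -- left.
  · set h₁ : Term := if h₀ = .XXZ then .YYZ else .XXZ with hh₁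
    set H : ℕ → Term := fun n => if n = 0 then h₀ else if n = 1 then h₁ else .XXZ with hH
    have key : ∀ n, H n = .XXZ ∨ H n = .YYZ := by
      intro n
      simp only [hH, hh₁]
      split_ifs <;> simp [hh₀']
    obtain ⟨D, -, hD, -, hcD⟩ := hc.exists_run hκ hk hw (H := H)
      (fun n => by
        rcases key n with h | h <;> rw [h]
        exacts [⟨rfl, ha⟩, ⟨rfl, hb⟩]) he
      (fun n => by
        rcases key n with h | h <;> rcases key (n + 1) with h' | h' <;> rw [h, h'] <;> decide)
      hcw (m + 2 + k)
    have D2 : D (m + 2) = .X := by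
      have s1 := hD m (by omega)
      have s2 := hD (m + 1) (by omega)
      rw [stream_end (by omega) 0 (by omega), stream_end' (by omega) 0 (by omega)] at s1
      rw [stream_end (by omega) 1 (by omega), stream_end' (by omega) 1 (by omega)] at s2
      rcases hh₀' with rfl | rfl
      · rw [s1.eq_Y_of_XX] at s2
        exact s2.eq_X (by decide)
      · rw [s1.eq_X_of_YY] at s2
        exact s2.eq_X (by decide)
    have Dn : ∀ n, n ≤ k → D (m + 2 + n) = .X := by
      intro n
      induction n with
      | zero => exact fun _ => D2
      | succ n ih =>
        intro hn
        have s := hD (m + 2 + n) (by omega)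
        rw [stream_end (by omega) (n + 2) (by omega), stream_end' (by omega) (n + 2) (by omega),
          ih (by omega)] at s
        exact s.eq_X (by decide)
    refine hcD ?_
    rw [Dn k le_rfl, ← hc.altWord_eq_zero (hc.shaped hκ hk hfull) (by omega) (by omega) h2 ha hab]
    congr 1
    funext i
    unfold streamWord
    simp only [altWord, alt]
    by_cases i0 : i = 0
    · rw [if_pos i0, if_pos i0, if_pos (by omega)]
    rw [if_neg i0, if_neg i0]
    by_cases i1 : i < k - 1
    · rw [if_pos i1, if_pos i1]
      split_ifs with i2
      · rw [stream_end (by omega) ((2 * (m + 2 + k) + i - k) / 2) (by omega)]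
        simp only [hH]
        rw [if_neg (by omega), if_neg (by omega)]; rfl
      · rw [stream_end' (by omega) ((2 * (m + 2 + k) + i - k - 1) / 2) (by omega)]
        simp only [hH]
        rw [if_neg (by omega), if_neg (by omega), if_neg (by omega), if_neg (by omega)]; rfl
    · rw [if_neg i1, if_neg i1, if_neg (show m + 2 + k ≠ 0 by omega)]
      split_ifs with i2
      · simp only [hH]
        rw [if_neg (by omega), if_neg (by omega)]; rfl
      · rfl

/-! ### Only the terms `XXZ` and `ZYY` are present -/

/-- Appending copies of `XXZ` leads to the alternating word for odd `k`. For even `k` it leads to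
`ZYXYX⋯XZ`, where `XXZ` is appended and `ZYY` removed. -/
theorem WindowCharge.eq_zero_of_XXZ_ZYY (hc : WindowCharge k κ c) (hk : 4 ≤ k)
    (h2 : ∀ h : Term, h.len = 2 → κ h = -2) (ha : κ .XXZ ≠ 0) (hb : κ .YYZ = 0)
    (hzxx : κ .ZXX = 0) (hd : κ .ZYY ≠ 0) (had : κ .XXZ ≠ κ .ZYY) {w : ℕ → Pauli}
    (hw : IsWord k w) : c w = 0 := by
  have hfull : ∀ p : Pauli, ∃ h, Kept κ h ∧ p ≠ h.fst := by
    intro p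
    by_cases hp : p = .X
    · exact ⟨.ZYY, ⟨rfl, hd⟩, by rw [hp]; decide⟩
    · exact ⟨.XXZ, ⟨rfl, ha⟩, hp⟩
  have hκ : Admissible κ := ⟨h2, Or.inr hfull⟩
  by_contra hcw
  obtain ⟨h₀, hh₀, he, he'⟩ : ∃ h₀, Kept κ h₀ ∧ w (k - 1) ≠ h₀.fst ∧ h₀.thd ≠ Term.XXZ.fst := by
    by_cases hp : w (k - 1) = .X
    · exact ⟨.ZYY, ⟨rfl, hd⟩, by rw [hp]; decide, by decide⟩
    · exact ⟨.XXZ, ⟨rfl, ha⟩, hp, by decide⟩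
  obtain ⟨h', ⟨k1, k2⟩, h3, h4, h5⟩ := hc.exists_pat hκ hk hw hh₀ ⟨rfl, ha⟩ he he' hcw _ _ rfl rfl
  by_cases hpar : k % 2 = 1
  · rw [if_pos hpar] at h3
    rw [if_pos hpar, if_pos hpar] at h5
    have : h' = .XXZ := by
      cases h' <;> first | rfl | exact absurd k1 (by decide) | exact absurd h3 (by decide) |
        exact absurd hzxx k2
    rw [this] at h5
    refine h5 ?_
    rw [← hc.altWord_eq_zero (hc.shaped hκ hk hfull) (by omega) hpar h2 ha (by rwa [hb, add_zero]),
      altWord_eq_pat hk]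
    rfl
  · rw [if_neg hpar] at h3
    rw [if_neg hpar, if_neg hpar] at h5
    have : h' = .ZYY := by
      cases h' <;> first | rfl | exact absurd k1 (by decide) | exact absurd h3 (by decide) |
        exact absurd hb k2
    rw [this] at h5
    change c (pat k .Z .Y .X .Z) ≠ 0 at h5
    have w0 : pat k .Z .Y .X .Z 0 = .Z := rfl
    have w1 : pat k .Z .Y .X .Z 1 = .Y := by grind [pat]
    have w2 : pat k .Z .Y .X .Z 2 = .X := by grind [pat]
    have wk : pat k .Z .Y .X .Z (k - 1) = .Z := by grind [pat]
    have := hc.eqn_slide hk (w := pat k .Z .Y .X .Z) (h := .XXZ) (by grind [pat])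
      (by rw [w0]; decide) ⟨1, by omega, by omega, by rw [w1]; decide⟩ rfl (by rw [wk]; decide)
    have e : slide k (pat k .Z .Y .X .Z) .XXZ .ZYY = pat k .Z .Y .X .Z := by
      funext i
      simp only [slide, pat, Term.fst, Term.snd, Term.thd]
      grind [Pauli.mul_def, Pauli.mul]
    simp only [sum_term, Term.fst, Term.len, w0, w1, w2, wk, e, reduceCtorEq,
      Nat.reduceEqDiff, Term.snd, Term.thd, Pauli.mul_def, Pauli.mul, Pauli.sign] at this
    norm_num at this
    -- The word slides to itself, but with different coefficients at its two ends.
    have h6 : ((κ .XXZ - κ .ZYY : ℤ) : ℂ) * c (pat k .Z .Y .X .Z) = 0 := by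
      push_cast; linear_combination this
    rcases mul_eq_zero.1 h6 with h | h
    · rw [Int.cast_eq_zero] at h
      omega
    · exact h5 h

end

section

variable {k : ℕ} {κ : Term → ℤ} {c : (ℕ → Pauli) → ℂ}

/-! ### Reflected charges -/

/-- The word `w` of length `k` read backwards. -/
def reverseWord (k : ℕ) (w : ℕ → Pauli) (i : ℕ) : Pauli := if i < k then w (k - 1 - i) else .I

theorem IsWord.reverse {w : ℕ → Pauli} (hk : 1 ≤ k) (hw : IsWord k w) :
    IsWord k (reverseWord k w) := by
  refine ⟨?_, ?_, fun i hi => if_neg (by omega)⟩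
  · rw [reverseWord, if_pos (by omega)]
    exact hw.2.1
  · rw [reverseWord, if_pos (by omega), show k - 1 - (k - 1) = 0 by omega]
    exact hw.1

theorem RingCharge.windowCoeff_reverse {N : ℕ} [NeZero N] {C : (ZMod N → Pauli) → ℂ} (hk : 1 ≤ k)
    (hkN : k ≤ N) (hC : RingCharge N k κ C) {w : ℕ → Pauli} (hw : IsWord k w) :
    windowCoeff N k (fun P => C fun x => P (-x)) (reverseWord k w) = windowCoeff N k C w := by
  have hwide : ∀ v, IsWord k v → ¬ IsWide k v := fun v hv ⟨i, j, hij, _, hj⟩ =>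
    hj (hv.2.2 j (by omega))
  rw [windowCoeff, windowCoeff, if_neg (hwide _ (hw.reverse hk)), if_neg (hwide _ hw),
    ← hC.shift_natCast (fun x => onRing N (reverseWord k w) (-x)) (N - (k - 1))]
  congr 1
  funext x
  have hx := ZMod.val_lt x
  -- The reflection followed by a translation by `k - 1` is `x ↦ k - 1 - x`, the reversal of the
  -- window; `N - (k - 1)` is the translation written with a natural number.
  have e : -(x + ((N - (k - 1) : ℕ) : ZMod N)) =
      ((if x.val < k then k - 1 - x.val else N + (k - 1) - x.val : ℕ) : ZMod N) := by
    rw [Nat.cast_sub (show k - 1 ≤ N by omega)]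
    split_ifs with h
    · rw [Nat.cast_sub (show x.val ≤ k - 1 by omega), ZMod.natCast_val, ZMod.cast_id', id,
        ZMod.natCast_self]
      ring
    · rw [Nat.cast_sub (show x.val ≤ N + (k - 1) by omega), ZMod.natCast_val, ZMod.cast_id', id,
        Nat.cast_add, ZMod.natCast_self]
      ring
  simp only [e, onRing]
  split_ifs with h
  · rw [ZMod.val_natCast_of_lt (by omega), reverseWord, if_pos (by omega),
      show k - 1 - (k - 1 - x.val) = x.val by omega]
  · rw [ZMod.val_natCast_of_lt (by omega), reverseWord, if_neg (by omega), hw.2.2 _ (by omega)]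

/-! ### Only the term `XXZ` is present -/

theorem WindowCharge.last_eq_Z_of_XXZ (hc : WindowCharge k κ c) (hk : 4 ≤ k)
    (hκ : Admissible κ) (ha : κ .XXZ ≠ 0) (hb : κ .YYZ = 0) (hzxx : κ .ZXX = 0) (hzyy : κ .ZYY = 0)
    {w : ℕ → Pauli} (hw : IsWord k w) (he : w (k - 1) ≠ .X) (hcw : c w ≠ 0) :
    w (k - 1) = .Z ∧ k % 2 = 1 ∧ c (altWord k) ≠ 0 := by
  have key : ∀ h, Kept κ h → h = .XXZ := by
    rintro h ⟨k1, k2⟩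
    cases h <;> first | rfl | exact absurd k1 (by decide) | contradiction
  obtain ⟨h', k1, h3, h4, h5⟩ := hc.exists_pat hκ hk hw ⟨rfl, ha⟩ ⟨rfl, ha⟩ he (by decide) hcw _ _
    rfl rfl
  obtain rfl := key h' k1
  by_cases hpar : k % 2 = 1
  · rw [if_pos hpar, if_pos hpar] at h5
    refine ⟨?_, hpar, ?_⟩
    -- The slide reading position `k - 1` meets `w (k - 1) * X`, which must be neither `I` nor `Z`.
    -- This excludes `X` and `Y` as last letters.
    · obtain ⟨D, -, hD, -⟩ := hc.exists_run hκ hk hw (H := fun _ => .XXZ) (fun _ => ⟨rfl, ha⟩) he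
        (fun _ => by decide) hcw (k / 2)
      obtain ⟨h, k1, -, -, -, h6, -⟩ := hD (k / 2 - 1) (by omega)
      obtain rfl := key h k1
      rw [show 2 * (k / 2 - 1) + 2 = k - 1 by omega] at h6
      unfold stream at h6
      rw [if_neg (by omega), if_pos rfl] at h6
      have := hw.2.1
      generalize w (k - 1) = p at *
      revert p; decide
    · rw [altWord_eq_pat hk]
      exact h5
  · rw [if_neg hpar] at h3
    exact absurd h3 (by decide)

/-- Words ending with `X` cannot be slid, since appending `XXZ` would cancel their last letter. They
are treated separately, according to their first letter; this also yields `Shaped`, which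
`altWord_eq_zero` needs. -/
theorem WindowCharge.eq_zero_of_XXZ {c' : (ℕ → Pauli) → ℂ} (hc : WindowCharge k κ c)
    (hc' : WindowCharge k (fun h => κ h.reverse) c')
    (hr : ∀ w, IsWord k w → c' (reverseWord k w) = c w) (hk : 4 ≤ k)
    (h2 : ∀ h : Term, h.len = 2 → κ h = -2) (ha : κ .XXZ ≠ 0) (hb : κ .YYZ = 0)
    (hzxx : κ .ZXX = 0) (hzyy : κ .ZYY = 0) {w : ℕ → Pauli} (hw : IsWord k w) : c w = 0 := by
  have hκ : Admissible κ := ⟨h2, Or.inl ⟨hzxx, hzyy⟩⟩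
  -- words that end with `X`
  have hX : ∀ w, IsWord k w → w (k - 1) = .X → c w = 0 := by
    intro w hw he
    by_cases hi : ∃ i, 1 ≤ i ∧ i ≤ k - 2 ∧ w i ≠ .I
    swap
    · push Not at hi
      exact hc.eq_zero_of_no_interior hκ hk hw hi hw.2.1
    -- `YY` is appended on the right. On the left only `ZZ` could contribute, but it produces a word
    -- that ends with `Y`, and those have coefficient zero because a surviving word not ending with
    -- `X` ends with `Z`.
    by_cases h0 : w 0 = .Z
    · set O : ℕ → Pauli := fun i => if i < k - 1 then w i else if i = k - 1 then .Z
        else if i = k then .Y else .I with hO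
      have O0 : O 0 = .Z := by rw [← h0]; exact if_pos (by omega)
      have Ok1 : O (k - 1) = .Z := by grind
      have Ok : O k = .Y := by grind
      have OI : ∀ i, k < i → O i = .I := by grind
      have := hc.eqn_one (by omega) OI (by rw [O0]; decide) (by rw [Ok]; decide)
      have e1 : Term.YY.act (k - 1) O = w := by
        funext i
        have := hw.2.2 i
        simp only [hO, Term.act, Term.fst, Term.snd, Term.thd]
        grind [Pauli.mul_def, Pauli.mul]
      have e2 : ((κ .ZZ * Term.ZZ.sign .Z (O 1) (O 2) : ℤ) : ℂ) *
          c (fun i => Term.ZZ.act 0 O (i + 1)) = 0 := by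
        by_cases h1 : O 1 = .Z
        · rw [h1, show Term.ZZ.sign .Z .Z (O 2) = 0 from Term.sign_pair rfl _]
          simp
        · rw [mul_eq_zero]
          right
          by_contra hcw
          obtain ⟨v, hv⟩ : ∃ v : ℕ → Pauli, v = fun i => Term.ZZ.act 0 O (i + 1) := ⟨_, rfl⟩
          rw [← hv] at hcw
          have hk1 : v (k - 1) = .Y := by
            rw [hv]
            change Term.ZZ.act 0 O (k - 1 + 1) = .Y
            rw [Term.act_of_ge _ _ (by simp only [Term.len]; omega), Nat.sub_add_cancel (by omega),
              Ok]
          have := (hc.last_eq_Z_of_XXZ hk hκ ha hb hzxx hzyy (w := v)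
            ⟨?_, by rw [hk1]; decide, ?_⟩ (by rw [hk1]; decide) hcw).1
          · rw [hk1] at this
            exact absurd this (by decide)
          · rw [hv]
            change Term.ZZ.act 0 O (0 + 1) ≠ .I
            rw [Term.act_snd, Ne, Pauli.mul_eq_I]
            exact h1
          · intro i hi
            rw [hv]
            change Term.ZZ.act 0 O (i + 1) = .I
            rw [Term.act_of_ge _ _ (by simp only [Term.len]; omega), OI _ (by omega)]
      simp only [sum_term, Term.fst, Term.last, Term.len, O0, Ok, reduceIte, reduceCtorEq,
        Nat.reduceEqDiff, Term.snd, Term.thd, show k + 3 - 2 = k + 1 by omega,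
        OI (k + 1) (by omega), show k + 1 - 2 = k - 1 by omega, show k + 1 - 3 = k - 2 by omega,
        show k + 2 - 3 = k - 1 by omega, Ok1, show k + 2 - 2 = k by omega,
        show k + 3 - 3 = k by omega, e1, e2, hzxx, hzyy, h2 .YY rfl,
        show Term.YY.sign .Z .Y .I = 1 by decide] at this
      norm_num at this
      exact this
    -- Read backwards, the word can be extended by `ZXX`, the only three-site term of the reflected
    -- Hamiltonian. It starts with `X`, so nothing can be removed on the left to balance this.
    · rw [← hr w hw]
      have hw' := hw.reverse (by omega)
      have r0 : reverseWord k w 0 = .X := by rw [reverseWord, if_pos (by omega)]; exact he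
      have rk : reverseWord k w (k - 1) ≠ .Z := by
        rw [reverseWord, if_pos (by omega), show k - 1 - (k - 1) = 0 by omega]
        exact h0
      obtain ⟨i, i1, i2, i3⟩ := hi
      have := hc'.eqn_slide hk (h := .ZXX) hw'.2.2 hw'.1 ⟨k - 1 - i, by omega, by omega, by
        rw [reverseWord, if_pos (by omega), show k - 1 - (k - 1 - i) = i by omega]
        exact i3⟩ rfl rk
      simp only [sum_term, Term.fst, Term.len, r0, reduceCtorEq, Nat.reduceEqDiff, Term.reverse,
        hzxx] at this
      norm_num at this
      refine this.resolve_left (not_or.2 ⟨ha, ?_⟩)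
      exact Pauli.sign_ne_zero hw'.2.1 (by decide) rk
  by_contra hcw
  by_cases he : w (k - 1) = .X
  · exact hcw (hX w hw he)
  obtain ⟨-, hodd, h⟩ := hc.last_eq_Z_of_XXZ hk hκ ha hb hzxx hzyy hw he hcw
  refine h (hc.altWord_eq_zero ?_ (by omega) hodd h2 ha (by rwa [hb, add_zero]))
  intro v hv hcv
  by_cases hev : v (k - 1) = .X
  · exact absurd (hX v hv hev) hcv
  · exact fun i hi hik => hc.shape hκ hk hv (h := .XXZ) ⟨rfl, ha⟩ hev hcv i hi hik

end

section

variable {k : ℕ} {κ : Term → ℤ} {c : (ℕ → Pauli) → ℂ}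

/-! ### Only the terms `XXZ` and `ZXX` are present -/

theorem eq_of_kept (hb : κ .YYZ = 0) (hd : κ .ZYY = 0) {h : Term} (hh : Kept κ h) :
    h = .XXZ ∨ h = .ZXX := by
  obtain ⟨k1, k2⟩ := hh
  cases h <;> first | exact Or.inl rfl | exact Or.inr rfl | exact absurd k1 (by decide) |
    contradiction

theorem exists_kept_fst_ne (ha : κ .XXZ ≠ 0) (hzxx : κ .ZXX ≠ 0) (p : Pauli) :
    ∃ h, Kept κ h ∧ p ≠ h.fst := by
  by_cases hp : p = .X
  · exact ⟨.ZXX, ⟨rfl, hzxx⟩, by rw [hp]; decide⟩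
  · exact ⟨.XXZ, ⟨rfl, ha⟩, hp⟩

/-- No three-site term of this Hamiltonian starts with `Y`, so a slide is impossible. This disposes
of the contributions of `ZZ` at the left end below, where `X * Z = Y` becomes the first letter. -/
theorem WindowCharge.eq_zero_of_head_Y (hc : WindowCharge k κ c) (hk : 4 ≤ k)
    (hκ : Admissible κ) (ha : κ .XXZ ≠ 0) (hzxx : κ .ZXX ≠ 0) (hb : κ .YYZ = 0) (hd : κ .ZYY = 0)
    {w : ℕ → Pauli} (h0 : w 0 = .Y) (h1 : w (k - 1) ≠ .I) (hw : ∀ i, k ≤ i → w i = .I) :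
    c w = 0 := by
  by_contra hcw
  obtain ⟨h, hh, he⟩ := exists_kept_fst_ne ha hzxx (w (k - 1))
  obtain ⟨h', k1, k2, -⟩ := hc.exists_slide hκ hk ⟨by rw [h0]; decide, h1, hw⟩ hh he hcw
  rw [h0] at k2
  rcases eq_of_kept hb hd k1 with rfl | rfl <;> exact absurd k2 (by decide)

/-- The analogue of a slide for words of length `k - 1`: `ZXX` is appended on the right and `h`
removed on the left, in the equation of length `k + 1`. -/
theorem WindowCharge.eq_zero_of_strip (hc : WindowCharge k κ c) (hk : 5 ≤ k)
    (hκ : Admissible κ) (ha : κ .XXZ ≠ 0) (hzxx : κ .ZXX ≠ 0) (hb : κ .YYZ = 0) (hd : κ .ZYY = 0)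
    {h : Term} (hh : h = .XXZ ∨ h = .ZXX) {u : ℕ → Pauli}
    (hu : ∀ i, k - 1 ≤ i → u i = .I) (h0 : u 0 = h.fst) (h1 : u 1 = .X)
    (hl : u (k - 2) ≠ .I) (hl' : u (k - 2) ≠ .Z)
    (hs : ((h.sign h.fst .X (u 2) : ℤ) : ℂ) * c (fun i => if i = 0 then u 2 * h.thd
      else if i < k - 4 then u (i + 2) else if i = k - 4 then u (k - 2) * .Z
      else if i ≤ k - 2 then .X else .I) = 0) : c u = 0 := by
  set O : ℕ → Pauli := fun i => if i < k - 2 then u i else if i = k - 2 then u i * .Z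
    else if i ≤ k then .X else .I with hO
  have O0 : O 0 = h.fst := by rw [← h0]; exact if_pos (by omega)
  have O1 : O 1 = .X := by rw [← h1]; exact if_pos (by omega)
  have O2 : O 2 = u 2 := if_pos (by omega)
  have Ok2 : O (k - 2) = u (k - 2) * .Z := by grind
  have Ok1 : O (k - 1) = .X := by grind
  have Ok : O k = .X := by grind
  have OI : ∀ i, k < i → O i = .I := by grind
  have := hc.eqn_one (by omega) OI (by rw [O0]; exact h.fst_ne) (by rw [Ok]; decide)
  have e1 : Term.ZXX.act (k - 2) O = u := by
    funext i
    have := hu i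
    have := Pauli.mul_mul_self (u (k - 2)) .Z
    simp only [hO, Term.act, Term.fst, Term.snd, Term.thd]
    grind [Pauli.mul_def, Pauli.mul]
  have hs' : Term.ZXX.sign (u (k - 2) * .Z) .X .X ≠ 0 := by
    generalize u (k - 2) = p at hl hl'
    revert p; decide
  have e2 : c (fun i => Term.ZZ.act 0 O (i + 1)) = 0 := by
    refine hc.eq_zero_of_head_Y (by omega) hκ ha hzxx hb hd ?_ ?_ ?_
    · rw [Term.act_snd, O1]; rfl
    · rw [Nat.sub_add_cancel (by omega), Term.act_of_ge _ _ (by simp only [Term.len]; omega), Ok]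
      decide
    · intro i hi
      rw [Term.act_of_ge _ _ (by simp only [Term.len]; omega), OI _ (by omega)]
  have e3 : ((κ h * h.sign h.fst .X (u 2) : ℤ) : ℂ) * c (fun i => h.act 0 O (i + 1)) = 0 := by
    rw [hc.strip OI (by omega) (by rw [O1]; rcases hh with rfl | rfl <;> rfl)]
    rw [Int.cast_mul, mul_assoc]
    refine mul_eq_zero_of_right _ (Eq.trans ?_ hs)
    congr 2
    funext i
    simp only [O2]
    simp only [hO]
    grind
  have e4 : ∀ o, Term.XX.sign .X .X o = 0 := Term.sign_pair rfl
  simp only [sum_term, Term.last, Term.len, O0, O1, O2, Ok, reduceIte, reduceCtorEq,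
    Nat.reduceEqDiff, Term.snd, Term.thd, show k + 3 - 2 = k + 1 by omega,
    OI (k + 1) (by omega), show k + 1 - 2 = k - 1 by omega, show k + 1 - 3 = k - 2 by omega,
    show k + 2 - 3 = k - 1 by omega, Ok1, Ok2, show k + 2 - 2 = k by omega,
    show k + 3 - 3 = k by omega, e1, hd, e4] at this
  rcases hh with rfl | rfl
  · simp only [Term.fst, reduceIte, reduceCtorEq, e4] at this e3
    rw [e3] at this
    simpa [hzxx, hs'] using this
  · simp only [Term.fst, reduceIte, reduceCtorEq, e2] at this e3
    rw [e3] at this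
    simpa [hzxx, hs'] using this

/-- Every strip brings the letter `h.thd` two sites closer to the left end. Once it is at site `2`,
the word begins with `h` itself, which commutes with it, and the chain of equations ends with zero.
-/
theorem WindowCharge.eq_zero_of_hole (hc : WindowCharge k κ c) (hk : 5 ≤ k)
    (hκ : Admissible κ) (ha : κ .XXZ ≠ 0) (hzxx : κ .ZXX ≠ 0) (hb : κ .YYZ = 0) (hd : κ .ZYY = 0)
    {h : Term} (hh : h = .XXZ ∨ h = .ZXX) (j : ℕ) (hj : 2 * j + 5 ≤ k) {u : ℕ → Pauli}
    (hu : ∀ i, k - 1 ≤ i → u i = .I) (h0 : u 0 = h.fst)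
    (hX : ∀ i, i ≤ 2 * j + 1 → i % 2 = 1 → u i = .X)
    (hY : ∀ i, 1 ≤ i → i ≤ 2 * j → i % 2 = 0 → u i = .Y) (hZ : u (2 * j + 2) = h.thd)
    (hl : u (k - 2) ≠ .I) (hl' : u (k - 2) ≠ .Z) : c u = 0 := by
  induction j generalizing u with
  | zero =>
    refine hc.eq_zero_of_strip hk hκ ha hzxx hb hd hh hu h0 (hX 1 (by omega) (by omega)) hl hl' ?_
    rw [show u 2 = h.thd from hZ, show h.sign h.fst .X h.thd = 0 by rcases hh with rfl | rfl <;> decide]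
    simp
  | succ j ih =>
    refine hc.eq_zero_of_strip hk hκ ha hzxx hb hd hh hu h0 (hX 1 (by omega) (by omega)) hl hl' ?_
    rw [hY 2 (by omega) (by omega) (by omega)]
    refine mul_eq_zero_of_right _ (ih (by omega) ?_ ?_ ?_ ?_ ?_ ?_ ?_)
    · intro i hi
      rw [if_neg (by omega), if_neg (by omega), if_neg (by omega), if_neg (by omega)]
    · rw [if_pos rfl]
      rcases hh with rfl | rfl <;> rfl
    · intro i hi hi'
      rw [if_neg (by omega), if_pos (by omega), hX _ (by omega) (by omega)]
    · intro i hi hi' hi2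
      rw [if_neg (by omega), if_pos (by omega), hY _ (by omega) (by omega) (by omega)]
    · rw [if_neg (by omega), if_pos (by omega)]
      exact hZ
    · rw [if_neg (by omega), if_neg (by omega), if_neg (by omega), if_pos le_rfl]; decide
    · rw [if_neg (by omega), if_neg (by omega), if_neg (by omega), if_pos le_rfl]; decide

/-- The alternating words whose first and last letters agree have coefficient zero. -/
theorem WindowCharge.pat_eq_zero (hc : WindowCharge k κ c) (hk : 5 ≤ k) (hodd : k % 2 = 1)
    (hκ : Admissible κ) (ha : κ .XXZ ≠ 0) (hzxx : κ .ZXX ≠ 0) (hb : κ .YYZ = 0) (hd : κ .ZYY = 0)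
    {h : Term} (hh : h = .XXZ ∨ h = .ZXX) : c (pat k h.fst .X .Y h.fst) = 0 := by
  set O : ℕ → Pauli := fun i => if i = 0 then h.fst else if i < k - 1 then
    (if i % 2 = 1 then .X else .Y) else if i = k - 1 then h.fst * .Y else if i = k then .Y else .I
    with hO
  have O0 : O 0 = h.fst := rfl
  have O1 : O 1 = .X := by grind
  have O2 : O 2 = .Y := by grind
  have Ok2 : O (k - 2) = .X := by grind
  have Ok1 : O (k - 1) = h.fst * .Y := by grind
  have Ok : O k = .Y := by grind
  have OI : ∀ i, k < i → O i = .I := by grind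
  have := hc.eqn_one (by omega) OI (by rw [O0]; exact h.fst_ne) (by rw [Ok]; decide)
  have e1 : Term.YY.act (k - 1) O = pat k h.fst .X .Y h.fst := by
    funext i
    have := Pauli.mul_mul_self h.fst .Y
    simp only [hO, pat, Term.act, Term.fst, Term.snd, Term.thd]
    grind [Pauli.mul_def, Pauli.mul]
  have hs : Term.YY.sign (h.fst * .Y) .Y .I ≠ 0 := by rcases hh with rfl | rfl <;> decide
  have e2 : c (fun i => Term.ZZ.act 0 O (i + 1)) = 0 := by
    refine hc.eq_zero_of_head_Y (by omega) hκ ha hzxx hb hd ?_ ?_ ?_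
    · rw [Term.act_snd, O1]; rfl
    · rw [Nat.sub_add_cancel (by omega), Term.act_of_ge _ _ (by simp only [Term.len]; omega), Ok]
      decide
    · intro i hi
      rw [Term.act_of_ge _ _ (by simp only [Term.len]; omega), OI _ (by omega)]
  have e3 : c (fun i => h.act 0 O (i + 1)) = 0 := by
    rw [hc.strip OI (by omega) (by rw [O1]; rcases hh with rfl | rfl <;> rfl)]
    refine hc.eq_zero_of_hole hk hκ ha hzxx hb hd hh ((k - 5) / 2) (by omega) ?_ ?_ ?_ ?_ ?_ ?_ ?_
    · intro i hi
      rw [if_neg (by omega), OI _ (by omega)]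
    · rw [if_pos rfl, O2]
      rcases hh with rfl | rfl <;> rfl
    · intro i hi hi'
      rw [if_neg (by omega)]
      grind
    · intro i hi hi' hi2
      rw [if_neg (by omega)]
      grind
    · rw [if_neg (by omega), show 2 * ((k - 5) / 2) + 2 + 2 = k - 1 by omega, Ok1]
      rcases hh with rfl | rfl <;> rfl
    · rw [if_neg (by omega), Nat.sub_add_cancel (by omega), Ok]; decide
    · rw [if_neg (by omega), Nat.sub_add_cancel (by omega), Ok]; decide
  simp only [sum_term, Term.last, Term.len, O0, O1, O2, Ok, reduceIte, reduceCtorEq,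
    Nat.reduceEqDiff, Term.snd, Term.thd, show k + 3 - 2 = k + 1 by omega,
    OI (k + 1) (by omega), show k + 1 - 2 = k - 1 by omega, show k + 1 - 3 = k - 2 by omega,
    show k + 2 - 3 = k - 1 by omega, Ok1, Ok2, show k + 2 - 2 = k by omega,
    show k + 3 - 3 = k by omega, e1, e2, hd, hκ.two .YY rfl] at this
  rcases hh with rfl | rfl
  · simp only [Term.fst, reduceIte, reduceCtorEq, show Term.XX.sign .X .X .Y = 0 by decide,
      e3] at this hs ⊢
    simpa [hs] using this
  · simp only [Term.fst, reduceIte, reduceCtorEq, e3] at this hs ⊢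
    simpa [hs] using this

/-- For even `k` the second letter read would be `Y`, which no term has. For odd `k` every run ends
in an alternating word with outer letters `X` or `Z`: `X⋯Z` is the alternating word, `Z⋯X` its
reflection, and equal outer letters are covered by `pat_eq_zero`. -/
theorem WindowCharge.eq_zero_of_XXZ_ZXX {c' : (ℕ → Pauli) → ℂ} (hc : WindowCharge k κ c)
    (hc' : WindowCharge k (fun h => κ h.reverse) c')
    (hr : ∀ w, IsWord k w → c' (reverseWord k w) = c w) (hk : 4 ≤ k)
    (h2 : ∀ h : Term, h.len = 2 → κ h = -2) (ha : κ .XXZ ≠ 0) (hzxx : κ .ZXX ≠ 0)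
    (hb : κ .YYZ = 0) (hd : κ .ZYY = 0) {w : ℕ → Pauli} (hw : IsWord k w) : c w = 0 := by
  have hfull := exists_kept_fst_ne ha hzxx
  have hκ : Admissible κ := ⟨h2, Or.inr hfull⟩
  by_contra hcw
  obtain ⟨h, hh, he, hh'⟩ : ∃ h, Kept κ h ∧ w (k - 1) ≠ h.fst ∧ (h = .XXZ ∨ h = .ZXX) := by
    obtain ⟨h, h1, h3⟩ := hfull (w (k - 1))
    exact ⟨h, h1, h3, eq_of_kept hb hd h1⟩
  obtain ⟨h', k1, h3, -, h5⟩ := hc.exists_pat hκ hk hw hh hh he (Term.thd_ne_fst hh.1) hcw _ _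
    rfl rfl
  have k1' := eq_of_kept hb hd k1
  by_cases hpar : k % 2 = 1
  · rw [if_pos hpar, if_pos hpar] at h5
    have hk5 : 5 ≤ k := by omega
    have hA : c (pat k .X .X .Y .Z) = 0 := by
      rw [← altWord_eq_pat hk]
      exact hc.altWord_eq_zero (hc.shaped hκ hk hfull) hk5 hpar h2 ha (by rwa [hb, add_zero])
    have hA' : c (pat k .Z .X .Y .X) = 0 := by
      have hκ' : Admissible fun h => κ h.reverse :=
        ⟨fun h hh => h2 _ (by revert h; decide), Or.inr (exists_kept_fst_ne hzxx ha)⟩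
      have := hc'.altWord_eq_zero (hc'.shaped hκ' hk (exists_kept_fst_ne hzxx ha)) hk5 hpar hκ'.two
        hzxx (by simpa [Term.reverse, hd] using hzxx)
      rw [← this, ← hr _ ⟨by change Pauli.Z ≠ .I; decide, by grind [pat], by grind [pat]⟩]
      congr 1
      funext i
      simp only [reverseWord, pat, altWord, alt]
      grind
    rcases hh' with rfl | rfl <;> rcases k1' with rfl | rfl
    · exact h5 hA
    · exact h5 (hc.pat_eq_zero hk5 hpar hκ ha hzxx hb hd (Or.inr rfl))
    · exact h5 (hc.pat_eq_zero hk5 hpar hκ ha hzxx hb hd (Or.inl rfl))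
    · exact h5 hA'
  · rw [if_neg hpar] at h3
    rcases hh' with rfl | rfl <;> rcases k1' with rfl | rfl <;> exact absurd h3 (by decide)

end

section

variable {N : ℕ} [NeZero N] {k : ℕ} {κ : Term → ℤ} {C : (ZMod N → Pauli) → ℂ}

/-! ### Absence of conserved charges -/

/-- The coefficients of a truncated Fredkin Hamiltonian with at least one of the three-site terms
missing, up to symmetries. -/
structure Truncated (κ : Term → ℤ) : Prop where
  two : ∀ h : Term, h.len = 2 → κ h = -2
  three : ∃ r : ℤ, r ≠ 0 ∧ (κ .XXZ = 0 ∨ κ .XXZ = r) ∧ (κ .YYZ = 0 ∨ κ .YYZ = r) ∧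
    (κ .ZXX = 0 ∨ κ .ZXX = -r) ∧ (κ .ZYY = 0 ∨ κ .ZYY = -r)
  missing : κ .XXZ = 0 ∨ κ .YYZ = 0 ∨ κ .ZXX = 0 ∨ κ .ZYY = 0

theorem Truncated.swap (h : Truncated κ) : Truncated fun t => κ t.swap where
  two t ht := h.two _ (by revert t; decide)
  three := by
    obtain ⟨r, h0, h1, h2, h3, h4⟩ := h.three
    exact ⟨r, h0, h2, h1, h4, h3⟩
  missing := by
    rcases h.missing with h | h | h | h <;> simp [Term.swap, h]

theorem Truncated.reverse (h : Truncated κ) : Truncated fun t => κ t.reverse where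
  two t ht := h.two _ (by revert t; decide)
  three := by
    obtain ⟨r, h0, h1, h2, h3, h4⟩ := h.three
    exact ⟨-r, neg_ne_zero.2 h0, h3, h4, by rw [neg_neg]; exact h1, by rw [neg_neg]; exact h2⟩
  missing := by
    rcases h.missing with h | h | h | h <;> simp [Term.reverse, h]

/-- The signs of the Fredkin terms enter only through `κ .XXZ + κ .YYZ = 2 * r` when both are
present, and through `κ .XXZ = r ≠ -r = κ .ZYY`. -/
theorem RingCharge.vanishesAt_of_XXZ (hk : 4 ≤ k) (hkN : 2 * k ≤ N) (hC : RingCharge N k κ C)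
    (hκ : Truncated κ) (ha : κ .XXZ ≠ 0) (hcd : κ .YYZ ≠ 0 ∨ κ .ZXX = 0 ∨ κ .ZYY = 0) :
    VanishesAt k C := by
  have hc := hC.windowCharge hk hkN
  have hc' := (hC.reverse (by omega) (by omega) (by omega)).windowCharge hk hkN
  have hr := fun w hw => hC.windowCoeff_reverse (by omega) (by omega) (w := w) hw
  refine hC.vanishesAt hk fun w h0 h1 hw => ?_
  have hword : IsWord k w := ⟨h0, h1, hw⟩
  obtain ⟨r, hr0, ra, rb, rc, rd⟩ := hκ.three
  by_cases hb : κ .YYZ = 0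
  · by_cases h3 : κ .ZXX = 0 <;> by_cases h4 : κ .ZYY = 0
    · exact hc.eq_zero_of_XXZ hc' hr hk hκ.two ha hb h3 h4 hword
    · exact hc.eq_zero_of_XXZ_ZYY hk hκ.two ha hb h3 h4 (by omega) hword
    · exact hc.eq_zero_of_XXZ_ZXX hc' hr hk hκ.two ha h3 hb h4 hword
    · simp [hb, h3, h4] at hcd
  · have := hκ.missing
    exact hc.eq_zero_of_XXZ_YYZ hk hκ.two ha hb (by omega) (by omega) hword

/-- The configuration with `XXZ`, `ZXX`, `ZYY` present and `YYZ` missing is the reflection of `XXZ`,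
`YYZ`, `ZXX`, which is already covered. -/
theorem RingCharge.vanishesAt_of_XXZ_or (hk : 4 ≤ k) (hkN : 2 * k ≤ N) (hC : RingCharge N k κ C)
    (hκ : Truncated κ) (ha : κ .XXZ ≠ 0 ∨ κ .ZXX ≠ 0) : VanishesAt k C := by
  have hrev := hC.reverse (by omega) (by omega) (by omega)
  by_cases h : κ .XXZ ≠ 0 ∧ (κ .YYZ ≠ 0 ∨ κ .ZXX = 0 ∨ κ .ZYY = 0)
  · exact hC.vanishesAt_of_XXZ hk hkN hκ h.1 h.2
  · refine VanishesAt.of_reverse (by omega) (by omega)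
      (hrev.vanishesAt_of_XXZ hk hkN hκ.reverse ?_ ?_)
    · simp only [Term.reverse]; tauto
    · simp only [Term.reverse]; tauto

theorem RingCharge.vanishesAt_of_truncated (hk : 4 ≤ k) (hkN : 2 * k ≤ N)
    (hC : RingCharge N k κ C) (hκ : Truncated κ)
    (h : κ .XXZ ≠ 0 ∨ κ .YYZ ≠ 0 ∨ κ .ZXX ≠ 0 ∨ κ .ZYY ≠ 0) : VanishesAt k C := by
  by_cases ha : κ .XXZ ≠ 0 ∨ κ .ZXX ≠ 0
  · exact hC.vanishesAt_of_XXZ_or hk hkN hκ ha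
  · refine VanishesAt.of_swap (hC.swap.vanishesAt_of_XXZ_or hk hkN hκ.swap ?_)
    simp only [Term.swap]; tauto

theorem Truncated.weight {R : Finset ThreeSiteTerm} (hR : R.Nonempty) :
    Truncated (weight R) where
  two h hh := by cases h <;> first | rfl | exact absurd hh (by decide)
  three := ⟨1, one_ne_zero, by simp only [FredkinChain.weight]; split_ifs <;> simp,
    by simp only [FredkinChain.weight]; split_ifs <;> simp,
    by simp only [FredkinChain.weight]; split_ifs <;> simp,
    by simp only [FredkinChain.weight]; split_ifs <;> simp⟩
  missing := by
    obtain ⟨t, ht⟩ := hR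
    cases t <;> simp [FredkinChain.weight, ht]

theorem not_isKLocalConservedCharge {R : Finset ThreeSiteTerm} (hR : R.Nonempty)
    (hR' : R ≠ Finset.univ) (hk : 4 ≤ k) (hkN : 2 * k ≤ N) (Q : Op N) :
    ¬ IsKLocalConservedCharge N k (truncatedFredkin N R) Q := by
  intro hQ
  obtain ⟨C, hC, P, h0, h1, h2, hP⟩ := hQ.exists_ringCharge hk hkN
  have hκ : weight R .XXZ ≠ 0 ∨ weight R .YYZ ≠ 0 ∨ weight R .ZXX ≠ 0 ∨ weight R .ZYY ≠ 0 := by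
    obtain ⟨t, ht⟩ : ∃ t, t ∉ R := by
      by_contra! h
      exact hR' (Finset.eq_univ_iff_forall.2 h)
    cases t <;> simp [weight, ht]
  refine hP (hC.vanishesAt_of_truncated hk hkN (Truncated.weight hR) hκ P 0 h0 ?_ ?_)
  · rwa [zero_add]
  · intro x hx
    rw [sub_zero]
    by_contra h
    exact hx (h2 x (by omega))

end

section

variable {N : ℕ} [NeZero N]

/-! ### A conserved charge of the XXX chain -/

/-- The translation invariant sum of the words `w`. -/
noncomputable def transOp (N : ℕ) [NeZero N] (w : ℕ → Pauli) : Op N :=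
  ∑ j : ZMod N, pauliOp N fun x => onRing N w (x - j)

theorem transOp_shift {w : ℕ → Pauli} {n : ℕ} (hw : ∀ i, n ≤ i → w i = .I) (hn : n ≤ N)
    (h0 : w 0 = .I) : transOp N w = transOp N fun i => w (i + 1) := by
  unfold transOp
  rw [← onRing_add_one hw hn h0]
  refine (Equiv.sum_comp (Equiv.subRight (1 : ZMod N)) _).symm.trans ?_
  refine Finset.sum_congr rfl fun j _ => ?_
  congr 1
  funext x
  simp only [Equiv.subRight_apply]
  congr 1
  ring

omit [NeZero N] in
theorem Term.place_add (h : Term) (j t x : ZMod N) : h.place (j + t) x = h.place t (x - j) := by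
  unfold Term.place
  simp only [sub_eq_iff_eq_add, add_comm, add_assoc]

/-- The leading `I` leaves room for a term that meets the word from the left, so all nonzero
commutators occur at `t < 5` inside the window. -/
theorem bracket_transOp (hN : 7 ≤ N) {w : ℕ → Pauli} (h0 : w 0 = .I) (hw : ∀ i, 5 ≤ i → w i = .I)
    {h : Term} (h2 : h.len = 2) :
    ⁅transOp N w, ∑ i : ZMod N, pauliOp N (h.place i)⁆ = (2 * Complex.I) •
      ∑ t ∈ Finset.range 5, sign₃ ((w t).sign h.fst) ((w (t + 1)).sign h.snd) 0 •
        transOp N (h.act t w) := by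
  have key : ∀ j : ZMod N, ⁅pauliOp N fun x => onRing N w (x - j), ∑ i : ZMod N, pauliOp N (h.place i)⁆
      = (2 * Complex.I) • ∑ t ∈ Finset.range 5, sign₃ ((w t).sign h.fst) ((w (t + 1)).sign h.snd) 0 •
        pauliOp N fun x => onRing N (h.act t w) (x - j) := by
    intro j
    rw [bracket_sum, ← Equiv.sum_comp (Equiv.addLeft j), sum_zmod,
      ← Finset.sum_subset (Finset.range_subset_range.2 (show 5 ≤ N by omega)), Finset.smul_sum]
    · refine Finset.sum_congr rfl fun t ht => ?_
      rw [Finset.mem_range] at ht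
      have c1 : onRing N w ((t : ZMod N) + 1) = w (t + 1) := by
        have := onRing_natCast (N := N) (i := t + 1) (by omega) w
        push_cast at this
        exact this
      rw [Equiv.coe_addLeft, pauliOp_commutator_place (by omega), add_sub_cancel_left,
        show j + (t : ZMod N) + 1 - j = (t : ZMod N) + 1 by ring, c1, onRing_natCast (by omega),
        Term.thd_eq (by omega), Pauli.sign_I, mul_smul, Int.cast_smul_eq_zsmul]
      congr 3
      funext x
      rw [← onRing_mul_place (by omega), Pi.mul_apply, Pi.mul_apply, Term.place_add]
    · intro t ht ht'
      rw [Finset.mem_range] at ht ht'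
      have c1 : onRing N w ((t : ZMod N) + 1) = .I := by
        rcases (by omega : t + 1 < N ∨ t + 1 = N) with h' | h'
        · have := onRing_natCast (N := N) h' w
          push_cast at this
          rw [this, hw _ (by omega)]
        · have : (t : ZMod N) + 1 = 0 := by
            have : ((t + 1 : ℕ) : ZMod N) = 0 := by rw [h']; simp
            exact_mod_cast this
          rw [this, onRing, ZMod.val_zero, h0]
      rw [Equiv.coe_addLeft, pauliOp_commutator_place (by omega), add_sub_cancel_left,
        show j + (t : ZMod N) + 1 - j = (t : ZMod N) + 1 by ring, c1, onRing_natCast (by omega),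
        hw _ (by omega), Term.thd_eq (by omega), Pauli.sign_I, Pauli.I_sign, Pauli.I_sign,
        show sign₃ 0 0 0 = 0 by decide]
      simp
  unfold transOp
  rw [sum_bracket, Finset.sum_congr rfl fun j _ => key j, ← Finset.smul_sum, Finset.sum_comm]
  simp only [Finset.smul_sum]

/-- The letters of a list, followed by `I`. -/
def letters (l : List Pauli) (i : ℕ) : Pauli := l.getD i .I

/-- Moves a letter `I` from the beginning of a list to its end. -/
def rotateHead : List Pauli → List Pauli
  | .I :: l => l ++ [.I]
  | l => l

theorem letters_eq {l : List Pauli} {i : ℕ} (hi : l.length ≤ i) : letters l i = .I := by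
  simp [letters, hi]

theorem length_rotateHead (l : List Pauli) : (rotateHead l).length = l.length := by
  unfold rotateHead
  split <;> simp

theorem transOp_rotateHead {l : List Pauli} (hl : l.length ≤ N) :
    transOp N (letters (rotateHead l)) = transOp N (letters l) := by
  unfold rotateHead
  split
  · rename_i l
    rw [transOp_shift (w := letters (.I :: l)) (fun i hi => letters_eq hi) hl rfl]
    congr 1
    funext i
    simp only [letters, List.getD_cons_succ]
    rcases lt_or_ge i l.length with h | h
    · rw [List.getD_append _ _ _ _ h]
    · rw [List.getD_append_right _ _ _ _ h, List.getD_eq_default _ _ h]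
      rcases Nat.eq_zero_or_pos (i - l.length) with h' | h'
      · simp [h']
      · exact List.getD_eq_default _ _ (by simp only [List.length_singleton]; omega)
  · rfl

theorem transOp_rotateHead_iterate {l : List Pauli} (hl : l.length ≤ N) (n : ℕ) :
    transOp N (letters (rotateHead^[n] l)) = transOp N (letters l) := by
  induction n generalizing l with
  | zero => rfl
  | succ n ih =>
    rw [Function.iterate_succ_apply, ih (by rwa [length_rotateHead]), transOp_rotateHead hl]

/-- The strings of a conserved charge of the XXX chain, with their coefficients. -/
def xxxStrings : List (ℤ × List Pauli) :=
  [(1, [.X, .I, .X]), (1, [.Y, .I, .Y]), (1, [.Z, .I, .Z])] ++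
    ([(.X, .Y), (.Y, .X), (.Y, .Z), (.Z, .Y), (.Z, .X), (.X, .Z)] : List (Pauli × Pauli)).flatMap
      fun p => [(1, [p.1, p.2, p.1, p.2]), (-1, [p.1, p.2, p.2, p.1])]

/-- The strings of the commutator with the Hamiltonian of the XXX chain. -/
def xxxCommutator : List (ℤ × List Pauli) :=
  xxxStrings.flatMap fun e => ([.XX, .YY, .ZZ] : List Term).flatMap fun h =>
    (List.range 5).map fun t =>
      (e.1 * sign₃ ((letters (.I :: e.2) t).sign h.fst) ((letters (.I :: e.2) (t + 1)).sign h.snd) 0,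
        rotateHead^[2] ((List.range 6).map (h.act t (letters (.I :: e.2)))))

/-- Grouping by labels turns an identity between operators into a decidable statement about
integers. -/
theorem sum_smul_eq_zero {α M : Type*} [DecidableEq α] [AddCommGroup M] (G : α → M)
    (l : List (ℤ × α))
    (h : ∀ e ∈ l, (l.map fun e' => if e'.2 = e.2 then e'.1 else 0).sum = 0) :
    (l.map fun e => e.1 • G e.2).sum = 0 := by
  have key : ∀ (s : Finset α) (l : List (ℤ × α)), (∀ e ∈ l, e.2 ∈ s) →
      (l.map fun e => e.1 • G e.2).sum =
        ∑ a ∈ s, (l.map fun e' => if e'.2 = a then e'.1 else 0).sum • G a := by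
    intro s l hl
    induction l with
    | nil => simp
    | cons e l ih =>
      simp only [List.map_cons, List.sum_cons, add_smul, Finset.sum_add_distrib, ite_smul, zero_smul]
      rw [ih fun e' he' => hl e' (List.mem_cons_of_mem _ he'), Finset.sum_ite_eq,
        if_pos (hl e List.mem_cons_self)]
  rw [key (l.map Prod.snd).toFinset l (by simpa using fun a b h => ⟨a, h⟩)]
  refine Finset.sum_eq_zero fun a ha => ?_
  obtain ⟨e, he, rfl⟩ := List.mem_map.1 (List.mem_toFinset.1 ha)
  rw [h e he, zero_smul]

/-- Translates of a string must appear in one normal form to cancel. Two rotations suffice: besides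
the `I` put in front, a term with nonzero sign can erase at most the first letter, since at one of
its sites it anticommutes and leaves a letter other than `I`. -/
theorem xxxCommutator_cancel : ∀ e ∈ xxxCommutator,
    (xxxCommutator.map fun e' => if e'.2 = e.2 then e'.1 else 0).sum = 0 := by
  decide +kernel

end

/-! ### The commutator and the locality of the XXX charge -/

section

variable {N : ℕ} [NeZero N]

/-- A conserved charge of the XXX chain. -/
noncomputable def xxxCharge (N : ℕ) [NeZero N] : Op N :=
  (xxxStrings.map fun e => e.1 • transOp N (letters e.2)).sum

theorem sum_map_bracket {A ι : Type*} [Ring A] (l : List ι) (f : ι → A) (y : A) :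
    ⁅(l.map f).sum, y⁆ = (l.map fun i => ⁅f i, y⁆).sum := by
  induction l with
  | nil => simp [Ring.lie_def]
  | cons i l ih =>
    rw [List.map_cons, List.sum_cons, List.map_cons, List.sum_cons, ← ih]
    simp only [Ring.lie_def, add_mul, mul_add]
    abel

theorem bracket_add {A : Type*} [Ring A] (x y z : A) : ⁅x, y + z⁆ = ⁅x, y⁆ + ⁅x, z⁆ := by
  simp only [Ring.lie_def, add_mul, mul_add]
  abel

theorem sum_map_mul_smul {ι M : Type*} [AddCommGroup M] (r : ℤ) (l : List ι) (f : ι → ℤ)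
    (g : ι → M) :
    (l.map fun i => (r * f i) • g i).sum = r • (l.map fun i => f i • g i).sum := by
  rw [List.smul_sum, List.map_map]
  simp only [Function.comp_def, mul_smul]

theorem sum_map_flatMap {α β M : Type*} [AddCommMonoid M] (l : List α) (f : α → List β)
    (g : β → M) : ((l.flatMap f).map g).sum = (l.map fun a => ((f a).map g).sum).sum := by
  induction l with
  | nil => simp
  | cons i l ih => simp [ih]

theorem letters_map_range {w : ℕ → Pauli} {n : ℕ} (hw : ∀ i, n ≤ i → w i = .I) :
    letters ((List.range n).map w) = w := by
  funext i
  unfold letters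
  rcases lt_or_ge i n with h | h
  · simp [List.getD_eq_getElem?_getD, h]
  · rw [List.getD_eq_default _ _ (by simpa using h), hw i h]

theorem bracket_xxxCharge (hN : 8 ≤ N) : ⁅xxxCharge N, truncatedFredkin N Finset.univ⁆ = 0 := by
  have hH : truncatedFredkin N Finset.univ = (-2 : ℂ) • (([.XX, .YY, .ZZ] : List Term).map fun h =>
      ∑ j : ZMod N, pauliOp N (h.place j)).sum := by
    rw [truncatedFredkin_eq (by omega), Finset.sum_comm, sum_term]
    simp [weight, Finset.smul_sum, add_assoc]
  have hlen : ∀ e ∈ xxxStrings, e.2.length ≤ 4 := by decide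
  have key : ∀ e ∈ xxxStrings, ⁅e.1 • transOp N (letters e.2), truncatedFredkin N Finset.univ⁆ =
      (-4 * Complex.I) • ((([.XX, .YY, .ZZ] : List Term).flatMap fun h => (List.range 5).map fun t =>
      (e.1 * sign₃ ((letters (.I :: e.2) t).sign h.fst) ((letters (.I :: e.2) (t + 1)).sign h.snd) 0,
        rotateHead^[2] ((List.range 6).map (h.act t (letters (.I :: e.2)))))).map
        fun e => e.1 • transOp N (letters e.2)).sum := by
    intro e he
    have hw : ∀ i, 5 ≤ i → letters (.I :: e.2) i = .I := fun i hi =>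
      letters_eq (by have := hlen e he; simp only [List.length_cons]; omega)
    have h1 : ∀ h : Term, h.len = 2 →
        ⁅transOp N (letters (.I :: e.2)), ∑ i : ZMod N, pauliOp N (h.place i)⁆ =
        (2 * Complex.I) • ((List.range 5).map fun t =>
          sign₃ ((letters (.I :: e.2) t).sign h.fst) ((letters (.I :: e.2) (t + 1)).sign h.snd) 0 •
          transOp N (letters (rotateHead^[2] ((List.range 6).map (h.act t (letters (.I :: e.2))))))).sum := by
      intro h h2
      rw [bracket_transOp (by omega) rfl hw h2, ← List.sum_toFinset _ List.nodup_range,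
        List.toFinset_range]
      congr 1
      refine Finset.sum_congr rfl fun t ht => ?_
      rw [Finset.mem_range] at ht
      rw [transOp_rotateHead_iterate (by simp; omega), letters_map_range]
      intro i hi
      rw [h.act_of_ge _ (by omega), hw i (by omega)]
    have h2 : transOp N (letters e.2) = transOp N (letters (.I :: e.2)) := by
      rw [transOp_shift (w := letters (.I :: e.2)) hw (by omega) rfl]
      rfl
    rw [hH, h2, ← Int.cast_smul_eq_zsmul ℂ, smul_bracket_smul, sum_map_flatMap]
    simp only [List.map_cons, List.map_nil, List.sum_cons, List.sum_nil, bracket_add, add_zero,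
      h1 .XX rfl, h1 .YY rfl, h1 .ZZ rfl, List.map_map, Function.comp_def, mul_smul]
    simp only [← smul_add, smul_smul, ← add_assoc]
    rw [sum_map_mul_smul, sum_map_mul_smul, sum_map_mul_smul, ← smul_add, ← smul_add,
      ← Int.cast_smul_eq_zsmul ℂ, smul_smul]
    congr 1
    ring
  unfold xxxCharge
  rw [sum_map_bracket, List.map_congr_left key]
  -- The commutator is `-4 * i` times the sum over `xxxCommutator`: `-2` comes from the Hamiltonian
  -- and `2 * i` from each commutator of Pauli operators.
  have := sum_smul_eq_zero (fun l => transOp N (letters l)) _ xxxCommutator_cancel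
  rw [xxxCommutator, sum_map_flatMap] at this
  have h3 := congrArg (fun x => (-4 * Complex.I) • x) this
  simp only [smul_zero] at h3
  rw [List.smul_sum, List.map_map] at h3
  exact h3

/-- The coefficients of a list of strings. -/
def stringCoeff (s : List (ℤ × List Pauli)) (l : ℕ) (A : Fin l → Pauli) : ℤ :=
  (s.map fun e => if e.2 = List.ofFn A then e.1 else 0).sum

/-- The list `l` is a Pauli string. -/
def IsStringList (l : List Pauli) : Prop := l ≠ [] ∧ IsPauliString l.get

theorem sum_stringOp_eq {k : ℕ} {l : List Pauli} (hl : IsStringList l) (hk : l.length ≤ k) (j : ZMod N) :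
    ∑ m ∈ Finset.Icc 1 k, ∑ A : Fin m → Pauli with IsPauliString A,
      (if l = List.ofFn A then stringOp N j A else 0) =
    pauliOp N fun x => onRing N (letters l) (x - j) := by
  have h1 : 1 ≤ l.length := List.length_pos_iff.2 hl.1
  rw [Finset.sum_eq_single_of_mem l.length (Finset.mem_Icc.2 ⟨h1, hk⟩),
    Finset.sum_eq_single_of_mem l.get (by simpa using hl.2), if_pos (List.ofFn_get l).symm]
  · rw [stringOp]
    congr 1
    funext x
    simp only [onRing, letters]
    split_ifs with h
    · rw [List.getD_eq_getElem _ _ h]; rfl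
    · rw [List.getD_eq_default _ _ (by omega)]
  · intro A _ hA
    rw [if_neg]
    intro h
    refine hA (List.ofFn_injective ?_)
    rw [← h, List.ofFn_get]
  · intro m _ hm
    refine Finset.sum_eq_zero fun A _ => if_neg fun h => hm ?_
    rw [h, List.length_ofFn]

theorem chargeOfCoeffs_stringCoeff {k : ℕ} (s : List (ℤ × List Pauli))
    (hs : ∀ e ∈ s, IsStringList e.2 ∧ e.2.length ≤ k) :
    chargeOfCoeffs N k (fun l A => stringCoeff s l A) =
      (s.map fun e => e.1 • transOp N (letters e.2)).sum := by
  induction s with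
  | nil => simp [chargeOfCoeffs, stringCoeff]
  | cons e s ih =>
    rw [List.map_cons, List.sum_cons, ← ih fun e' he' => hs e' (List.mem_cons_of_mem _ he')]
    obtain ⟨h1, h2⟩ := hs e List.mem_cons_self
    have : transOp N (letters e.2) = chargeOfCoeffs N k fun l A => if e.2 = List.ofFn A then 1 else 0 := by
      unfold transOp chargeOfCoeffs
      rw [Finset.sum_comm]
      refine Finset.sum_congr rfl fun j _ => ?_
      rw [← sum_stringOp_eq h1 h2 j]
      simp only [ite_smul, one_smul, zero_smul]
    rw [this]
    simp only [chargeOfCoeffs, ← Int.cast_smul_eq_zsmul ℂ, Finset.smul_sum, ← Finset.sum_add_distrib,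
      smul_smul, ← add_smul]
    refine Finset.sum_congr rfl fun l _ => Finset.sum_congr rfl fun j _ =>
      Finset.sum_congr rfl fun A _ => ?_
    congr 1
    simp only [stringCoeff, List.map_cons, List.sum_cons]
    push_cast
    split_ifs <;> simp

instance (l : List Pauli) : Decidable (IsStringList l) := by
  unfold IsStringList; infer_instance

theorem isKLocalConservedCharge_xxxCharge (hN : 8 ≤ N) :
    IsKLocalConservedCharge N 4 (truncatedFredkin N Finset.univ) (xxxCharge N) := by
  refine ⟨⟨fun l A => stringCoeff xxxStrings l A, ?_, ![.X, .Y, .X, .Y], by decide, ?_⟩,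
    bracket_xxxCharge hN⟩
  · exact (chargeOfCoeffs_stringCoeff _ (by decide)).symm
  · rw [Int.cast_ne_zero]
    decide

end

end FredkinChain

/-! ### The dichotomy for the truncated Hamiltonians -/

open FredkinChain in
theorem theorem4 (N : ℕ) [NeZero N] (hN : 8 ≤ N) (R : Finset ThreeSiteTerm) (hR : R.Nonempty) :
    (HasNontrivialLocalCharge N (truncatedFredkin N R) ↔ R = Finset.univ) ∧
    (R = Finset.univ → truncatedFredkin N R = xxxHamiltonian N) ∧
    (R ≠ Finset.univ → ∀ k : ℕ, 4 ≤ k → 2 * k ≤ N →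
      ¬ ∃ Q : Op N, IsKLocalConservedCharge N k (truncatedFredkin N R) Q) := by
  refine ⟨⟨?_, ?_⟩, ?_, ?_⟩
  · rintro ⟨k, hk, hkN, Q, hQ⟩
    by_contra h
    exact not_isKLocalConservedCharge hR h hk hkN Q hQ
  · rintro rfl
    exact ⟨4, le_rfl, by omega, xxxCharge N, isKLocalConservedCharge_xxxCharge hN⟩
  · rintro rfl
    simp [truncatedFredkin, xxxHamiltonian]
  · rintro h k hk hkN ⟨Q, hQ⟩
    exact not_isKLocalConservedCharge hR h hk hkN Q hQ
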